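/- **Calculi.** Finite types are $0$ and $(\sigma\tau)$ (functions from $\sigma$ to $\tau$; $\rho\sigma\tau$ means $\rho(\sigma\tau)$), with level $\mathrm{lv}(0)=0$, $\mathrm{lv}(\sigma\tau)=\max\{\mathrm{lv}(\sigma)+1,\mathrm{lv}(\tau)\}$. The set $\mathcal T$ of terms of Gödel's T is built from typed variables (countably infinitely many of each type) and constants $\mathsf 0:0$, $\mathsf S:00$, $\mathsf D_\tau:0\tau\tau\tau$, $\mathsf R_\tau:0(0\tau\tau)\tau\tau$ by typed application and abstraction $\lambda X.B$. The set $\mathcal T'\supseteq\mathcal T$ is obtained by adding terms $\mathsf R_\tau^t$ of type $(0\tau\tau)\tau\tau$ for terms $t$ of type $0$. The one-step reduction $\rhd$ of $\lambda\beta\mathsf R$ on $\mathcal T$ is the closure under application (on either side) and abstraction of $\mathsf D\mathsf 0AB\rhd A$, $\mathsf D(\mathsf St)AB\rhd B$, $\mathsf R\mathsf 0AB\rhd B$, $\mathsf R(\mathsf St)AB\rhd At(\mathsf RtAB)$, and $(\lambda X.A)B\rhd A\{X:=B\}$ provided that no variable bound in $\lambda X.A$ is free in $B$. The reduction of $\lambda\beta\mathsf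 R'$ on $\mathcal T'$ is defined in the same way, but the two $\mathsf R$-rules are replaced by $\mathsf Rt\rhd\mathsf R^t$, $\mathsf R^{\mathsf 0}AB\rhd B$, $\mathsf R^{\mathsf St}AB\rhd At(\mathsf R^tAB)$, and $s\rhd t$ implies $\mathsf R^s\rhd\mathsf R^t$. A term is well-named if in none of its subterms a variable is both free and bound or a binder $\lambda X$ occurs twice. For well-named $A,B$ let $A\rhd_\alpha B$ mean $A\rhd B'=_\alpha B$ for some $B'$. The reduction tree of a well-named term is obtained by exhaustive application of $\rhd_\alpha$; its height is the supremum of the numbers of nodes on its branches. The reduction tree of an arbitrary term is that of any well-named term $\alpha$-equivalent to it. **Ordinals.** For $\alpha=\omega^{\alpha_1}+\dots+\omega^{\alpha_n}<\varepsilon_0$ in Cantor normal form put $\mathrm{no}(\alpha)=n+\mathrm{no}(\alpha_1)+\dots+\mathrm{no}(\alpha_n)$. Let $F_0(x)=2^x$, $F_{n+1}(x)=F_n^{x+1}(x)$ (iteration), $\Phi(x)=F_5(x+100)$, and $$\psi(\alpha)=\max\bigl(\{0\}\cup\{\psi(\beta)+1\mid\beta<\alpha,\ \mathrm{no}(\beta)\le\Phi(\mathrm{no}(\alpha))\}\bigr)\in\mathbb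 N .$$ Ordinal terms are formed from ordinal variables and $0,1,\omega$ by $f+g$, $2^f\cdot g$, $\psi(\omega\cdot f+g)$. Closed ones denote ordinals, with $+,\cdot$ read as natural (Hessenberg) sum and product. A vector of level $n$ is a tuple $\vec h=\langle h_0,\dots,h_n\rangle$ of ordinal terms; a sum of vectors is componentwise, components missing in one summand being omitted; $k\cdot h$ for $k\in\mathbb N$ is the $k$-fold sum. Each variable $X$ of type $\sigma$ has a vector $\vec x=\langle x_0,\dots,x_{\mathrm{lv}(\sigma)}\rangle$ of ordinal variables, all of them distinct. A term is $x$-free if no $x_i$ occurs in it. For $m=\mathrm{lv}(\vec f)>n=\mathrm{lv}(\vec g)$ the vector $\vec f\,\Box\,\vec g$ of level $m$ has components $(\vec f\,\Box\,\vec g)_i=f_i$ for $n<i\le m$; $=2^{(\vec f\Box\vec g)_{i+1}}\cdot(f_i+g_i)$ for $1\le i\le n$; and $=\psi(\omega\cdot(\vec f\,\Box\,\vec g)_1+f_0+g_0+n)$ for $i=0$ (without the summand $n$ if $n=0$). For a variable $X$ let $n=\mathrm{lv}(\vec x)+1$. Let $\mathrm{sz}^x(h)=1$ if $h$ is $x$-free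 or some $x_i$; otherwise $\mathrm{sz}^x(f+g)=\mathrm{sz}^x(\psi(\omega\cdot f+g))=\mathrm{sz}^x(f)+\mathrm{sz}^x(g)+1$ and $\mathrm{sz}^x(2^f\cdot g)=2\,\mathrm{sz}^x(f)+\mathrm{sz}^x(g)+1$. Vectors $\delta^x_ih$ of level $n$ are defined as follows. If $h$ is $x$-free, then $(\delta^x_ih)_i=h+1$ and $(\delta^x_ih)_j=1$ for $j\ne i$. Otherwise $\delta^x_ix_i=\vec1$; $\delta^x_i(f+g)=\delta^x_if+\delta^x_ig+\vec1$; $\delta^x_i(2^f\cdot g)=2\,\delta^x_{i+1}f+\delta^x_ig+\vec1$; and for $h=\psi(\omega\cdot f+g)$ (with $i=0$), $(\delta^x_0h)_0=\psi(\omega\cdot f\{\vec x:=\vec1\}+(\delta^x_0g)_0)$ and $(\delta^x_0h)_j=(\delta^x_1f)_j+(\delta^x_0g)_j$ for $1\le j\le n$. For $\vec h$ of level $m$, $\delta^x\vec h$ is the vector of level $\max\{n,m\}$ with $(\delta^x\vec h)_0=\bigl(2^n\sum_{i\le m}\mathrm{sz}^x(h_i)\bigr)\cdot(\delta^x_0h_0)_0$,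 $(\delta^x\vec h)_j=\sum_{i\le m}(\delta^x_ih_i)_j$ for $0<j\le n$, and $(\delta^x\vec h)_j=h_j$ for $j>n$. Multiple sums associate to the left. The canonical assignment $[\![A]\!]$ of $A\in\mathcal T$ of type $\sigma$ is the vector of level $\mathrm{lv}(\sigma)$ given by $[\![X]\!]=\vec x$, $[\![\mathsf 0]\!]=\langle1\rangle$, $[\![\mathsf S]\!]=\langle1,1\rangle$, $[\![\mathsf D_\tau]\!]=\langle1,\dots,1\rangle$ of level $\mathrm{lv}(\tau)+1$, $[\![\mathsf R_\tau]\!]=\langle2,1,\dots,1,\omega\rangle$ of level $\mathrm{lv}(\tau)+2$ (where $2$ is $1+1$), $[\![BC]\!]=[\![B]\!]\,\Box\,[\![C]\!]$ restricted to the components $\le\mathrm{lv}(\tau)$, where $\tau$ is the type of $BC$, and $[\![\lambda X.G]\!]=\delta^x[\![G]\!]+[\![G]\!]\{\vec x:=\vec1\}$. The closed canonical assignment $\vec a$ of $A$ arises from $[\![A]\!]$ by replacing every ordinal variable by $1$. **Corollary 3.5.** (1) Let $A\in\mathcal T$ and let $\vec a$ be its closed canonical assignment. Then (the value of) $a_0$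 is a natural number, and it is an upper bound of the height of the reduction tree of $A$, both in $\lambda\beta\mathsf R$ and in $\lambda\beta\mathsf R'$. (2) $\lambda\beta\mathsf R$ and $\lambda\beta\mathsf R'$ are strongly normalizing: there is no infinite sequence $A_0\rhd A_1\rhd\cdots$ and no infinite sequence $A_0\rhd_\alpha A_1\rhd_\alpha\cdots$, neither of terms in $\mathcal T$ in $\lambda\beta\mathsf R$ nor of terms in $\mathcal T'$ in $\lambda\beta\mathsf R'$. -/

import Mathlib

namespace GodelT

/-! ### Types, variables and terms -/

/-- Finite types: the type `0` and the function types `(σ τ)`. -/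
inductive FType : Type
  | nat : FType
  | arrow : FType → FType → FType
  deriving DecidableEq

/-- The level of a finite type. -/
def FType.lv : FType → ℕ
  | .nat => 0
  | .arrow σ τ => max (σ.lv + 1) τ.lv

/-- Typed variables (Church style): a variable is a pair of its type and an index, so that there
are countably many variables, infinitely many of each type. -/
abbrev TVar : Type := FType × ℕ

/-- The type `0 τ τ τ` of the case distinction functional `D_τ`. -/
abbrev FType.caseT (τ : FType) : FType := .arrow .nat (.arrow τ (.arrow τ τ))

/-- The type `(0 τ τ) τ τ` of a recursor `R_τ` applied to its recursion argument. -/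
abbrev FType.iterT (τ : FType) : FType :=
  .arrow (.arrow .nat (.arrow τ τ)) (.arrow τ τ)

/-- The extended typed terms (the set `T'`), indexed by their type. The constructor `recSup τ t`
is the term `R_τ^t`. Terms are syntactic objects with named variables, not `α`-classes. -/
inductive Term : FType → Type
  | var (σ : FType) (k : ℕ) : Term σ
  | zero : Term .nat
  | succ : Term (.arrow .nat .nat)
  | caseD (τ : FType) : Term τ.caseT
  | recR (τ : FType) : Term (.arrow .nat τ.iterT)
  | recSup (τ : FType) (t : Term .nat) : Term τ.iterT
  | app {σ τ : FType} (B : Term (.arrow σ τ)) (C : Term σ) : Term τ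
  | lam {σ : FType} (ρ : FType) (k : ℕ) (B : Term σ) : Term (.arrow ρ σ)

namespace Term

/-- `A` belongs to the set `T` of terms of the original calculus: no `R^t` occurs in `A`. -/
def InT : {σ : FType} → Term σ → Prop
  | _, var _ _ => True
  | _, zero => True
  | _, succ => True
  | _, caseD _ => True
  | _, recR _ => True
  | _, recSup _ _ => False
  | _, app B C => InT B ∧ InT C
  | _, lam _ _ B => InT B

/-- Free variables. -/
def FV : {σ : FType} → Term σ → Finset TVar
  | _, var σ k => {(σ, k)}
  | _, zero => ∅
  | _, succ => ∅
  | _, caseD _ => ∅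
  | _, recR _ => ∅
  | _, recSup _ t => FV t
  | _, app B C => FV B ∪ FV C
  | _, lam ρ k B => (FV B).erase (ρ, k)

/-- Bound variables: those `X` for which the binder `λX` occurs. -/
def BV : {σ : FType} → Term σ → Finset TVar
  | _, var _ _ => ∅
  | _, zero => ∅
  | _, succ => ∅
  | _, caseD _ => ∅
  | _, recR _ => ∅
  | _, recSup _ t => BV t
  | _, app B C => BV B ∪ BV C
  | _, lam ρ k B => insert (ρ, k) (BV B)

/-- The number of occurrences of the binder `λX`. -/
def binderCount (X : TVar) : {σ : FType} → Term σ → ℕ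
  | _, var _ _ => 0
  | _, zero => 0
  | _, succ => 0
  | _, caseD _ => 0
  | _, recR _ => 0
  | _, recSup _ t => binderCount X t
  | _, app B C => binderCount X B + binderCount X C
  | _, lam ρ k B => (if (ρ, k) = X then 1 else 0) + binderCount X B

/-- `subst ρ k B A` is `A{X := B}` for the variable `X = (ρ, k)`: the literal replacement of every
free occurrence of `X` by `B`; bound variables are not renamed. -/
def subst (ρ : FType) (k : ℕ) (B : Term ρ) : {σ : FType} → Term σ → Term σ
  | _, var σ m => if h : ρ = σ ∧ k = m then h.1 ▸ B else var σ m
  | _, zero => zero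
  | _, succ => succ
  | _, caseD τ => caseD τ
  | _, recR τ => recR τ
  | _, recSup τ t => recSup τ (subst ρ k B t)
  | _, app C D => app (subst ρ k B C) (subst ρ k B D)
  | _, lam π m C => if (π, m) = (ρ, k) then lam π m C else lam π m (subst ρ k B C)

/-- `IsSubterm B A`: `B` is a subterm of `A`. -/
inductive IsSubterm : {σ τ : FType} → Term σ → Term τ → Prop
  | refl {σ : FType} (A : Term σ) : IsSubterm A A
  | appFun {π σ τ : FType} {A : Term π} {B : Term (.arrow σ τ)} {C : Term σ} :
      IsSubterm A B → IsSubterm A (app B C)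
  | appArg {π σ τ : FType} {A : Term π} {B : Term (.arrow σ τ)} {C : Term σ} :
      IsSubterm A C → IsSubterm A (app B C)
  | lamBody {π ρ σ : FType} {k : ℕ} {A : Term π} {B : Term σ} :
      IsSubterm A B → IsSubterm A (lam ρ k B)
  | supRec {τ : FType} {t : Term .nat} : IsSubterm (recR τ) (recSup τ t)
  | supArg {π τ : FType} {A : Term π} {t : Term .nat} :
      IsSubterm A t → IsSubterm A (recSup τ t)

/-- `A` is well-named: in every subterm, no variable is both free and bound, and no binder `λX`
occurs more than once. -/
def WellNamed {σ : FType} (A : Term σ) : Prop :=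
  ∀ (τ : FType) (B : Term τ), IsSubterm B A →
    Disjoint B.FV B.BV ∧ ∀ X : TVar, B.binderCount X ≤ 1

/-- One `α`-conversion at some address: a subterm `λX.B` is replaced by `λY.B{X := Y}`, where `Y` is
a variable of the same type as `X` that occurs neither free nor bound in `B` (so that no occurrence
of `Y` is captured). -/
inductive AlphaConv : {σ : FType} → Term σ → Term σ → Prop
  | rename {σ : FType} (ρ : FType) (k m : ℕ) (B : Term σ) :
      (ρ, m) ∉ B.FV → (ρ, m) ∉ B.BV →
      AlphaConv (lam ρ k B) (lam ρ m (subst ρ k (var ρ m) B))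
  | appFun {σ τ : FType} {A B : Term (.arrow σ τ)} {C : Term σ} :
      AlphaConv A B → AlphaConv (app A C) (app B C)
  | appArg {σ τ : FType} {A : Term (.arrow σ τ)} {B C : Term σ} :
      AlphaConv B C → AlphaConv (app A B) (app A C)
  | lamBody {ρ σ : FType} {k : ℕ} {A B : Term σ} :
      AlphaConv A B → AlphaConv (lam ρ k A) (lam ρ k B)
  | supArg {τ : FType} {s t : Term .nat} :
      AlphaConv s t → AlphaConv (recSup τ s) (recSup τ t)

/-- `α`-equivalence. -/
def AlphaEq {σ : FType} (A B : Term σ) : Prop :=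
  Relation.EqvGen (fun C D : Term σ => AlphaConv C D) A B

/-! ### One-step reduction -/

/-- One-step reduction of the calculus `λβR` (on terms in `T`). -/
inductive Red : {σ : FType} → Term σ → Term σ → Prop
  | D_zero {τ : FType} (A B : Term τ) : Red (app (app (app (caseD τ) zero) A) B) A
  | D_succ {τ : FType} (t : Term .nat) (A B : Term τ) :
      Red (app (app (app (caseD τ) (app succ t)) A) B) B
  | R_zero {τ : FType} (A : Term (.arrow .nat (.arrow τ τ))) (B : Term τ) :
      Red (app (app (app (recR τ) zero) A) B) B
  | R_succ {τ : FType} (t : Term .nat) (A : Term (.arrow .nat (.arrow τ τ))) (B : Term τ) :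
      Red (app (app (app (recR τ) (app succ t)) A) B)
        (app (app A t) (app (app (app (recR τ) t) A) B))
  | beta {ρ σ : FType} (k : ℕ) (A : Term σ) (B : Term ρ) :
      Disjoint (lam ρ k A).BV B.FV → Red (app (lam ρ k A) B) (subst ρ k B A)
  | appFun {σ τ : FType} {A B : Term (.arrow σ τ)} {C : Term σ} :
      Red A B → Red (app A C) (app B C)
  | appArg {σ τ : FType} {A : Term (.arrow σ τ)} {B C : Term σ} :
      Red B C → Red (app A B) (app A C)
  | xi {ρ σ : FType} {k : ℕ} {A B : Term σ} : Red A B → Red (lam ρ k A) (lam ρ k B)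

/-- One-step reduction of the calculus `λβR'` (on terms in `T'`). -/
inductive Red' : {σ : FType} → Term σ → Term σ → Prop
  | D_zero {τ : FType} (A B : Term τ) : Red' (app (app (app (caseD τ) zero) A) B) A
  | D_succ {τ : FType} (t : Term .nat) (A B : Term τ) :
      Red' (app (app (app (caseD τ) (app succ t)) A) B) B
  | R_sup {τ : FType} (t : Term .nat) : Red' (app (recR τ) t) (recSup τ t)
  | R_zero {τ : FType} (A : Term (.arrow .nat (.arrow τ τ))) (B : Term τ) :
      Red' (app (app (recSup τ zero) A) B) B
  | R_succ {τ : FType} (t : Term .nat) (A : Term (.arrow .nat (.arrow τ τ))) (B : Term τ) :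
      Red' (app (app (recSup τ (app succ t)) A) B)
        (app (app A t) (app (app (recSup τ t) A) B))
  | beta {ρ σ : FType} (k : ℕ) (A : Term σ) (B : Term ρ) :
      Disjoint (lam ρ k A).BV B.FV → Red' (app (lam ρ k A) B) (subst ρ k B A)
  | appFun {σ τ : FType} {A B : Term (.arrow σ τ)} {C : Term σ} :
      Red' A B → Red' (app A C) (app B C)
  | appArg {σ τ : FType} {A : Term (.arrow σ τ)} {B C : Term σ} :
      Red' B C → Red' (app A B) (app A C)
  | xi {ρ σ : FType} {k : ℕ} {A B : Term σ} : Red' A B → Red' (lam ρ k A) (lam ρ k B)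
  | supArg {τ : FType} {s t : Term .nat} : Red' s t → Red' (recSup τ s) (recSup τ t)

/-- The relation `▷_α` on well-named terms that belongs to a one-step reduction `▷`:
`A ▷ B' =_α B` for some `B'`. -/
def AlphaRed {σ : FType} (step : Term σ → Term σ → Prop) (A B : Term σ) : Prop :=
  A.WellNamed ∧ B.WellNamed ∧ ∃ B' : Term σ, step A B' ∧ AlphaEq B' B

end Term

/-- The height of the tree whose root is `a` and in which the children of a node `b` are all `c`
with `step b c`: the supremum of the numbers of nodes on its finite branches
`a = f 0, f 1, …, f n`. It is `⊤` if these numbers are unbounded. -/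
noncomputable def treeHeight {α : Type} (step : α → α → Prop) (a : α) : ℕ∞ :=
  ⨆ (n : ℕ) (_ : ∃ f : ℕ → α, f 0 = a ∧ ∀ i < n, step (f i) (f (i + 1))), ((n + 1 : ℕ) : ℕ∞)

/-- There is no infinite reduction sequence that starts with `a`. -/
def StronglyNormalizing {α : Type} (step : α → α → Prop) (a : α) : Prop :=
  ¬ ∃ f : ℕ → α, f 0 = a ∧ ∀ i, step (f i) (f (i + 1))

/-! ### Ordinals below `ε₀` -/

section Ordinals

open Ordinal

/-- The multiset `{γ₀, …, γₘ}` of the exponents of the Cantor normal form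
`α = ω^γ₀ + ⋯ + ω^γₘ`, `γ₀ ≥ ⋯ ≥ γₘ`. -/
noncomputable def exps (α : Ordinal.{0}) : Multiset Ordinal.{0} :=
  ((CNF ω α).map fun p => Multiset.replicate (Cardinal.toNat p.2.card) p.1).sum

/-- The ordinal `ω^γ₀ + ⋯ + ω^γₘ`, where `γ₀ ≥ ⋯ ≥ γₘ` are the elements of the multiset. -/
noncomputable def ofExps (s : Multiset Ordinal.{0}) : Ordinal.{0} :=
  ((s.sort (· ≥ ·)).map fun γ => ω ^ γ).sum

/-- Natural (Hessenberg) sum. -/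
noncomputable def natSum (α β : Ordinal.{0}) : Ordinal.{0} :=
  ofExps (exps α + exps β)

/-- Natural (Hessenberg) product. -/
noncomputable def natProd (α β : Ordinal.{0}) : Ordinal.{0} :=
  ofExps ((exps α ×ˢ exps β).map fun p => natSum p.1 p.2)

/-- The norm: `no α = m + no γ₁ + ⋯ + no γₘ` for `α = ω^γ₁ + ⋯ + ω^γₘ` in Cantor normal form. For
`α < ε₀` all exponents are smaller than `α`; only such `α` are of interest. -/
noncomputable def no (α : Ordinal.{0}) : ℕ :=
  ((exps α).attach.map fun γ => if _h : γ.1 < α then 1 + no γ.1 else 0).sum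
termination_by α
decreasing_by exact _h

/-- `F₀ x = 2 ^ x`, and `Fₙ₊₁ x` is the `(x + 1)`-fold iterate of `Fₙ` at `x`. -/
def fastF : ℕ → ℕ → ℕ
  | 0, x => 2 ^ x
  | n + 1, x => (fastF n)^[x + 1] x

/-- The number-theoretic function `Φ x = F₅ (x + 100)`. -/
def Phi (x : ℕ) : ℕ := fastF 5 (x + 100)

/-- The collapsing function
`ψ α = max ({0} ∪ {ψ β + 1 | β < α, no β ≤ Φ (no α)})`. For `α < ε₀` the set is finite, so that the
supremum in `ℕ` is its maximum; only such `α` are of interest. -/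
noncomputable def psi (α : Ordinal.{0}) : ℕ :=
  sSup ({0} ∪ {k : ℕ | ∃ (β : Ordinal.{0}) (_h : β < α), no β ≤ Phi (no α) ∧ k = psi β + 1})
termination_by α
decreasing_by exact _h

end Ordinals

/-! ### Ordinal terms -/

/-- Ordinal terms with variables from `V`; `exp2 f g` is `2^f · g`, and `psi f g` is the term
`ψ(ω · f + g)`. A closed term is an element of `OTerm Empty`. -/
inductive OTerm (V : Type) : Type
  | var (v : V) : OTerm V
  | zero : OTerm V
  | one : OTerm V
  | omega : OTerm V
  | add (f g : OTerm V) : OTerm V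
  | exp2 (f g : OTerm V) : OTerm V
  | psi (f g : OTerm V) : OTerm V

/-- Ordinal variables: for `X` of type `σ` the variables `x₀, …, x_{lv σ}`. -/
abbrev OVar : Type := Σ X : TVar, Fin (X.1.lv + 1)

namespace OTerm

/-- Simultaneous substitution. -/
def bind {V W : Type} (s : V → OTerm W) : OTerm V → OTerm W
  | var v => s v
  | zero => zero
  | one => one
  | omega => omega
  | add f g => add (bind s f) (bind s g)
  | exp2 f g => exp2 (bind s f) (bind s g)
  | psi f g => psi (bind s f) (bind s g)

/-- The canonical interpretation of closed ordinal terms, where `+` and `·` are the natural sum and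
product. -/
noncomputable def interp : OTerm Empty → Ordinal.{0}
  | zero => 0
  | one => 1
  | omega => Ordinal.omega0
  | add f g => natSum (interp f) (interp g)
  | exp2 f g => natProd ((2 : Ordinal.{0}) ^ interp f) (interp g)
  | psi f g => (GodelT.psi (natSum (natProd Ordinal.omega0 (interp f)) (interp g)) : ℕ)

/-- Some component `xᵢ` of the variable vector of `X` occurs; `h` is `x`-free iff this is
`false`. -/
def occurs (X : TVar) : OTerm OVar → Bool
  | var v => decide (v.1 = X)
  | zero => false
  | one => false
  | omega => false
  | add f g => occurs X f || occurs X g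
  | exp2 f g => occurs X f || occurs X g
  | psi f g => occurs X f || occurs X g

/-- `h{x := 1}`: every component of the variable vector of `X` is replaced by `1`. -/
def substOne (X : TVar) (h : OTerm OVar) : OTerm OVar :=
  h.bind fun v => if v.1 = X then one else var v

/-- `n · h`, the `n`-fold sum of `h`. -/
def nmul {V : Type} : ℕ → OTerm V → OTerm V
  | 0, _ => zero
  | 1, h => h
  | n + 2, h => add (nmul (n + 1) h) h

/-- The sum `h 0 + ⋯ + h m`. -/
def sumTo {V : Type} (h : ℕ → OTerm V) : ℕ → OTerm V
  | 0 => h 0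
  | m + 1 => add (sumTo h m) (h (m + 1))

/-- The size `sz^x`. -/
def sz (X : TVar) : OTerm OVar → ℕ
  | add f g => if occurs X (add f g) then sz X f + sz X g + 1 else 1
  | psi f g => if occurs X (psi f g) then sz X f + sz X g + 1 else 1
  | exp2 f g => if occurs X (exp2 f g) then 2 * sz X f + sz X g + 1 else 1
  | _ => 1

/-- `deltaPart X h i j` is the component `(δ^x_i h)_j` (for `j ≤ lv x + 1`). It is of interest for
terms `h` of the class `C^x_i` only: there a term `ψ(ω · f + g)` that is not `x`-free has `i = 0`,
and the constants are `x`-free. -/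
def deltaPart (X : TVar) : OTerm OVar → ℕ → ℕ → OTerm OVar
  | var v, i, j =>
      if occurs X (var v) then one else if i = j then add (var v) one else one
  | zero, i, j => if i = j then add zero one else one
  | one, i, j => if i = j then add one one else one
  | omega, i, j => if i = j then add omega one else one
  | add f g, i, j =>
      if occurs X (add f g) then add (add (deltaPart X f i j) (deltaPart X g i j)) one
      else if i = j then add (add f g) one else one
  | exp2 f g, i, j =>
      if occurs X (exp2 f g) then
        add (add (nmul 2 (deltaPart X f (i + 1) j)) (deltaPart X g i j)) one
      else if i = j then add (exp2 f g) one else one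
  | psi f g, i, j =>
      if occurs X (psi f g) then
        if j = 0 then psi (substOne X f) (deltaPart X g 0 0)
        else add (deltaPart X f 1 j) (deltaPart X g 0 j)
      else if i = j then add (psi f g) one else one

end OTerm

/-! ### Ordinal vectors -/

/-- A vector of level `lv`, i.e. an `(lv + 1)`-tuple of ordinal terms. -/
structure OVec (V : Type) where
  lv : ℕ
  comp : Fin (lv + 1) → OTerm V

namespace OVec

variable {V W : Type}

/-- The component `hᵢ`, which is `0` for `i > lv h`. -/
def get (h : OVec V) (i : ℕ) : OTerm V :=
  if hi : i < h.lv + 1 then h.comp ⟨i, hi⟩ else .zero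

/-- The vector `⟨c 0, …, c l⟩` of level `l`. -/
def mk' (l : ℕ) (c : ℕ → OTerm V) : OVec V := ⟨l, fun i => c i⟩

/-- Restriction to the components `0, …, l`. -/
def restrict (l : ℕ) (h : OVec V) : OVec V := mk' l h.get

/-- Replacement of terms in all components. -/
def map (s : OTerm V → OTerm W) (h : OVec V) : OVec W := ⟨h.lv, fun i => s (h.comp i)⟩

/-- Componentwise sum. A component that only one of the vectors has is kept as it is, without a
summand `0`. -/
def add (f g : OVec V) : OVec V :=
  mk' (max f.lv g.lv) fun i =>
    if g.lv < i then f.get i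
    else if f.lv < i then g.get i
    else .add (f.get i) (g.get i)

/-- The components `(f □ g)_i` for `i ≥ 1`. -/
def boxPos (f g : OVec V) (i : ℕ) : OTerm V :=
  if i ≤ g.lv then .exp2 (boxPos f g (i + 1)) (.add (f.get i) (g.get i)) else f.get i
termination_by g.lv + 1 - i

/-- The operator `f □ g` (for `lv f > lv g`). In the component `0` there is no summand `n` if
`n = lv g = 0`. -/
def box (f g : OVec V) : OVec V :=
  mk' f.lv fun i =>
    if i = 0 then
      .psi (boxPos f g 1)
        (if g.lv = 0 then .add (f.get 0) (g.get 0)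
          else .add (.add (f.get 0) (g.get 0)) (.nmul g.lv .one))
    else boxPos f g i

/-- The norm controlling factor `S^x(h) = 2^n · (sz^x(h₀) + ⋯ + sz^x(hₘ))`, `n = lv x + 1`. -/
def normFactor (X : TVar) (h : OVec OVar) : ℕ :=
  2 ^ (X.1.lv + 1) * ∑ i ∈ Finset.range (h.lv + 1), (h.get i).sz X

/-- The operator `δ^x`. -/
def delta (X : TVar) (h : OVec OVar) : OVec OVar :=
  mk' (max (X.1.lv + 1) h.lv) fun j =>
    if j = 0 then .nmul (normFactor X h) (OTerm.deltaPart X (h.get 0) 0 0)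
    else if j ≤ X.1.lv + 1 then OTerm.sumTo (fun i => OTerm.deltaPart X (h.get i) i j) h.lv
    else h.get j

end OVec

/-! ### The canonical assignment -/

/-- The canonical assignment `[[A]]` of an ordinal vector of level `lv σ` to a term `A` of type `σ`.
It is of interest for terms in `T`; the clause for `R^t` is not used there. -/
def canon : {σ : FType} → Term σ → OVec OVar
  | _, .var σ k => ⟨σ.lv, fun i => .var ⟨(σ, k), i⟩⟩
  | _, .zero => .mk' 0 fun _ => .one
  | _, .succ => .mk' 1 fun _ => .one
  | _, .caseD τ => .mk' (τ.lv + 1) fun _ => .one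
  | _, .recR τ => .mk' (τ.lv + 2) fun i =>
      if i = 0 then .add .one .one else if i = τ.lv + 2 then .omega else .one
  | _, .recSup τ t => .mk' (τ.lv + 2) fun i =>
      if i = 0 ∨ i = τ.lv + 2 then (canon t).get 0 else .one
  | τ, .app B C => ((canon B).box (canon C)).restrict τ.lv
  | _, .lam ρ k G =>
      ((canon G).delta (ρ, k)).add ((canon G).map (OTerm.substOne (ρ, k)))

/-- The closed canonical assignment: all ordinal variables of `[[A]]` are replaced by `1`. -/
def closedCanon {σ : FType} (A : Term σ) : OVec Empty :=
  (canon A).map (OTerm.bind fun _ => .one)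

end GodelT

namespace GodelT
open Ordinal

/-! ### Ordinals as finite multisets of exponents -/

/-! A term receives vectors of ordinals below `ε₀` whose component `0` is a positive natural number.
If `A ▷ B`, every assignment to `A` yields an assignment to `B` that is smaller in component `0` and
nowhere larger (`Assign.red`, `Assign.red'`). So component `0` of any assignment bounds the number
of nodes on each branch, and infinite reductions are impossible. Assignments are invariant under
`α`-conversion (`Assign.alphaEq_iff`), hence the same holds for `▷_α`.

The assignment is a relation, not a function of the term. The operator `δ^x` is built so that
`[[G]]` with `x` valued by `b` lies below `(δ^x[[G]] + e) □ b`, which settles `β`; but there is no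
reason for `δ^x[[G]]` to decrease when `G` is reduced. Therefore an assignment to `λX.G` stores any
family `d` that dominates the current assignment `g` to `G` in this way. Reducing inside `G` keeps
`d` and lowers only the summand `g(1)` (`Assign.lam_body`); contracting the redex uses the
domination (`Assign.beta`). The canonical assignment is the case `d = δ^x[[G]]` (`assign_canon`),
whose content is the domination proved in `prec_veval_delta`.

The comparison `ψ α < ψ β` needs `α < β` and a bound on the norm of `α`. The bound comes from the
invariant `Good`: component `0` dominates the norms of all components, while `Phi` outgrows the
iterated exponentials by which `□` can enlarge norms. Moreover `ψ(α + ψ β) ≤ ψ(α + β)`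
(`Psi_add_Psi_le`), so nested values of `ψ` can be replaced by their arguments. This handles the
hard rule `R^{St}AB ▷ At(R^tAB)` (`prec_rec`): `St` is worth at least `3` more than `t`, so the
power `2^t` at the top component of `R^t` gains a factor `8`, and the gain propagates downwards.

In `λβR` the term `R t` may also be treated like `R^t`; the flag `p` of `Assign` permits this, and
one canonical assignment serves both calculi. A term with subterms `R^t` is a reduct in `λβR'` of a
term in `T` and inherits an assignment from it (`exists_assign`). -/

theorem sort_add_of_ge {s t : Multiset Ordinal.{0}} (h : ∀ x ∈ s, ∀ y ∈ t, y ≤ x) :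
    (s + t).sort (· ≥ ·) = s.sort (· ≥ ·) ++ t.sort (· ≥ ·) := by
  refine List.Perm.eq_of_pairwise' (r := (· ≥ ·)) (Multiset.pairwise_sort _ _) ?_ ?_
  · refine List.pairwise_append.2 ⟨Multiset.pairwise_sort _ _, Multiset.pairwise_sort _ _, ?_⟩
    intro a ha b hb
    exact h a (by simpa using ha) b (by simpa using hb)
  · rw [← Multiset.coe_eq_coe, ← Multiset.coe_add]
    simp

theorem ofExps_add_of_ge {s t : Multiset Ordinal.{0}} (h : ∀ x ∈ s, ∀ y ∈ t, y ≤ x) :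
    ofExps (s + t) = ofExps s + ofExps t := by
  simp [ofExps, sort_add_of_ge h]

@[simp] theorem ofExps_zero : ofExps 0 = 0 := by simp [ofExps]

@[simp] theorem ofExps_singleton (a : Ordinal.{0}) : ofExps {a} = ω ^ a := by simp [ofExps]

theorem ofExps_cons {a : Ordinal.{0}} {s : Multiset Ordinal.{0}} (h : ∀ x ∈ s, x ≤ a) :
    ofExps (a ::ₘ s) = ω ^ a + ofExps s := by
  rw [← Multiset.singleton_add, ofExps_add_of_ge (by simpa using h), ofExps_singleton]

theorem sum_omega_lt (l : List Ordinal.{0}) {c : Ordinal.{0}} (h : ∀ x ∈ l, x < c) :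
    (l.map fun γ => ω ^ γ).sum < ω ^ c := by
  induction l with
  | nil => simpa using opow_pos c omega0_pos
  | cons a l ih =>
    simp only [List.map_cons, List.sum_cons]
    refine isPrincipal_add_omega0_opow c ?_ (ih fun x hx => h x (by simp [hx]))
    exact (opow_lt_opow_iff_right one_lt_omega0).2 (h a (by simp))

theorem ofExps_lt {s : Multiset Ordinal.{0}} {c : Ordinal.{0}} (h : ∀ x ∈ s, x < c) :
    ofExps s < ω ^ c :=
  sum_omega_lt _ fun x hx => h x (by simpa using hx)

theorem dvd_sum_omega (l : List Ordinal.{0}) {d : Ordinal.{0}} (h : ∀ x ∈ l, d ≤ x) :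
    ω ^ d ∣ (l.map fun γ => ω ^ γ).sum := by
  induction l with
  | nil => simp
  | cons a l ih =>
    simp only [List.map_cons, List.sum_cons]
    exact dvd_add (opow_dvd_opow _ (h a (by simp))) (ih fun x hx => h x (by simp [hx]))

theorem le_sum_omega (l : List Ordinal.{0}) {d : Ordinal.{0}} (h : d ∈ l) :
    ω ^ d ≤ (l.map fun γ => ω ^ γ).sum := by
  induction l with
  | nil => simp at h
  | cons a l ih =>
    simp only [List.map_cons, List.sum_cons]
    rcases List.mem_cons.1 h with rfl | h
    · exact le_self_add
    · exact (ih h).trans le_add_self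

theorem opow_le_ofExps {s : Multiset Ordinal.{0}} {d : Ordinal.{0}} (h : d ∈ s) :
    ω ^ d ≤ ofExps s :=
  le_sum_omega _ (by simpa using h)

/-- Exponents `≥ d` contribute a multiple of `ω ^ d`, the smaller ones a remainder below `ω ^ d`.
One more `d` is placed between the two groups and raises the quotient by `1`. Hence inserting an
exponent preserves strict inequalities. -/
theorem ofExps_split (d : Ordinal.{0}) (s : Multiset Ordinal.{0}) :
    ∃ q r : Ordinal.{0}, r < ω ^ d ∧ ofExps s = ω ^ d * q + r ∧
      ofExps (d ::ₘ s) = ω ^ d * (q + 1) + r := by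
  set s₁ := s.filter (d ≤ ·)
  set s₂ := s.filter (¬ d ≤ ·)
  have hs : s = s₁ + s₂ := (Multiset.filter_add_not _ _).symm
  have h₁ : ∀ x ∈ s₁, d ≤ x := fun x hx => (Multiset.mem_filter.1 hx).2
  have h₂ : ∀ x ∈ s₂, x < d := fun x hx => not_le.1 (Multiset.mem_filter.1 hx).2
  obtain ⟨q, hq⟩ : ω ^ d ∣ ofExps s₁ := dvd_sum_omega _ fun x hx => h₁ x (by simpa using hx)
  refine ⟨q, ofExps s₂, ofExps_lt h₂, ?_, ?_⟩
  · rw [hs, ofExps_add_of_ge (fun x hx y hy => (h₂ y hy).le.trans (h₁ x hx)), ← hq]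
  · have : d ::ₘ s = s₁ + d ::ₘ s₂ := by rw [hs]; simp
    rw [this, ofExps_add_of_ge, ofExps_cons fun x hx => (h₂ x hx).le, hq, mul_add, mul_one,
      add_assoc]
    intro x hx y hy
    rcases Multiset.mem_cons.1 hy with rfl | hy
    · exact h₁ x hx
    · exact (h₂ y hy).le.trans (h₁ x hx)

theorem mul_add_lt_mul_add {b q q' r r' : Ordinal.{0}} (hr : r < b)
    (h : q < q' ∨ q = q' ∧ r < r') : b * q + r < b * q' + r' := by
  rcases h with h | ⟨rfl, h⟩
  · calc b * q + r < b * q + b := by gcongr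
      _ = b * (q + 1) := by rw [mul_add, mul_one]
      _ ≤ b * q' := by gcongr; exact Order.add_one_le_of_lt h
      _ ≤ b * q' + r' := le_self_add
  · gcongr

theorem ofExps_cons_lt_cons {s t : Multiset Ordinal.{0}} (d : Ordinal.{0})
    (h : ofExps s < ofExps t) : ofExps (d ::ₘ s) < ofExps (d ::ₘ t) := by
  obtain ⟨q, r, hr, hs, hs'⟩ := ofExps_split d s
  obtain ⟨q', r', hr', ht, ht'⟩ := ofExps_split d t
  rw [hs', ht']
  rw [hs, ht] at h
  refine mul_add_lt_mul_add hr ?_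
  rcases lt_trichotomy q q' with hq | rfl | hq
  · exact .inl (Order.lt_add_one_iff.2 (Order.add_one_le_of_lt hq))
  · exact .inr ⟨rfl, by simpa using h⟩
  · exact absurd h (mul_add_lt_mul_add hr' (.inl hq)).not_gt

/-- `s` arises from `t` by replacing an element `c` (and possibly more) by smaller ones. -/
def MLt (s t : Multiset Ordinal.{0}) : Prop :=
  ∃ u s' t' c, s = u + s' ∧ t = u + (c ::ₘ t') ∧ ∀ x ∈ s', x < c

theorem MLt.ofExps_lt {s t : Multiset Ordinal.{0}} (h : MLt s t) : ofExps s < ofExps t := by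
  obtain ⟨u, s', t', c, rfl, rfl, h⟩ := h
  induction u using Multiset.induction_on with
  | empty =>
    rw [zero_add, zero_add]
    exact (GodelT.ofExps_lt h).trans_le (opow_le_ofExps (by simp))
  | cons d u ih =>
    rw [Multiset.cons_add, Multiset.cons_add]
    exact ofExps_cons_lt_cons d ih

theorem exists_max_mem {s : Multiset Ordinal.{0}} (hs : s ≠ 0) : ∃ c ∈ s, ∀ x ∈ s, x ≤ c := by
  have hs' : s.toFinset.Nonempty := by simpa [Finset.nonempty_iff_ne_empty] using hs
  obtain ⟨c, hc, h⟩ := Finset.exists_max_image s.toFinset id hs'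
  exact ⟨c, by simpa using hc, fun x hx => h x (by simpa using hx)⟩

/-- After cancelling `s ∩ t` the two remainders are disjoint, so the larger of their maxima belongs
to only one of them and strictly exceeds everything in the other. -/
theorem MLt.trichotomy (s t : Multiset Ordinal.{0}) : MLt s t ∨ s = t ∨ MLt t s := by
  have hs : s = s ∩ t + (s - t) := by rw [add_comm, Multiset.sub_add_inter]
  have ht : t = s ∩ t + (t - s) := by rw [add_comm, Multiset.inter_comm, Multiset.sub_add_inter]
  have hd : ∀ x ∈ s - t, x ∉ t - s := by
    intro x h₁ h₂
    rw [← Multiset.count_pos, Multiset.count_sub] at h₁ h₂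
    omega
  by_cases h₁ : s - t = 0
  · by_cases h₂ : t - s = 0
    · exact .inr (.inl (by rw [hs, h₁, add_zero]; nth_rewrite 2 [ht]; rw [h₂, add_zero]))
    · obtain ⟨c, hc, -⟩ := exists_max_mem h₂
      obtain ⟨t', ht'⟩ := Multiset.exists_cons_of_mem hc
      exact .inl ⟨s ∩ t, 0, t', c, by rw [← h₁]; exact hs, by rw [← ht']; exact ht, by simp⟩
  · obtain ⟨c, hc, hcm⟩ := exists_max_mem h₁
    obtain ⟨s', hs'⟩ := Multiset.exists_cons_of_mem hc
    by_cases h : ∀ x ∈ t - s, x < c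
    · exact .inr (.inr ⟨s ∩ t, t - s, s', c, ht, by rw [← hs']; exact hs, h⟩)
    · push Not at h
      obtain ⟨x, hx, hcx⟩ := h
      obtain ⟨t', ht'⟩ := Multiset.exists_cons_of_mem hx
      refine .inl ⟨s ∩ t, s - t, t', x, hs, by rw [← ht']; exact ht, fun y hy => ?_⟩
      exact ((hcm y hy).trans hcx).lt_of_ne fun e => hd y hy (e ▸ hx)

theorem ofExps_lt_iff {s t : Multiset Ordinal.{0}} : ofExps s < ofExps t ↔ MLt s t := by
  refine ⟨fun h => ?_, MLt.ofExps_lt⟩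
  rcases MLt.trichotomy s t with h' | rfl | h'
  · exact h'
  · exact absurd h (lt_irrefl _)
  · exact absurd h h'.ofExps_lt.not_gt

theorem ofExps_injective : Function.Injective ofExps := by
  intro s t h
  rcases MLt.trichotomy s t with h' | rfl | h'
  · exact absurd h h'.ofExps_lt.ne
  · rfl
  · exact absurd h h'.ofExps_lt.ne'

theorem ofExps_replicate (n : ℕ) (a : Ordinal.{0}) :
    ofExps (Multiset.replicate n a) = ω ^ a * n := by
  induction n with
  | zero => simp
  | succ n ih =>
    rw [Multiset.replicate_succ, ofExps_cons fun x hx => (Multiset.eq_of_mem_replicate hx).le, ih,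
      Nat.cast_succ, ← mul_one_add]
    congr 1
    exact_mod_cast congrArg Nat.cast (add_comm 1 n)

theorem ofExps_exps (α : Ordinal.{0}) : ofExps (exps α) = α := by
  -- The induction runs over arbitrary lists with weakly decreasing exponents and finite
  -- coefficients, a property that tails inherit.
  have key : ∀ l : List (Ordinal.{0} × Ordinal.{0}), (l.map Prod.fst).Pairwise (· ≥ ·) →
      (∀ p ∈ l, p.2 < ω) →
      ofExps ((l.map fun p => Multiset.replicate (Cardinal.toNat p.2.card) p.1).sum) =
        l.foldr (fun p r ↦ ω ^ p.1 * p.2 + r) 0 := by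
    intro l
    induction l with
    | nil => simp
    | cons p l ih =>
      intro h₁ h₂
      simp only [List.map_cons, List.sum_cons, List.foldr_cons, List.pairwise_cons] at h₁ ⊢
      rw [ofExps_add_of_ge, ih h₁.2 fun q hq => h₂ q (by simp [hq]), ofExps_replicate]
      · obtain ⟨n, hn⟩ := lt_omega0.1 (h₂ p (by simp))
        simp [hn]
      · intro x hx y hy
        rw [Multiset.eq_of_mem_replicate hx]
        refine h₁.1 y ?_
        have : ∀ l : List (Ordinal.{0} × Ordinal.{0}),
            y ∈ (l.map fun p => Multiset.replicate (Cardinal.toNat p.2.card) p.1).sum →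
            y ∈ l.map Prod.fst := by
          intro l
          induction l with
          | nil => simp
          | cons q l ih =>
            intro h
            rw [List.map_cons, List.sum_cons, Multiset.mem_add] at h
            rcases h with h | h
            · simp [Multiset.eq_of_mem_replicate h]
            · exact List.mem_cons_of_mem _ (ih h)
        exact this l hy
  rw [exps, key _ (CNF.sortedGT ω α).sortedGE.pairwise fun p hp => CNF.snd_lt one_lt_omega0 hp]
  exact CNF.foldr ω α

theorem exps_ofExps (s : Multiset Ordinal.{0}) : exps (ofExps s) = s :=
  ofExps_injective (ofExps_exps _)

/-! ### Order, natural sum and natural product in terms of exponents. -/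

theorem lt_iff_exps {α β : Ordinal.{0}} : α < β ↔ MLt (exps α) (exps β) := by
  rw [← ofExps_lt_iff, ofExps_exps, ofExps_exps]

theorem exps_natSum (α β : Ordinal.{0}) : exps (natSum α β) = exps α + exps β := exps_ofExps _

theorem exps_injective : Function.Injective exps := fun α β h => by
  rw [← ofExps_exps α, h, ofExps_exps]

@[simp] theorem exps_zero : exps 0 = 0 := by rw [← ofExps_zero, exps_ofExps]

theorem exps_opow (a : Ordinal.{0}) : exps (ω ^ a) = {a} := by
  rw [← ofExps_singleton, exps_ofExps]

theorem exps_opow_mul (a : Ordinal.{0}) (n : ℕ) : exps (ω ^ a * n) = Multiset.replicate n a := by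
  rw [← ofExps_replicate, exps_ofExps]

@[simp] theorem exps_natCast (n : ℕ) : exps n = Multiset.replicate n 0 := by
  simpa using exps_opow_mul 0 n

@[simp] theorem exps_one : exps 1 = {0} := by simpa using exps_natCast 1

@[simp] theorem exps_omega : exps ω = {1} := by simpa using exps_opow 1

theorem natSum_comm (α β : Ordinal.{0}) : natSum α β = natSum β α := by
  rw [natSum, natSum, add_comm]

theorem natSum_assoc (α β γ : Ordinal.{0}) :
    natSum (natSum α β) γ = natSum α (natSum β γ) :=
  exps_injective (by simp only [exps_natSum, add_assoc])

theorem zero_natSum (α : Ordinal.{0}) : natSum 0 α = α :=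
  exps_injective (by simp [exps_natSum])

theorem natSum_lt_natSum_left {α β : Ordinal.{0}} (γ : Ordinal.{0}) (h : α < β) :
    natSum γ α < natSum γ β := by
  rw [lt_iff_exps] at h ⊢
  obtain ⟨u, s, t, c, hs, ht, h⟩ := h
  rw [exps_natSum, exps_natSum, hs, ht, ← add_assoc, ← add_assoc]
  exact ⟨_, s, t, c, rfl, rfl, h⟩

theorem exps_natProd (α β : Ordinal.{0}) :
    exps (natProd α β) = (exps α).bind fun a => (exps β).map fun b => natSum a b := by
  rw [natProd, exps_ofExps]
  change Multiset.map _ ((exps α).bind fun a => (exps β).map (Prod.mk a)) = _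
  simp [Multiset.map_bind, Multiset.map_map]

theorem natProd_comm (α β : Ordinal.{0}) : natProd α β = natProd β α :=
  exps_injective (by
    rw [exps_natProd, exps_natProd, Multiset.bind_map_comm]
    simp only [natSum_comm])

theorem natProd_assoc (α β γ : Ordinal.{0}) :
    natProd (natProd α β) γ = natProd α (natProd β γ) :=
  exps_injective (by
    simp only [exps_natProd, Multiset.bind_assoc, Multiset.map_bind, Multiset.bind_map,
      Multiset.map_map, Function.comp_def, natSum_assoc])

theorem zero_natProd (α : Ordinal.{0}) : natProd 0 α = 0 :=
  exps_injective (by simp [exps_natProd])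

theorem one_natProd (α : Ordinal.{0}) : natProd 1 α = α :=
  exps_injective (by simp [exps_natProd, zero_natSum])

theorem natSum_natProd (α β γ : Ordinal.{0}) :
    natProd (natSum α β) γ = natSum (natProd α γ) (natProd β γ) :=
  exps_injective (by simp only [exps_natProd, exps_natSum, Multiset.add_bind])

theorem exps_ne_zero {α : Ordinal.{0}} (h : α ≠ 0) : exps α ≠ 0 := fun e =>
  h (exps_injective (by rw [e, exps_zero]))

theorem natProd_lt_natProd_right {α β γ : Ordinal.{0}} (h : α < β) (hγ : γ ≠ 0) :
    natProd α γ < natProd β γ := by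
  obtain ⟨g, hg, hm⟩ := exists_max_mem (exps_ne_zero hγ)
  obtain ⟨w, hw⟩ := Multiset.exists_cons_of_mem hg
  rw [lt_iff_exps] at h ⊢
  obtain ⟨u, s, t, c, hs, ht, h⟩ := h
  rw [exps_natProd, exps_natProd, hs, ht, Multiset.add_bind, Multiset.add_bind,
    Multiset.cons_bind, hw, Multiset.map_cons, ← hw, Multiset.cons_add]
  -- Since `g` is the largest exponent of `γ`, `natSum c g` exceeds every `natSum a b` with `a < c`
  -- and `b` an exponent of `γ`.
  refine ⟨_, _, _, natSum c g, rfl, rfl, fun x hx => ?_⟩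
  obtain ⟨a, ha, hx⟩ := Multiset.mem_bind.1 hx
  obtain ⟨b, hb, rfl⟩ := Multiset.mem_map.1 hx
  refine lt_of_lt_of_le (b := natSum c b) ?_ ?_
  · rw [natSum_comm a, natSum_comm c]
    exact natSum_lt_natSum_left _ (h a ha)
  · rcases (hm b hb).eq_or_lt with rfl | h'
    · rfl
    · exact (natSum_lt_natSum_left _ h').le

end GodelT

namespace GodelT
open Ordinal

/-! ### The norm -/

/-- An ordinal that is one of its own exponents satisfies `ω ^ α ≤ α`, and such ordinals start at
`ε₀`. Below `ε₀` the guard in the recursion for `no` is therefore void. -/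
theorem lt_of_mem_exps {α γ : Ordinal.{0}} (hα : α < ε₀) (h : γ ∈ exps α) : γ < α := by
  have h₁ : ω ^ γ ≤ α := by
    simpa [ofExps_exps] using opow_le_ofExps h
  have h₂ : γ ≤ α := (right_le_opow γ one_lt_omega0).trans h₁
  rcases h₂.eq_or_lt with rfl | h₂
  · exact absurd (epsilon_zero_le_of_omega0_opow_le h₁) hα.not_ge
  · exact h₂

theorem ofExps_lt_epsilon {s : Multiset Ordinal.{0}} (h : ∀ γ ∈ s, γ < ε₀) : ofExps s < ε₀ := by
  rw [← omega0_opow_epsilon]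
  exact ofExps_lt h

theorem lt_epsilon_iff_exps {α : Ordinal.{0}} : α < ε₀ ↔ ∀ γ ∈ exps α, γ < ε₀ :=
  ⟨fun h _ hγ => (lt_of_mem_exps h hγ).trans h, fun h => by
    rw [← ofExps_exps α]; exact ofExps_lt_epsilon h⟩

theorem no_eq {α : Ordinal.{0}} (hα : α < ε₀) :
    no α = ((exps α).map fun γ => 1 + no γ).sum := by
  rw [no]
  congr 1
  rw [← Multiset.attach_map_val' (exps α) fun γ => 1 + no γ]
  refine Multiset.map_congr rfl fun γ _ => ?_
  rw [dif_pos (lt_of_mem_exps hα γ.2)]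

theorem natSum_lt_epsilon {α β : Ordinal.{0}} (hα : α < ε₀) (hβ : β < ε₀) : natSum α β < ε₀ := by
  rw [lt_epsilon_iff_exps] at *
  intro γ hγ
  rw [exps_natSum, Multiset.mem_add] at hγ
  exact hγ.elim (hα γ) (hβ γ)

theorem natProd_lt_epsilon {α β : Ordinal.{0}} (hα : α < ε₀) (hβ : β < ε₀) :
    natProd α β < ε₀ := by
  rw [lt_epsilon_iff_exps] at *
  intro γ hγ
  rw [exps_natProd, Multiset.mem_bind] at hγ
  obtain ⟨a, ha, hγ⟩ := hγ
  obtain ⟨b, hb, rfl⟩ := Multiset.mem_map.1 hγ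
  exact natSum_lt_epsilon (hα a ha) (hβ b hb)

theorem no_natSum {α β : Ordinal.{0}} (hα : α < ε₀) (hβ : β < ε₀) :
    no (natSum α β) = no α + no β := by
  rw [no_eq (natSum_lt_epsilon hα hβ), exps_natSum, Multiset.map_add, Multiset.sum_add,
    ← no_eq hα, ← no_eq hβ]

theorem no_natProd {α β : Ordinal.{0}} (hα : α < ε₀) (hβ : β < ε₀) :
    no (natProd α β) =
      ((exps α).map fun a => ((exps β).map fun b => 1 + no a + no b).sum).sum := by
  rw [no_eq (natProd_lt_epsilon hα hβ), exps_natProd, Multiset.map_bind, Multiset.sum_bind]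
  congr 1
  refine Multiset.map_congr rfl fun a ha => ?_
  rw [Multiset.map_map]
  congr 1
  refine Multiset.map_congr rfl fun b hb => ?_
  rw [Function.comp, no_natSum ((lt_of_mem_exps hα ha).trans hα)
    ((lt_of_mem_exps hβ hb).trans hβ), add_assoc]

theorem no_natProd_le {α β : Ordinal.{0}} (hα : α < ε₀) (hβ : β < ε₀) :
    no (natProd α β) ≤ no α * no β := by
  rw [no_natProd hα hβ, no_eq hα, no_eq hβ, ← Multiset.sum_map_mul_right]
  refine Multiset.sum_map_le_sum_map _ _ fun a _ => ?_
  rw [← Multiset.sum_map_mul_left]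
  refine Multiset.sum_map_le_sum_map _ _ fun b _ => ?_
  nlinarith [Nat.zero_le (no a * no b)]

theorem le_no_natProd {α β : Ordinal.{0}} (hα : α < ε₀) (hβ : β < ε₀) (h : β ≠ 0) :
    no α ≤ no (natProd α β) := by
  rw [no_natProd hα hβ, no_eq hα]
  refine Multiset.sum_map_le_sum_map _ _ fun a _ => ?_
  obtain ⟨b, hb⟩ := Multiset.exists_mem_of_ne_zero (exps_ne_zero h)
  refine le_trans ?_ (Multiset.single_le_sum (by simp) (1 + no a + no b)
    (Multiset.mem_map_of_mem _ hb))
  omega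

theorem natCast_lt_epsilon' (n : ℕ) : (n : Ordinal.{0}) < ε₀ := natCast_lt_epsilon n 0

@[simp] theorem no_zero : no 0 = 0 := by
  rw [no_eq (epsilon_pos 0)]; simp

@[simp] theorem no_natCast (n : ℕ) : no n = n := by
  rw [no_eq (natCast_lt_epsilon' n)]; simp

theorem no_omega : no ω = 2 := by
  have := no_natCast 1
  rw [no_eq (omega0_lt_epsilon 0)]
  simp at this ⊢
  rw [this]

theorem no_eq_zero {α : Ordinal.{0}} (hα : α < ε₀) : no α = 0 ↔ α = 0 := by
  refine ⟨fun h => ?_, fun h => by simp [h]⟩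
  by_contra h0
  obtain ⟨b, hb⟩ := Multiset.exists_mem_of_ne_zero (exps_ne_zero h0)
  have := Multiset.single_le_sum (by simp) (1 + no b)
    (Multiset.mem_map_of_mem (fun γ => 1 + no γ) hb)
  rw [← no_eq hα, h] at this
  omega

/-- An ordinal of norm at most `N + 1` has at most `N + 1` exponents, all of norm at most `N`. By
induction these come from a finite set, so only finitely many multisets are possible. This makes the
supremum in the definition of `psi` a maximum. -/
theorem finite_no_le (N : ℕ) : {α : Ordinal.{0} | α < ε₀ ∧ no α ≤ N}.Finite := by
  induction N with
  | zero =>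
    refine (Set.finite_singleton 0).subset ?_
    rintro α ⟨h, h'⟩
    exact (no_eq_zero h).1 (by omega)
  | succ N ih =>
    have : (Set.Iic ((N + 1) • ih.toFinset.val)).Finite := Set.finite_Iic _
    refine (this.image ofExps).subset ?_
    rintro α ⟨h, h'⟩
    refine ⟨exps α, ?_, ofExps_exps α⟩
    rw [no_eq h] at h'
    rw [Set.mem_Iic, Multiset.le_iff_count]
    intro γ
    by_cases hγ : γ ∈ exps α
    · have h₁ := Multiset.single_le_sum (by simp) (1 + no γ)
        (Multiset.mem_map_of_mem (fun γ => 1 + no γ) hγ)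
      have h₂ : γ ∈ ih.toFinset.val := by
        rw [Finset.mem_val, Set.Finite.mem_toFinset]
        exact ⟨(lt_of_mem_exps h hγ).trans h, by omega⟩
      have h₃ : (exps α).card ≤ N + 1 := by
        refine le_trans ?_ h'
        rw [← Multiset.card_map (fun γ => 1 + no γ) (exps α)]
        simp
      have h₄ := Multiset.count_le_card γ (exps α)
      have h₅ := Multiset.one_le_count_iff_mem.2 h₂
      rw [Multiset.count_nsmul]
      nlinarith
    · simp [Multiset.count_eq_zero_of_notMem hγ]

/-! ### Powers of two -/

theorem ofExps_map_one_add (t : Multiset Ordinal.{0}) :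
    ofExps (t.map (1 + ·)) = ω * ofExps t := by
  have h := Multiset.map_sort (1 + ·) t (fun a b : Ordinal.{0} => a ≥ b)
    (fun a b : Ordinal.{0} => a ≥ b) (by simp)
  rw [ofExps, ofExps, ← h]
  generalize t.sort (· ≥ ·) = l
  induction l with
  | nil => simp
  | cons a l ih => simpa [mul_add, opow_add] using ih

/-- The exponents of the ordinal `β` in `α = ω β + n`. -/
noncomputable def quotExps (α : Ordinal.{0}) : Multiset Ordinal.{0} :=
  ((exps α).filter (· ≠ 0)).map (· - 1)

theorem exps_eq_quotExps (α : Ordinal.{0}) :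
    exps α = (quotExps α).map (1 + ·) + Multiset.replicate ((exps α).count 0) 0 := by
  rw [quotExps, Multiset.map_map]
  nth_rewrite 1 [← Multiset.filter_add_not (· ≠ 0) (exps α)]
  congr 1
  · nth_rewrite 1 [← Multiset.map_id ((exps α).filter (· ≠ 0))]
    refine Multiset.map_congr rfl fun x hx => ?_
    have hx := (Multiset.mem_filter.1 hx).2
    exact (Ordinal.add_sub_cancel_of_le (Order.one_le_iff_ne_zero.2 hx)).symm
  · simp only [ne_eq, not_not]
    exact Multiset.filter_eq' _ _

/-- Write `α = ω * β + n`. Then `2 ^ α = (2 ^ ω) ^ β * 2 ^ n = ω ^ β * 2 ^ n`, where `β` has the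
exponents `quotExps α` and `n` counts the exponents `0` of `α`. -/
theorem exps_two_opow (α : Ordinal.{0}) :
    exps (2 ^ α) = Multiset.replicate (2 ^ (exps α).count 0) (ofExps (quotExps α)) := by
  have h : α = ω * ofExps (quotExps α) + ((exps α).count 0 : ℕ) := by
    conv_lhs => rw [← ofExps_exps α, exps_eq_quotExps α]
    rw [ofExps_add_of_ge, ofExps_map_one_add, ofExps_replicate]
    · simp
    · intro x _ y hy
      rw [Multiset.eq_of_mem_replicate hy]
      simp
  conv_lhs => rw [h, opow_add, opow_mul]
  have h2 : (2 : Ordinal.{0}) ^ ω = ω := by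
    exact_mod_cast natCast_opow_omega0 (n := 2) (by norm_num)
  rw [h2, ← exps_opow_mul, opow_natCast]
  norm_cast

theorem quotExps_natSum (α β : Ordinal.{0}) :
    quotExps (natSum α β) = quotExps α + quotExps β := by
  simp [quotExps, exps_natSum]

theorem two_opow_natSum (α β : Ordinal.{0}) :
    (2 : Ordinal.{0}) ^ natSum α β = natProd (2 ^ α) (2 ^ β) := by
  apply exps_injective
  rw [exps_natProd, exps_two_opow, exps_two_opow, exps_two_opow, quotExps_natSum, exps_natSum,
    Multiset.count_add, pow_add]
  simp only [Multiset.bind, Multiset.map_replicate]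
  rw [natSum, exps_ofExps, exps_ofExps]
  generalize 2 ^ (exps α).count 0 = n
  induction n with
  | zero => simp
  | succ n ih => 
    rw [Multiset.replicate_succ, Multiset.join_cons, ← ih, ← Multiset.replicate_add]
    congr 1
    ring

/-- Subtraction is on the left: `γ - 1` is the predecessor of a finite `γ`, but `γ` itself if `γ` is
infinite, because then `1 + γ = γ`. -/
theorem no_sub_one {γ : Ordinal.{0}} (h0 : γ ≠ 0) :
    no (γ - 1) ≤ no γ ∧ no γ ≤ 1 + no (γ - 1) := by
  rcases lt_or_ge γ ω with h | h
  · obtain ⟨n, rfl⟩ := lt_omega0.1 h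
    obtain ⟨n, rfl⟩ := Nat.exists_eq_succ_of_ne_zero (by simpa using h0 : n ≠ 0)
    have : ((n.succ : ℕ) : Ordinal.{0}) - 1 = n := by
      rw [Nat.succ_eq_one_add, Nat.cast_add, Nat.cast_one, Ordinal.add_sub_cancel]
    rw [this, no_natCast, no_natCast]
    omega
  · have : γ - 1 = γ := by
      conv_lhs => rw [← one_add_of_omega0_le h]
      rw [Ordinal.add_sub_cancel]
    rw [this]
    omega

theorem quotExps_lt_epsilon {α : Ordinal.{0}} (hα : α < ε₀) : ∀ γ ∈ quotExps α, γ < ε₀ := by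
  intro γ hγ
  obtain ⟨x, hx, rfl⟩ := Multiset.mem_map.1 hγ
  exact (Ordinal.sub_le_self _ _).trans_lt
    (lt_epsilon_iff_exps.1 hα x (Multiset.mem_of_mem_filter hx))

theorem two_opow_lt_epsilon {α : Ordinal.{0}} (hα : α < ε₀) : (2 : Ordinal.{0}) ^ α < ε₀ := by
  rw [lt_epsilon_iff_exps, exps_two_opow]
  intro γ hγ
  rw [Multiset.eq_of_mem_replicate hγ]
  exact ofExps_lt_epsilon (quotExps_lt_epsilon hα)

theorem no_two_opow {α : Ordinal.{0}} (hα : α < ε₀) :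
    no (2 ^ α) = 2 ^ (exps α).count 0 * (1 + no (ofExps (quotExps α))) := by
  rw [no_eq (two_opow_lt_epsilon hα), exps_two_opow]
  simp

theorem no_eq_count_add {α : Ordinal.{0}} (hα : α < ε₀) :
    no α = (exps α).count 0 + (((exps α).filter (· ≠ 0)).map fun γ => 1 + no γ).sum := by
  rw [no_eq hα]
  conv_lhs => rw [← Multiset.filter_add_not (· ≠ 0) (exps α)]
  rw [Multiset.map_add, Multiset.sum_add, add_comm]
  simp [Multiset.filter_eq']

theorem no_ofExps_quotExps {α : Ordinal.{0}} (hα : α < ε₀) :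
    no (ofExps (quotExps α)) =
      (((exps α).filter (· ≠ 0)).map fun γ => 1 + no (γ - 1)).sum := by
  rw [no_eq (ofExps_lt_epsilon (quotExps_lt_epsilon hα)), exps_ofExps, quotExps,
    Multiset.map_map]
  rfl

theorem no_two_opow_le {α : Ordinal.{0}} (hα : α < ε₀) :
    no (2 ^ α) ≤ 2 ^ no α * (1 + no α) := by
  have h := no_eq_count_add hα
  have h' : no (ofExps (quotExps α)) ≤ (((exps α).filter (· ≠ 0)).map fun γ => 1 + no γ).sum := by
    rw [no_ofExps_quotExps hα]
    refine Multiset.sum_map_le_sum_map _ _ fun γ hγ => ?_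
    have := (no_sub_one (Multiset.mem_filter.1 hγ).2).1
    omega
  rw [no_two_opow hα]
  gcongr <;> omega

/-- Passing to `quotExps` lowers the norm of an exponent by at most `1`, which the factor `2`
absorbs; the finite part `n` of `α` is covered by `n < 2 ^ n`. The lemma recovers the norm of `f`
from that of `2^f · g`. -/
theorem le_no_two_opow {α : Ordinal.{0}} (hα : α < ε₀) : no α ≤ 2 * no (2 ^ α) := by
  have h := no_eq_count_add hα
  have h' : (((exps α).filter (· ≠ 0)).map fun γ => 1 + no γ).sum ≤
      2 * no (ofExps (quotExps α)) := by
    rw [no_ofExps_quotExps hα, ← Multiset.sum_map_mul_left]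
    refine Multiset.sum_map_le_sum_map _ _ fun γ hγ => ?_
    have := (no_sub_one (Multiset.mem_filter.1 hγ).2).2
    omega
  have h₂ : (exps α).count 0 < 2 ^ (exps α).count 0 := Nat.lt_two_pow_self
  rw [no_two_opow hα]
  nlinarith

end GodelT

namespace GodelT
open Ordinal

/-! ### The ordered semiring of ordinals below `ε₀` -/

/-- The ordinals below `ε₀`, with natural sum and product. -/
def NO : Type 1 := {a : Ordinal.{0} // a < ε₀}

namespace NO

noncomputable instance : LinearOrder NO :=
  inferInstanceAs (LinearOrder {a : Ordinal.{0} // a < ε₀})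

instance : WellFoundedLT NO :=
  inferInstanceAs (WellFoundedLT {a : Ordinal.{0} // a < ε₀})

theorem ext {a b : NO} (h : a.1 = b.1) : a = b := Subtype.ext h

theorem lt_def {a b : NO} : a < b ↔ a.1 < b.1 := Iff.rfl

theorem le_def {a b : NO} : a ≤ b ↔ a.1 ≤ b.1 := Iff.rfl

noncomputable instance : Add NO := ⟨fun a b => ⟨natSum a.1 b.1, natSum_lt_epsilon a.2 b.2⟩⟩
noncomputable instance : Mul NO := ⟨fun a b => ⟨natProd a.1 b.1, natProd_lt_epsilon a.2 b.2⟩⟩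
noncomputable instance : Zero NO := ⟨⟨0, epsilon_pos 0⟩⟩
noncomputable instance : One NO := ⟨⟨1, by simpa using natCast_lt_epsilon' 1⟩⟩
noncomputable instance : NatCast NO := ⟨fun n => ⟨n, natCast_lt_epsilon' n⟩⟩

theorem val_add (a b : NO) : (a + b).1 = natSum a.1 b.1 := rfl
theorem val_mul (a b : NO) : (a * b).1 = natProd a.1 b.1 := rfl
theorem val_zero : (0 : NO).1 = 0 := rfl
theorem val_one : (1 : NO).1 = 1 := rfl
theorem val_natCast (n : ℕ) : (n : NO).1 = n := rfl

noncomputable instance : CommSemiring NO where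
  add_assoc a b c := ext (natSum_assoc _ _ _)
  zero_add a := ext (zero_natSum _)
  add_zero a := ext (by rw [val_add, natSum_comm]; exact zero_natSum _)
  add_comm a b := ext (natSum_comm _ _)
  nsmul := nsmulRec
  mul_assoc a b c := ext (natProd_assoc _ _ _)
  one_mul a := ext (one_natProd _)
  mul_one a := ext (by rw [val_mul, natProd_comm]; exact one_natProd _)
  zero_mul a := ext (zero_natProd _)
  mul_zero a := ext (by rw [val_mul, natProd_comm]; exact zero_natProd _)
  left_distrib a b c := ext (by
    simp only [val_mul, val_add]
    rw [natProd_comm, natSum_natProd, natProd_comm b.1, natProd_comm c.1])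
  right_distrib a b c := ext (natSum_natProd _ _ _)
  mul_comm a b := ext (natProd_comm _ _)
  natCast_zero := ext (by simp [val_natCast, val_zero])
  natCast_succ n := ext (exps_injective (by
    rw [val_natCast, val_add, val_natCast, val_one, exps_natSum]
    simp only [exps_natCast, exps_one]
    rw [Multiset.replicate_succ, add_comm, Multiset.singleton_add]))

theorem zero_le (a : NO) : 0 ≤ a := le_def.2 (by rw [val_zero]; exact bot_le)

theorem add_lt_add_left' {a b : NO} (c : NO) (h : a < b) : c + a < c + b :=
  natSum_lt_natSum_left _ h

instance : IsOrderedCancelAddMonoid NO where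
  add_le_add_left a b h c := by
    rcases h.eq_or_lt with rfl | h
    · rfl
    · rw [add_comm _ c, add_comm _ c]
      exact (add_lt_add_left' c h).le
  le_of_add_le_add_left a b c h := by
    by_contra h'
    exact absurd h (add_lt_add_left' a (not_le.1 h')).not_ge

theorem mul_lt_mul_right' {a b c : NO} (h : a < b) (hc : 0 < c) : a * c < b * c :=
  natProd_lt_natProd_right h (fun e => hc.ne' (ext e))

instance : IsStrictOrderedRing NO where
  zero_le_one := zero_le 1
  exists_pair_ne := ⟨0, 1, fun h => by simpa [val_zero, val_one] using congrArg Subtype.val h⟩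
  mul_lt_mul_of_pos_left c hc a b h := by
    rw [mul_comm c, mul_comm c]
    exact mul_lt_mul_right' h hc
  mul_lt_mul_of_pos_right c hc a b h := mul_lt_mul_right' h hc

instance : MulLeftMono NO := ⟨fun c _ _ h => mul_le_mul_of_nonneg_left h (zero_le c)⟩

instance : MulRightMono NO := ⟨fun c _ _ h => mul_le_mul_of_nonneg_right h (zero_le c)⟩

theorem one_le_iff {a : NO} : 1 ≤ a ↔ a ≠ 0 := by
  rw [le_def, val_one, Order.one_le_iff_ne_zero, ne_eq, ne_eq, not_iff_not]
  exact ⟨fun h => ext h, fun h => congrArg Subtype.val h⟩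

theorem one_le_iff_pos {a : NO} : 1 ≤ a ↔ 0 < a := by
  rw [one_le_iff, (zero_le a).lt_iff_ne']

theorem val_add_one (a : NO) : (a + 1).1 = a.1 + 1 := by
  rw [val_add, val_one, natSum, exps_one, ofExps_add_of_ge (by simp), ofExps_exps,
    ofExps_singleton, opow_zero]

theorem add_one_le_iff {a b : NO} : a + 1 ≤ b ↔ a < b := by
  rw [le_def, lt_def, val_add_one]
  exact Order.add_one_le_iff

/-- The ordinal `ω`. -/
noncomputable def om : NO := ⟨ω, omega0_lt_epsilon 0⟩

/-- The function `2 ^ a`. -/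
noncomputable def pw (a : NO) : NO := ⟨2 ^ a.1, two_opow_lt_epsilon a.2⟩

theorem pw_add (a b : NO) : pw (a + b) = pw a * pw b := ext (two_opow_natSum _ _)

@[simp] theorem pw_zero : pw 0 = 1 := ext (opow_zero _)

theorem pw_one : pw 1 = 2 := by
  have h : (2 : NO).1 = 2 := by
    rw [← Nat.cast_ofNat (R := NO), val_natCast]
    rfl
  exact ext (by rw [h]; exact opow_one _)

@[gcongr]
theorem pw_lt_pw {a b : NO} (h : a < b) : pw a < pw b :=
  (opow_lt_opow_iff_right (by exact_mod_cast Nat.one_lt_two)).2 h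

@[gcongr]
theorem pw_le_pw {a b : NO} (h : a ≤ b) : pw a ≤ pw b := by
  rcases h.eq_or_lt with rfl | h
  · rfl
  · exact (pw_lt_pw h).le

theorem one_le_pw (a : NO) : 1 ≤ pw a := by
  rw [← pw_zero]
  exact pw_le_pw (zero_le a)

theorem pw_pos (a : NO) : 0 < pw a := one_le_iff_pos.1 (one_le_pw a)

theorem pw_natCast (n : ℕ) : pw n = ((2 ^ n : ℕ) : NO) := by
  induction n with
  | zero => simp
  | succ n ih => rw [Nat.cast_succ, pw_add, ih, pw_one, pow_succ]; push_cast; rfl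

theorem natCast_lt_om (n : ℕ) : (n : NO) < om := natCast_lt_omega0 n

theorem exists_natCast_of_lt_om {a : NO} (h : a < om) : ∃ n : ℕ, a = n := by
  obtain ⟨n, hn⟩ := lt_omega0.1 (lt_def.1 h)
  exact ⟨n, ext hn⟩

theorem exists_natCast_of_le {a : NO} {n : ℕ} (h : a ≤ n) : ∃ k : ℕ, a = k :=
  exists_natCast_of_lt_om (h.trans_lt (natCast_lt_om n))

theorem om_mul_add_lt {a b c : NO} (n : ℕ) (h : a < b) : om * a + n < om * b + c :=
  calc om * a + n < om * a + om := by gcongr; exact natCast_lt_om n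
    _ = om * (a + 1) := by ring
    _ ≤ om * b := by gcongr; exact add_one_le_iff.2 h
    _ ≤ om * b + c := le_add_of_nonneg_right (zero_le c)

/-- The norm of an ordinal below `ε₀`. -/
noncomputable def nm (a : NO) : ℕ := no a.1

@[simp] theorem nm_add (a b : NO) : nm (a + b) = nm a + nm b := no_natSum a.2 b.2

theorem nm_mul_le (a b : NO) : nm (a * b) ≤ nm a * nm b := no_natProd_le a.2 b.2

theorem nm_le_mul_left {a b : NO} (h : 0 < b) : nm a ≤ nm (a * b) :=
  le_no_natProd a.2 b.2 fun e => h.ne' (ext e)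

theorem nm_le_mul_right {a b : NO} (h : 0 < a) : nm b ≤ nm (a * b) := by
  rw [mul_comm]
  exact nm_le_mul_left h

@[simp] theorem nm_natCast (n : ℕ) : nm n = n := no_natCast n

@[simp] theorem nm_zero : nm 0 = 0 := no_zero

@[simp] theorem nm_one : nm 1 = 1 := by simpa using nm_natCast 1

@[simp] theorem nm_om : nm om = 2 := no_omega

theorem nm_eq_zero {a : NO} : nm a = 0 ↔ a = 0 :=
  (no_eq_zero a.2).trans ⟨fun h => ext h, fun h => congrArg Subtype.val h⟩

theorem nm_pos {a : NO} (h : 1 ≤ a) : 1 ≤ nm a :=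
  Nat.one_le_iff_ne_zero.2 fun e => one_le_iff.1 h (nm_eq_zero.1 e)

theorem nm_pw_le (a : NO) : nm (pw a) ≤ 2 ^ nm a * (1 + nm a) := no_two_opow_le a.2

theorem nm_le_pw (a : NO) : nm a ≤ 2 * nm (pw a) := le_no_two_opow a.2

theorem finite_nm_le (N : ℕ) : {a : NO | nm a ≤ N}.Finite := by
  have : Function.Injective (Subtype.val : NO → Ordinal.{0}) := Subtype.val_injective
  refine Set.Finite.of_finite_image ((finite_no_le N).subset ?_) this.injOn
  rintro _ ⟨a, ha, rfl⟩
  exact ⟨a.2, ha⟩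

end NO
end GodelT

namespace GodelT

/-! ### Fast growing functions -/

theorem fastF_strictMono_and_lt (n : ℕ) : StrictMono (fastF n) ∧ ∀ x, x < fastF n x := by
  induction n with
  | zero => exact ⟨fun a b h => Nat.pow_lt_pow_right (by norm_num) h, fun x => Nat.lt_two_pow_self⟩
  | succ n ih =>
    obtain ⟨h₁, h₂⟩ := ih
    have h₃ : id ≤ fastF n := fun x => (h₂ x).le
    refine ⟨fun x y h => ?_, fun x => ?_⟩
    · change (fastF n)^[x + 1] x < (fastF n)^[y + 1] y
      exact (h₁.iterate (x + 1) h).trans_le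
        (Function.monotone_iterate_of_id_le h₃ (by omega : x + 1 ≤ y + 1) y)
    · change x < (fastF n)^[x + 1] x
      exact (h₂ x).trans_le
        (Function.monotone_iterate_of_id_le h₃ (by omega : 1 ≤ x + 1) x)

theorem fastF_mono (n : ℕ) : Monotone (fastF n) := (fastF_strictMono_and_lt n).1.monotone

theorem lt_fastF (n x : ℕ) : x < fastF n x := (fastF_strictMono_and_lt n).2 x

theorem fastF_iterate_le {n k x : ℕ} (h : k ≤ x + 1) : (fastF n)^[k] x ≤ fastF (n + 1) x :=
  Function.monotone_iterate_of_id_le (fun x => (lt_fastF n x).le) h x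

theorem fastF_le_fastF {m n : ℕ} (h : m ≤ n) (x : ℕ) : fastF m x ≤ fastF n x := by
  induction n, h using Nat.le_induction with
  | base => rfl
  | succ n _ ih => exact ih.trans (fastF_iterate_le (k := 1) (by omega))

theorem fastF_add_two_le (n x : ℕ) : fastF (n + 1) x + 2 ≤ fastF (n + 1) (x + 1) := by
  change (fastF n)^[x + 1] x + 2 ≤ (fastF n)^[x + 1 + 1] (x + 1)
  have h := (fastF_strictMono_and_lt n).1.iterate (x + 1) (Nat.lt_succ_self x)
  rw [Function.iterate_succ_apply' (fastF n) (x + 1) (x + 1)]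
  have := lt_fastF n ((fastF n)^[x + 1] (x + 1))
  simp only [Nat.succ_eq_add_one] at *
  omega

theorem Phi_mono : Monotone Phi := fun x y h => fastF_mono 5 (by omega)

/-- Each unit in the argument raises `Phi` by at least `2`, and `2 * x ≥ x + 1` for `x ≥ 1`. This is
the norm condition in `Psi_add_Psi_le`. -/
theorem add_Phi_le {x : ℕ} (hx : 1 ≤ x) (y : ℕ) : x + 1 + Phi y ≤ Phi (x + y) := by
  induction x, hx using Nat.le_induction with
  | base =>
    have : fastF 5 (y + 100) + 2 ≤ fastF 5 (y + 100 + 1) := fastF_add_two_le 4 _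
    simp only [Phi]
    rw [show 1 + y + 100 = y + 100 + 1 by ring]
    omega
  | succ x _ ih =>
    have : fastF 5 (x + y + 100) + 2 ≤ fastF 5 (x + y + 100 + 1) := fastF_add_two_le 4 _
    simp only [Phi] at *
    rw [show x + 1 + y + 100 = x + y + 100 + 1 by ring]
    omega

/-- An exponential function that dominates the effect of the operation `2^f · g` on norms. -/
def expG (x : ℕ) : ℕ := 8 ^ (x + 1)

theorem expG_mono : Monotone expG := fun _ _ h => Nat.pow_le_pow_right (by norm_num) (by omega)

theorem expG_iterate_mono (k : ℕ) : Monotone (expG^[k]) := expG_mono.iterate k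

theorem two_mul_lt_expG (x : ℕ) : 2 * x + 1 < expG x := by
  induction x with
  | zero => simp [expG]
  | succ n ih => simp only [expG] at *; rw [pow_succ]; omega

theorem le_expG_iterate (k x : ℕ) : x ≤ expG^[k] x :=
  Function.id_le_iterate_of_id_le (fun x => by have := two_mul_lt_expG x; simp; omega) k x

theorem expG_iterate_le_iterate {k l : ℕ} (h : k ≤ l) (x : ℕ) : expG^[k] x ≤ expG^[l] x :=
  Function.monotone_iterate_of_id_le
    (fun x => by have := two_mul_lt_expG x; simp; omega) h x

/-- By `nm_pw_le` and `nm_mul_le` the left side bounds the norm of `2^f · g` when `a` and `b` are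
the norms of `f` and `g`. -/
theorem two_pow_mul_le_expG {a b c : ℕ} (ha : a ≤ c) (hb : b ≤ c) :
    2 ^ a * (1 + a) * b ≤ expG c := by
  have h : ∀ n : ℕ, 1 + n ≤ 2 ^ n := fun n => by
    have := @Nat.lt_two_pow_self n
    omega
  calc 2 ^ a * (1 + a) * b ≤ 2 ^ c * 2 ^ c * 2 ^ c := by
        gcongr
        · norm_num
        · exact (by omega : 1 + a ≤ 1 + c).trans (h c)
        · have := h c
          omega
    _ = 8 ^ c := by rw [← mul_pow, ← mul_pow]; norm_num
    _ ≤ expG c := Nat.pow_le_pow_right (by norm_num) (by omega)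

/-- One `expG` costs at most two steps of `fastF 0`. So `k` of them are covered by `fastF 1` at an
argument that is itself below `fastF 1 (s + 100)`, and two applications of `fastF 1` stay below
`fastF 2`. -/
theorem expG_iterate_le_Phi {k x s : ℕ} (hk : k ≤ 100 * s + 100) (hx : x ≤ 100 * s + 100) :
    expG^[k] x ≤ Phi s := by
  -- The shift by `3` on both sides makes the estimate reproduce itself under iteration.
  have h₁ : ∀ y : ℕ, expG y + 3 ≤ fastF 0 (fastF 0 (y + 3)) := by
    intro y
    have h : 3 * y + 6 ≤ 2 ^ (y + 3) := by
      have := @Nat.lt_two_pow_self y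
      rw [pow_add]
      omega
    calc expG y + 3 ≤ 2 ^ (3 * y + 6) := by
          rw [expG, pow_add, pow_add, pow_mul]
          have : 1 ≤ 8 ^ y := Nat.one_le_pow _ _ (by norm_num)
          norm_num
          omega
      _ ≤ 2 ^ 2 ^ (y + 3) := Nat.pow_le_pow_right (by norm_num) h
  have h₂ : ∀ k : ℕ, expG^[k] x + 3 ≤ (fastF 0)^[2 * k] (x + 3) := by
    intro k
    induction k with
    | zero => simp
    | succ k ih =>
      rw [Function.iterate_succ_apply', show 2 * (k + 1) = 2 * k + 1 + 1 by ring,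
        Function.iterate_succ_apply', Function.iterate_succ_apply']
      exact (h₁ _).trans (fastF_mono 0 (fastF_mono 0 ih))
  have h₃ : 2 * k + x + 3 ≤ fastF 1 (s + 100) := by
    refine le_trans ?_ (fastF_le_fastF (by omega : 0 ≤ 1) _)
    change _ ≤ 2 ^ (s + 100)
    have := @Nat.lt_two_pow_self s
    rw [pow_add]
    have h100 : 400 ≤ 2 ^ 100 := by norm_num
    nlinarith
  calc expG^[k] x ≤ (fastF 0)^[2 * k] (x + 3) := by have := h₂ k; omega
    _ ≤ (fastF 0)^[2 * k] (2 * k + x + 3) := (fastF_mono 0).iterate _ (by omega)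
    _ ≤ fastF 1 (2 * k + x + 3) := fastF_iterate_le (by omega)
    _ ≤ fastF 1 (fastF 1 (s + 100)) := fastF_mono 1 h₃
    _ ≤ fastF 2 (s + 100) := fastF_iterate_le (n := 1) (k := 2) (by omega)
    _ ≤ Phi s := fastF_le_fastF (by omega) _

theorem le_Phi {x s : ℕ} (hx : x ≤ 100 * s + 100) : x ≤ Phi s :=
  expG_iterate_le_Phi (k := 0) (by omega) hx

/-! ### The collapsing function on ordinals below `ε₀` -/

namespace NO

/-- The collapsing function. -/
noncomputable def Psi (a : NO) : ℕ := psi a.1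

theorem Psi_eq (a : NO) : Psi a = sSup ({0} ∪ {k : ℕ | ∃ b < a, nm b ≤ Phi (nm a) ∧
    k = Psi b + 1}) := by
  rw [Psi, psi]
  congr 2
  ext k
  refine ⟨fun ⟨b, hb, h, e⟩ => ⟨⟨b, hb.trans a.2⟩, hb, h, e⟩, fun ⟨b, hb, h, e⟩ => ⟨b.1, hb, h, e⟩⟩

theorem finite_Psi_set (a : NO) : ({0} ∪ {k : ℕ | ∃ b < a, nm b ≤ Phi (nm a) ∧
    k = Psi b + 1}).Finite := by
  refine (Set.finite_singleton 0).union (((finite_nm_le (Phi (nm a))).image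
    fun b => Psi b + 1).subset ?_)
  rintro k ⟨b, -, h, rfl⟩
  exact ⟨b, h, rfl⟩

theorem Psi_lt_Psi {a b : NO} (h : a < b) (hn : nm a ≤ Phi (nm b)) : Psi a < Psi b := by
  rw [Psi_eq b]
  exact le_csSup (finite_Psi_set b).bddAbove (.inr ⟨a, h, hn, rfl⟩)

theorem Psi_le_Psi {a b : NO} (h : a ≤ b) (hn : nm a ≤ Phi (nm b)) : Psi a ≤ Psi b := by
  rcases h.eq_or_lt with rfl | h
  · rfl
  · exact (Psi_lt_Psi h hn).le

theorem Psi_cases (a : NO) :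
    Psi a = 0 ∨ ∃ b < a, nm b ≤ Phi (nm a) ∧ Psi a = Psi b + 1 := by
  have := Nat.sSup_mem ⟨0, .inl rfl⟩ (finite_Psi_set a).bddAbove
  rw [← Psi_eq a] at this
  exact this

/-- The norm of a natural number is the number itself, so the immediate predecessor always satisfies
the norm condition. -/
theorem Psi_natCast (n : ℕ) : Psi n = n := by
  induction n using Nat.strong_induction_on with
  | _ n ih =>
  refine le_antisymm ?_ ?_
  · rcases Psi_cases n with h | ⟨b, hb, -, h⟩
    · omega
    · obtain ⟨k, rfl⟩ := exists_natCast_of_le hb.le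
      have hk : k < n := Nat.cast_lt.1 hb
      rw [ih k hk] at h
      omega
  · rcases n with _ | n
    · simp
    · have := Psi_lt_Psi (a := n) (b := (n + 1 : ℕ)) (Nat.cast_lt.2 (by omega))
        (by rw [nm_natCast, nm_natCast]; exact le_Phi (by omega))
      rw [ih n (by omega)] at this
      exact this

theorem Psi_add_natCast_le (a : NO) (k : ℕ) : Psi a + k ≤ Psi (a + k) := by
  induction k with
  | zero => simp
  | succ k ih =>
    refine Nat.succ_le_of_lt (ih.trans_lt (Psi_lt_Psi ?_ ?_))
    · gcongr; omega
    · simp only [nm_add, nm_natCast]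
      exact le_Phi (by omega)

/-- Write `Psi b = Psi c + 1` with an admissible `c < b` and move the `1` to `a`: induction replaces
`a + 1 + Psi c` by `a + 1 + c ≤ a + b`. This is the device for removing nested occurrences of `ψ`.
-/
theorem Psi_add_Psi_le (a b : NO) : Psi (a + Psi b) ≤ Psi (a + b) := by
  induction b using WellFoundedLT.induction generalizing a with
  | _ b ih =>
  rcases Psi_cases b with h | ⟨c, hc, hn, h⟩
  · rw [h, Nat.cast_zero, add_zero]
    refine Psi_le_Psi (le_add_of_nonneg_right (zero_le b)) (le_Phi ?_)
    rw [nm_add]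
    omega
  · rw [h]
    -- The estimate `add_Phi_le` used below needs `nm a ≥ 1`.
    rcases eq_or_ne a 0 with rfl | ha
    · rw [zero_add, zero_add, Psi_natCast, h]
    · calc Psi (a + ((Psi c + 1 : ℕ) : NO)) = Psi (a + 1 + Psi c) := by
            congr 1; push_cast; ring
        _ ≤ Psi (a + 1 + c) := ih c hc _
        _ ≤ Psi (a + b) := by
            refine Psi_le_Psi ?_ ?_
            · calc a + 1 + c = a + (c + 1) := by ring
                _ ≤ a + b := by gcongr; exact add_one_le_iff.2 hc
            · rw [nm_add, nm_add, nm_add, nm_one]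
              have := add_Phi_le (nm_pos (one_le_iff.2 ha)) (nm b)
              omega

theorem Psi_add_le (a b : NO) : Psi a + Psi b ≤ Psi (a + b) :=
  (Psi_add_natCast_le a (Psi b)).trans (Psi_add_Psi_le a b)

/-- The natural number `Phi (nm a + k)` is its own `ψ`-value, lies below `ω ≤ om * a`, and has
admissible norm. So collapsing with a positive multiple of `ω` produces numbers above all norms that
`Phi` controls. -/
theorem Phi_lt_Psi {a : NO} (h : 1 ≤ a) (k : ℕ) : Phi (nm a + k) < Psi (om * a + k) := by
  have h₁ : nm a ≤ nm (om * a) := nm_le_mul_right (by simpa using natCast_lt_om 0)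
  have h₂ : Phi (nm a + k) ≤ Phi (nm (om * a + k)) := Phi_mono (by simp; omega)
  have := Psi_lt_Psi (a := (Phi (nm a + k) : ℕ)) (b := om * a + k) ?_ ?_
  · rwa [Psi_natCast] at this
  · refine lt_of_lt_of_le (natCast_lt_om _) ?_
    calc om = om * 1 := (mul_one _).symm
      _ ≤ om * a := by gcongr
      _ ≤ om * a + k := le_add_of_nonneg_right (zero_le _)
  · rwa [nm_natCast]

theorem nm_om_mul_le (a : NO) : nm (om * a) ≤ 2 * nm a := by
  simpa using nm_mul_le om a

theorem nm_le_om_mul (a : NO) : nm a ≤ nm (om * a) :=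
  nm_le_mul_right (by simpa using natCast_lt_om 0)

theorem Psi_om_lt {a b : NO} {k l : ℕ} (h : a < b) (hn : 2 * nm a + k ≤ Phi (nm b + l)) :
    Psi (om * a + k) < Psi (om * b + l) := by
  refine Psi_lt_Psi (om_mul_add_lt k h) ?_
  have h₁ := nm_om_mul_le a
  have h₂ : Phi (nm b + l) ≤ Phi (nm (om * b + l)) :=
    Phi_mono (by have := nm_le_om_mul b; simp; omega)
  simp only [nm_add, nm_natCast] at *
  omega

theorem Psi_om_le {a b : NO} {k l : ℕ} (h : a ≤ b) (hk : k ≤ l) :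
    2 * nm a + k ≤ Phi (nm b + l) → Psi (om * a + k) ≤ Psi (om * b + l) := by
  intro hn
  rcases h.eq_or_lt with rfl | h
  · refine Psi_le_Psi (by gcongr) ?_
    simp only [nm_add, nm_natCast]
    exact le_Phi (by omega)
  · exact (Psi_om_lt h hn).le

theorem Psi_om_lt' {a b : NO} {k l : ℕ} (h : a ≤ b) (hk : k < l)
    (hn : 2 * nm a + k ≤ Phi (nm b + l)) : Psi (om * a + k) < Psi (om * b + l) := by
  rcases h.eq_or_lt with rfl | h
  · refine Psi_lt_Psi (by gcongr) ?_
    simp only [nm_add, nm_natCast]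
    exact le_Phi (by omega)
  · exact Psi_om_lt h hn

end NO
end GodelT

namespace GodelT
open NO

/-! ### Vectors of ordinals -/

/-- Vectors of ordinals; the components above the level are irrelevant or `0`. -/
abbrev Vec : Type 1 := ℕ → NO

/-- The components `(f □ g)_i`, `i ≥ 1`, for `g` of level `l`. -/
noncomputable def bpos (l : ℕ) (f g : Vec) (i : ℕ) : NO :=
  if i ≤ l then pw (bpos l f g (i + 1)) * (f i + g i) else f i
termination_by l + 1 - i

/-- The vector `f □ g` for `g` of level `l`. -/
noncomputable def vbox (l : ℕ) (f g : Vec) : Vec := fun i =>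
  if i = 0 then ((Psi (om * bpos l f g 1 + (f 0 + g 0 + l)) : ℕ) : NO) else bpos l f g i

/-- Restriction to the components `0, …, l`. -/
noncomputable def vres (l : ℕ) (f : Vec) : Vec := fun i => if i ≤ l then f i else 0

/-- The admissible vectors of level `l`: the component `0` is a natural number, which bounds the
norms of all components, and all components are positive. -/
structure Good (l : ℕ) (a : Vec) : Prop where
  nat : a 0 = (nm (a 0) : NO)
  pos : ∀ i ≤ l, 1 ≤ a i
  norm : ∀ i, nm (a i) ≤ nm (a 0)
  zero : ∀ i, l < i → a i = 0

theorem bpos_of_le {l i : ℕ} (f g : Vec) (h : i ≤ l) :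
    bpos l f g i = pw (bpos l f g (i + 1)) * (f i + g i) := by
  rw [bpos, if_pos h]

theorem bpos_of_lt {l i : ℕ} (f g : Vec) (h : l < i) : bpos l f g i = f i := by
  rw [bpos, if_neg h.not_ge]

theorem down_induction {P : ℕ → Prop} (l : ℕ) (base : ∀ i, l < i → P i)
    (step : ∀ i ≤ l, P (i + 1) → P i) (i : ℕ) : P i := by
  induction h : l + 1 - i generalizing i with
  | zero => exact base i (by omega)
  | succ k ih => exact step i (by omega) (ih (i + 1) (by omega))

theorem bpos_mono {l : ℕ} {f f' g g' : Vec} (hf : ∀ i, 1 ≤ i → f i ≤ f' i)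
    (hg : ∀ i, 1 ≤ i → i ≤ l → g i ≤ g' i) :
    ∀ i, 1 ≤ i → bpos l f g i ≤ bpos l f' g' i := by
  refine down_induction l (fun i h h1 => ?_) fun i h ih h1 => ?_
  · rw [bpos_of_lt _ _ h, bpos_of_lt _ _ h]; exact hf i h1
  · rw [bpos_of_le _ _ h, bpos_of_le _ _ h]
    have := ih (by omega)
    have := hf i h1
    have := hg i h1 h
    gcongr

theorem bpos_congr {l : ℕ} {f f' g g' : Vec} (hf : ∀ i, 1 ≤ i → i ≤ l + 1 → f i = f' i)
    (hg : ∀ i, 1 ≤ i → i ≤ l → g i = g' i) :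
    ∀ i, 1 ≤ i → i ≤ l + 1 → bpos l f g i = bpos l f' g' i := by
  refine down_induction l (fun i h h1 h2 => ?_) fun i h ih h1 h2 => ?_
  · rw [bpos_of_lt _ _ h, bpos_of_lt _ _ h]; exact hf i h1 h2
  · rw [bpos_of_le _ _ h, bpos_of_le _ _ h, ih (by omega) (by omega), hf i h1 h2, hg i h1 h]

theorem le_bpos {l : ℕ} (f g : Vec) (i : ℕ) : f i ≤ bpos l f g i := by
  rcases le_or_gt i l with h | h
  · rw [bpos_of_le _ _ h]
    calc f i ≤ f i + g i := le_add_of_nonneg_right (zero_le _)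
      _ = 1 * (f i + g i) := (one_mul _).symm
      _ ≤ _ := by gcongr; exact one_le_pw _
  · rw [bpos_of_lt _ _ h]

theorem le_bpos_right {l i : ℕ} (f g : Vec) (h : i ≤ l) : g i ≤ bpos l f g i := by
  rw [bpos_of_le _ _ h]
  calc g i ≤ f i + g i := le_add_of_nonneg_left (zero_le _)
    _ = 1 * (f i + g i) := (one_mul _).symm
    _ ≤ _ := by gcongr; exact one_le_pw _

/-- Each step down from component `i + 1` to `i` has the form `2^f · g` and costs one `expG`. -/
theorem nm_bpos_le {l x y : ℕ} {f g : Vec} (hf : ∀ i, nm (f i) ≤ x) (hg : ∀ i, nm (g i) ≤ y) :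
    ∀ i, nm (bpos l f g i) ≤ expG^[l + 1 - i] (x + y) := by
  refine down_induction l (fun i h => ?_) fun i h ih => ?_
  · rw [bpos_of_lt _ _ h]
    have := hf i
    exact (by omega : nm (f i) ≤ x + y).trans (le_expG_iterate _ _)
  · rw [bpos_of_le _ _ h, show l + 1 - i = (l + 1 - (i + 1)) + 1 by omega,
      Function.iterate_succ_apply']
    refine (nm_mul_le _ _).trans ((Nat.mul_le_mul_right _ (nm_pw_le _)).trans ?_)
    refine two_pow_mul_le_expG ih ?_
    rw [nm_add]
    exact (add_le_add (hf i) (hg i)).trans (le_expG_iterate _ _)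

theorem nm_bpos_le' {l x y : ℕ} {f g : Vec} (hf : ∀ i, nm (f i) ≤ x) (hg : ∀ i, nm (g i) ≤ y)
    (i : ℕ) : nm (bpos l f g i) ≤ expG^[l + 1] (x + y) :=
  (nm_bpos_le hf hg i).trans (expG_iterate_le_iterate (by omega) _)

/-- Two additional `expG` absorb the factor `16` and the summand `8 * s`. The margin allows sums of
several norms to be compared with a single value of `Phi`. -/
theorem expG_bound_le_Phi {l s x : ℕ} (hl : l ≤ 50 * s + 50) (hx : x ≤ s) :
    2 * (8 * expG^[l] x) + 8 * s ≤ Phi s := by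
  refine le_trans ?_ (expG_iterate_le_Phi (k := l + 2) (x := s) (by omega) (by omega))
  rw [Function.iterate_succ_apply', Function.iterate_succ_apply']
  have h₁ := expG_iterate_mono l hx
  have h₂ := le_expG_iterate l s
  have h₃ := two_mul_lt_expG (expG^[l] s)
  have h₄ : ∀ y : ℕ, 64 * y ≤ expG (expG y) := by
    intro y
    have h : y < 8 ^ y := Nat.lt_pow_self (by norm_num)
    have h' : y + 2 ≤ expG y + 1 := by
      have := two_mul_lt_expG y
      omega
    calc 64 * y ≤ 8 ^ (y + 2) := by
          rw [pow_add]
          norm_num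
          omega
      _ ≤ expG (expG y) := Nat.pow_le_pow_right (by norm_num) h'
  have := h₄ (expG^[l] s)
  omega

theorem Good.pos' {l : ℕ} {a : Vec} (h : Good l a) : 1 ≤ nm (a 0) := nm_pos (h.pos 0 (by omega))

theorem vbox_zero (l : ℕ) {f g : Vec} (hf : f 0 = (nm (f 0) : NO)) (hg : g 0 = (nm (g 0) : NO)) :
    vbox l f g 0 = ((Psi (om * bpos l f g 1 + ((nm (f 0) + nm (g 0) + l : ℕ) : NO)) : ℕ) : NO) := by
  rw [vbox, if_pos rfl]
  nth_rewrite 1 [hf, hg]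
  push_cast
  rfl

theorem vbox_pos {l i : ℕ} (f g : Vec) (h : i ≠ 0) : vbox l f g i = bpos l f g i := by
  rw [vbox, if_neg h]

/-- The positive components of `f □ g` have norms below `Phi` of the finite part of the collapsed
argument, and component `0` exceeds that by `Phi_lt_Psi`. The summand `l` in that finite part pays
for the `l + 1` iterations of `expG`. -/
theorem Good.vbox {l m : ℕ} {f g : Vec} (hf : Good m f) (hg : Good l g) (hl : l < m) :
    Good m (vbox l f g) := by
  have h1 : 1 ≤ bpos l f g 1 := (hf.pos 1 (by omega)).trans (le_bpos f g 1)
  have h0 := vbox_zero l hf.nat hg.nat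
  have hΦ : ∀ i, nm (bpos l f g i) ≤ Phi (nm (bpos l f g 1) + (nm (f 0) + nm (g 0) + l)) := by
    intro i
    have h₁ := nm_bpos_le' (l := l) hf.norm hg.norm i
    have h₂ := expG_bound_le_Phi (l := l + 1) (s := nm (f 0) + nm (g 0) + l)
      (x := nm (f 0) + nm (g 0)) (by omega) (by omega)
    have h₃ := Phi_mono (by omega : nm (f 0) + nm (g 0) + l ≤
      nm (bpos l f g 1) + (nm (f 0) + nm (g 0) + l))
    omega
  have hΨ := Phi_lt_Psi h1 (nm (f 0) + nm (g 0) + l)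
  refine ⟨?_, fun i hi => ?_, fun i => ?_, fun i hi => ?_⟩
  · rw [h0, nm_natCast]
  · rcases eq_or_ne i 0 with rfl | hi0
    · rw [h0]
      exact_mod_cast (by omega : 1 ≤ Psi _)
    · rw [vbox_pos _ _ hi0]
      exact (hf.pos i hi).trans (le_bpos f g i)
  · rcases eq_or_ne i 0 with rfl | hi0
    · rfl
    · rw [vbox_pos _ _ hi0, h0, nm_natCast]
      exact (hΦ i).trans hΨ.le
  · rw [vbox_pos _ _ (by omega), bpos_of_lt _ _ (by omega), hf.zero i hi]

theorem Good.vres {l m : ℕ} {f : Vec} (hf : Good m f) (h : l ≤ m) : Good l (vres l f) := by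
  have h0 : GodelT.vres l f 0 = f 0 := if_pos (by omega)
  refine ⟨?_, fun i hi => ?_, fun i => ?_, fun i hi => ?_⟩
  · rw [h0]; exact hf.nat
  · rw [GodelT.vres, if_pos hi]; exact hf.pos i (by omega)
  · rw [h0, GodelT.vres]
    split_ifs
    · exact hf.norm i
    · simp
  · exact if_neg (by omega)

theorem vres_of_le {l i : ℕ} (f : Vec) (h : i ≤ l) : vres l f i = f i := if_pos h

theorem nat_le_of_le {a b : Vec} (ha : a 0 = (nm (a 0) : NO)) (hb : b 0 = (nm (b 0) : NO))
    (h : a 0 ≤ b 0) : nm (a 0) ≤ nm (b 0) := by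
  rw [ha, hb] at h
  exact_mod_cast h

theorem nat_lt_of_lt {a b : Vec} (ha : a 0 = (nm (a 0) : NO)) (hb : b 0 = (nm (b 0) : NO))
    (h : a 0 < b 0) : nm (a 0) < nm (b 0) := by
  rw [ha, hb] at h
  exact_mod_cast h

/-- `a` is smaller than `b`: strictly in the component `0`, and weakly in the others. -/
def Prec (a b : Vec) : Prop := a 0 < b 0 ∧ ∀ i, a i ≤ b i

theorem norm_side_condition {l s : ℕ} {f g f' g' : Vec} {c : NO}
    (hf : ∀ i, nm (f i) ≤ nm (f 0)) (hg : ∀ i, nm (g i) ≤ nm (g 0))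
    (hff : nm (f 0) ≤ nm (f' 0)) (hgg : nm (g 0) ≤ nm (g' 0))
    (hs : s = nm (f' 0) + nm (g' 0) + l) :
    2 * nm (bpos l f g 1) + (nm (f 0) + nm (g 0) + l) ≤ Phi (nm c + s) := by
  have h₁ := nm_bpos_le' (l := l) hf hg 1
  have h₂ := expG_bound_le_Phi (l := l + 1) (s := s)
    (x := nm (f 0) + nm (g 0)) (by omega) (by omega)
  have h₃ := Phi_mono (by omega : s ≤ nm c + s)
  omega

theorem vbox_mono {l m m' : ℕ} {f f' g g' : Vec} (hf : Good m f) (hf' : Good m' f')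
    (hg : Good l g) (hg' : Good l g') (hff : ∀ i, f i ≤ f' i) (hgg : ∀ i, g i ≤ g' i) (i : ℕ) :
    vbox l f g i ≤ vbox l f' g' i := by
  rcases eq_or_ne i 0 with rfl | hi
  · rw [vbox_zero l hf.nat hg.nat, vbox_zero l hf'.nat hg'.nat]
    have h₁ := nat_le_of_le hf.nat hf'.nat (hff 0)
    have h₂ := nat_le_of_le hg.nat hg'.nat (hgg 0)
    rw [Nat.cast_le]
    exact Psi_om_le (bpos_mono (fun i _ => hff i) (fun i _ _ => hgg i) 1 le_rfl) (by omega)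
      (norm_side_condition hf.norm hg.norm h₁ h₂ rfl)
  · rw [vbox_pos _ _ hi, vbox_pos _ _ hi]
    exact bpos_mono (fun i _ => hff i) (fun i _ _ => hgg i) i (by omega)

/-- Component `0` of `f □ g` sees only the components `0, …, l + 1` of `f`. Nothing is required of
the others, so `f` and `f'` may have different levels. -/
theorem vbox_zero_lt {l m m' : ℕ} {f f' g g' : Vec} (hf : Good m f) (hf' : Good m' f')
    (hg : Good l g) (hg' : Good l g') (hff : ∀ i, 1 ≤ i → i ≤ l + 1 → f i ≤ f' i)
    (hff0 : f 0 ≤ f' 0) (hgg : ∀ i, g i ≤ g' i)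
    (h : f 0 < f' 0 ∨ g 0 < g' 0) : vbox l f g 0 < vbox l f' g' 0 := by
  rw [vbox_zero l hf.nat hg.nat, vbox_zero l hf'.nat hg'.nat]
  have h₁ := nat_le_of_le hf.nat hf'.nat hff0
  have h₂ := nat_le_of_le hg.nat hg'.nat (hgg 0)
  have hb : bpos l f g 1 ≤ bpos l f' g' 1 := by
    have e : bpos l f g 1 = bpos l (vres (l + 1) f) g 1 :=
      bpos_congr (fun i _ hi => (vres_of_le f hi).symm) (fun _ _ _ => rfl) 1 le_rfl (by omega)
    rw [e]
    refine bpos_mono (fun i hi => ?_) (fun i _ _ => hgg i) 1 le_rfl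
    rw [vres]
    split_ifs with h
    · exact hff i hi h
    · exact zero_le _
  rw [Nat.cast_lt]
  refine Psi_om_lt' hb ?_ (norm_side_condition hf.norm hg.norm h₁ h₂ rfl)
  rcases h with h | h
  · have := nat_lt_of_lt hf.nat hf'.nat h
    omega
  · have := nat_lt_of_lt hg.nat hg'.nat h
    omega

theorem Prec.vres {a b : Vec} (h : Prec a b) (l : ℕ) : Prec (vres l a) (vres l b) := by
  refine ⟨h.1, fun i => ?_⟩
  rw [GodelT.vres, GodelT.vres]
  split_ifs
  · exact h.2 i
  · rfl

theorem Prec.vbox_left {l m m' : ℕ} {f f' g : Vec} (h : Prec f f') (hf : Good m f)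
    (hf' : Good m' f') (hg : Good l g) : Prec (vbox l f g) (vbox l f' g) :=
  ⟨vbox_zero_lt hf hf' hg hg (fun i _ _ => h.2 i) (h.2 0) (fun _ => le_rfl) (.inl h.1),
    vbox_mono hf hf' hg hg h.2 fun _ => le_rfl⟩

theorem Prec.vbox_right {l m : ℕ} {f g g' : Vec} (h : Prec g g') (hf : Good m f)
    (hg : Good l g) (hg' : Good l g') : Prec (vbox l f g) (vbox l f g') :=
  ⟨vbox_zero_lt hf hf hg hg' (fun _ _ _ => le_rfl) le_rfl h.2 (.inr h.1),
    vbox_mono hf hf hg hg' (fun _ => le_rfl) h.2⟩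

theorem Good.add {l m : ℕ} {a b : Vec} (ha : Good l a) (hb : Good m b) :
    Good (max l m) (a + b) := by
  refine ⟨?_, fun i hi => ?_, fun i => ?_, fun i hi => ?_⟩
  · rw [Pi.add_apply, nm_add, Nat.cast_add, ← ha.nat, ← hb.nat]
  · rcases le_max_iff.1 hi with hi | hi
    · exact (ha.pos i hi).trans (le_add_of_nonneg_right (zero_le _))
    · exact (hb.pos i hi).trans (le_add_of_nonneg_left (zero_le _))
  · simp only [Pi.add_apply, nm_add]
    exact add_le_add (ha.norm i) (hb.norm i)
  · rw [Pi.add_apply, ha.zero i (by omega), hb.zero i (by omega), add_zero]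

theorem right_lt_vbox_zero {l m : ℕ} {f g : Vec} (hf : Good m f) (hg : Good l g) (hm : 1 ≤ m) :
    nm (f 0) + nm (g 0) + l < nm (vbox l f g 0) := by
  rw [vbox_zero l hf.nat hg.nat, nm_natCast]
  have h1 : 1 ≤ bpos l f g 1 := (hf.pos 1 (by omega)).trans (le_bpos f g 1)
  refine lt_of_le_of_lt (le_Phi ?_) (Phi_lt_Psi h1 _)
  omega

/-! ### Additivity of the box operator -/

/-- Let `x`, `y` be the powers of two of `d` and `e` at component `i + 1`. By induction the
exponents add up with slack `1`, so the power of `f` is at least `2 * x * y`, while `x` and `y` are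
each at most `x * y`. -/
theorem bpos_add_lt {l : ℕ} {d e f b : Vec} (h : ∀ i, 1 ≤ i → i ≤ l + 1 → d i + e i + 1 ≤ f i) :
    ∀ i, 1 ≤ i → i ≤ l + 1 → bpos l d b i + bpos l e b i + 1 ≤ bpos l f b i := by
  refine down_induction l (fun i h' h1 h2 => ?_) fun i h' ih h1 h2 => ?_
  · simp only [bpos_of_lt _ _ h']
    exact h i h1 h2
  · simp only [bpos_of_le _ _ h']
    have ih := pw_le_pw (ih (by omega) (by omega))
    rw [pw_add, pw_add, pw_one] at ih
    have hx := one_le_pw (bpos l d b (i + 1))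
    have hy := one_le_pw (bpos l e b (i + 1))
    generalize pw (bpos l d b (i + 1)) = x at *
    generalize pw (bpos l e b (i + 1)) = y at *
    have hxy : x ≤ x * y := le_mul_of_one_le_right (zero_le _) hy
    have hyx : y ≤ x * y := le_mul_of_one_le_left (zero_le _) hx
    calc x * (d i + b i) + y * (e i + b i) + 1
        ≤ (x * y) * (d i + b i) + (x * y) * (e i + b i) + x * y := by
          gcongr
          exact hx.trans hxy
      _ ≤ (x * y) * (d i + b i) + (x * y) * (e i + b i) + x * y +
          (x * y) * (d i + e i + 1) := le_add_of_nonneg_right (zero_le _)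
      _ = x * y * 2 * (d i + e i + 1 + b i) := by ring
      _ ≤ _ := by
          gcongr
          exact h i h1 h2

theorem Psi_om_add_Psi_om_le (a b : NO) (k l : ℕ) :
    Psi (om * a + k) + Psi (om * b + l) ≤ Psi (om * (a + b) + ((k + l : ℕ) : NO)) := by
  refine (Psi_add_le _ _).trans (le_of_eq ?_)
  congr 1
  push_cast
  ring

/-- `ψ` is superadditive, and by `bpos_add_lt` the slack `1` survives in the multiple of `ω`, so the
comparison is strict whatever the finite parts are. Only the norm condition remains. -/
theorem vbox_add_lt {l : ℕ} {d e f b : Vec} (hb : Good l b)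
    (hd : d 0 = (nm (d 0) : NO)) (he : e 0 = (nm (e 0) : NO)) (hf : f 0 = (nm (f 0) : NO))
    (hdn : ∀ i ≤ l + 1, nm (d i) ≤ nm (d 0)) (hen : ∀ i ≤ l + 1, nm (e i) ≤ nm (e 0))
    (h : ∀ i ≤ l + 1, d i + e i + 1 ≤ f i) :
    nm (vbox l d b 0) + nm (vbox l e b 0) < nm (vbox l f b 0) := by
  have key : ∀ d : Vec, (∀ i ≤ l + 1, nm (d i) ≤ nm (d 0)) →
      nm (bpos l d b 1) ≤ expG^[l + 1] (nm (d 0) + nm (b 0)) := by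
    intro d hd
    rw [bpos_congr (f' := vres (l + 1) d) (g' := b)
      (fun i _ hi => (vres_of_le d hi).symm) (fun _ _ _ => rfl) 1 le_rfl (by omega)]
    refine nm_bpos_le' (fun i => ?_) hb.norm 1
    rw [vres]
    split_ifs with h
    · exact hd i h
    · simp
  rw [vbox_zero l hd hb.nat, vbox_zero l he hb.nat, vbox_zero l hf hb.nat]
  simp only [nm_natCast]
  refine (Psi_om_add_Psi_om_le _ _ _ _).trans_lt (Psi_om_lt ?_ ?_)
  · exact add_one_le_iff.1 (bpos_add_lt (fun i _ hi => h i hi) 1 le_rfl (by omega))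
  · have h0 : nm (d 0) + nm (e 0) + 1 ≤ nm (f 0) := by
      have := h 0 (by omega)
      rw [hd, he, hf] at this
      exact_mod_cast this
    have h₁ := key d hdn
    have h₂ := key e hen
    have h₃ := expG_iterate_mono (l + 1)
      (by omega : nm (d 0) + nm (b 0) ≤ nm (f 0) + nm (b 0))
    have h₄ := expG_iterate_mono (l + 1)
      (by omega : nm (e 0) + nm (b 0) ≤ nm (f 0) + nm (b 0))
    have h₅ := expG_bound_le_Phi (l := l + 1) (s := nm (f 0) + nm (b 0) + l)
      (x := nm (f 0) + nm (b 0)) (by omega) (by omega)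
    have h₆ := Phi_mono (by omega : nm (f 0) + nm (b 0) + l ≤
      nm (bpos l f b 1) + (nm (f 0) + nm (b 0) + l))
    rw [nm_add]
    omega

end GodelT

namespace GodelT
open NO

/-! ### The vectors of the constants -/

/-- The vector `⟨1, …, 1⟩` of level `l`. -/
noncomputable def oneVec (l : ℕ) : Vec := fun i => if i ≤ l then 1 else 0

/-- The vector `⟨2, 1, …, 1, ω⟩` of level `n + 2`. -/
noncomputable def recVec (n : ℕ) : Vec := fun i =>
  if i = 0 then 1 + 1 else if i = n + 2 then om else if i ≤ n + 2 then 1 else 0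

/-- The vector `⟨t, 1, …, 1, t⟩` of level `n + 2`. -/
noncomputable def supVec (n : ℕ) (t : NO) : Vec := fun i =>
  if i = 0 ∨ i = n + 2 then t else if i ≤ n + 2 then 1 else 0

theorem good_oneVec (l : ℕ) : Good l (oneVec l) := by
  refine ⟨by simp [oneVec], fun i hi => by simp [oneVec, hi], fun i => ?_,
    fun i hi => if_neg (by omega)⟩
  simp only [oneVec]
  split_ifs <;> simp_all

theorem one_le_om : 1 ≤ om := by simpa using (natCast_lt_om 1).le

theorem good_recVec (n : ℕ) : Good (n + 2) (recVec n) := by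
  have h0 : recVec n 0 = 1 + 1 := if_pos rfl
  refine ⟨by rw [h0, nm_add, nm_one]; norm_num, fun i hi => ?_, fun i => ?_, fun i hi => ?_⟩
  · simp only [recVec]
    split_ifs
    · exact le_add_of_nonneg_right zero_le_one
    · exact one_le_om
    · exact le_rfl
  · rw [h0, nm_add, nm_one]
    simp only [recVec]
    split_ifs <;> simp
  · simp only [recVec]
    rw [if_neg (by omega), if_neg (by omega), if_neg (by omega)]

theorem supVec_zero (n : ℕ) (t : NO) : supVec n t 0 = t := if_pos (.inl rfl)

theorem good_supVec (n : ℕ) {t : ℕ} (ht : 1 ≤ t) : Good (n + 2) (supVec n t) := by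
  have ht' : (1 : NO) ≤ t := by exact_mod_cast ht
  refine ⟨by rw [supVec_zero, nm_natCast], fun i hi => ?_, fun i => ?_, fun i hi => ?_⟩
  · simp only [supVec]
    split_ifs
    · exact ht'
    · exact le_rfl
  · rw [supVec_zero, nm_natCast]
    simp only [supVec]
    split_ifs
    · simp
    · simpa using ht
    · simp
  · simp only [supVec]
    rw [if_neg (by omega), if_neg (by omega)]

theorem Prec.trans {a b c : Vec} (h : Prec a b) (h' : Prec b c) : Prec a c :=
  ⟨h.1.trans h'.1, fun i => (h.2 i).trans (h'.2 i)⟩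

theorem nat_cast_lt {a b : Vec} (ha : a 0 = (nm (a 0) : NO)) (hb : b 0 = (nm (b 0) : NO))
    (h : nm (a 0) < nm (b 0)) : a 0 < b 0 := by
  rw [ha, hb]
  exact_mod_cast h

theorem prec_vbox_left {l m : ℕ} {f g : Vec} (hf : Good m f) (hg : Good l g) (hl : l < m) :
    Prec f (vbox l f g) := by
  have h := right_lt_vbox_zero hf hg (by omega)
  have h0 := nat_cast_lt hf.nat (hf.vbox hg hl).nat (by omega)
  refine ⟨h0, fun i => ?_⟩
  rcases eq_or_ne i 0 with rfl | hi
  · exact h0.le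
  · rw [vbox_pos _ _ hi]
    exact le_bpos f g i

theorem prec_vbox_right {l m : ℕ} {f g : Vec} (hf : Good m f) (hg : Good l g) (hl : l < m) :
    Prec g (vres l (vbox l f g)) := by
  have h := right_lt_vbox_zero hf hg (by omega)
  have h0 := nat_cast_lt hg.nat (hf.vbox hg hl).nat (by omega)
  refine ⟨h0, fun i => ?_⟩
  rcases eq_or_ne i 0 with rfl | hi
  · exact h0.le
  · rcases le_or_gt i l with h | h
    · rw [vres_of_le _ h, vbox_pos _ _ hi]
      exact le_bpos_right f g h
    · rw [hg.zero i h]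
      exact zero_le _

theorem prec_case {n : ℕ} {f a b : Vec} (hf : Good (n + 1) f) (ha : Good n a) (hb : Good n b) :
    Prec a (vres n (vbox n (vres (n + 1) (vbox n f a)) b)) := by
  refine (prec_vbox_right hf ha (by omega)).trans ?_
  have := (prec_vbox_left ((hf.vbox ha (by omega)).vres le_rfl) hb (by omega)).vres n
  refine ⟨this.1, fun i => le_trans (le_of_eq ?_) (this.2 i)⟩
  simp only [vres]
  split_ifs
  · rfl
  · omega
  · rfl

/-- The gain `3` is what the recursion rule consumes: `2 ^ (t + 3) = 8 * 2 ^ t`. -/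
theorem succ_vbox {t : Vec} (ht : Good 0 t) :
    nm (t 0) + 3 ≤ nm (vres 0 (vbox 0 (oneVec 1) t) 0) := by
  have h1 : 1 ≤ bpos 0 (oneVec 1) t 1 :=
    ((good_oneVec 1).pos 1 le_rfl).trans (le_bpos _ t 1)
  rw [vres_of_le _ le_rfl, vbox_zero 0 (good_oneVec 1).nat ht.nat, nm_natCast]
  have h := Phi_lt_Psi h1 (nm (oneVec 1 0) + nm (t 0) + 0)
  refine le_trans (le_Phi ?_) h.le
  omega

/-- The top component `ω` of the recursor lies above the natural number `t 0`, and `□` puts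
component `0` above that of its right argument. -/
theorem prec_supVec {n : ℕ} {t : Vec} (ht : Good 0 t) :
    Prec (supVec n (t 0)) (vres (n + 2) (vbox 0 (recVec n) t)) := by
  have h := right_lt_vbox_zero (good_recVec n) ht (by omega)
  have h0 := nat_cast_lt ht.nat ((good_recVec n).vbox ht (by omega)).nat (by omega)
  refine ⟨by rw [supVec_zero]; exact h0, fun i => ?_⟩
  rcases eq_or_ne i 0 with rfl | hi
  · rw [supVec_zero]; exact h0.le
  · rcases le_or_gt i (n + 2) with h | h
    · rw [vres_of_le _ h, vbox_pos _ _ hi, bpos_of_lt _ _ (by omega)]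
      simp only [supVec, recVec, hi, false_or, if_false]
      split_ifs
      · rw [ht.nat]
        exact (natCast_lt_om _).le
      · rfl
    · have : supVec n (t 0) i = 0 := by
        simp only [supVec]
        rw [if_neg (by omega), if_neg (by omega)]
      rw [this]
      exact zero_le _

/-! ### The recursor -/

/-- The top component of the recursion rule, with `u = 2^t` and `v = 2^s`. -/
theorem rec_ineq_base {a u v : NO} (hu : 1 ≤ u) (hv : 8 * u ≤ v) :
    a + a + u * (1 + a) + u * (1 + a) + 3 ≤ v * (1 + a) :=
  calc a + a + u * (1 + a) + u * (1 + a) + 3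
      ≤ a + a + u * (1 + a) + u * (1 + a) + 3 + (a + 3 * (1 + a) ) := 
        le_add_of_nonneg_right (zero_le _)
    _ = 6 * (1 * (1 + a)) + 2 * (u * (1 + a)) := by ring
    _ ≤ 6 * (u * (1 + a)) + 2 * (u * (1 + a)) := by gcongr
    _ = 8 * u * (1 + a) := by ring
    _ ≤ v * (1 + a) := by gcongr

/-- The components below the top: `x`, `c` and `r` stand for the powers of two whose exponents are
the components `i + 1` of `At(R^tAB)`, `R^tAB` and `R^{St}AB`; `q` and `qs` are the components `i`
of `R^tA` and `R^{St}A`. -/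
theorem rec_ineq_step {a b c q qs r x : NO} (hx : 1 ≤ x) (hc : 1 ≤ c) (hr : 8 * (x * c) ≤ r)
    (hq : 1 + a ≤ q) (hqs : q ≤ qs) :
    x * (a + c * (q + b)) + a + c * (q + b) + q + 3 ≤ r * (qs + b) := by
  have h₁ : x ≤ x * c := le_mul_of_one_le_right (zero_le _) hc
  have h₂ : c ≤ x * c := le_mul_of_one_le_left (zero_le _) hx
  have h₃ : a ≤ q := (le_add_of_nonneg_left zero_le_one).trans hq
  have h₄ : 1 ≤ q := (le_add_of_nonneg_right (zero_le _)).trans hq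
  have h₅ : 1 ≤ x * c := hc.trans h₂
  calc x * (a + c * (q + b)) + a + c * (q + b) + q + 3
      = x * a + x * c * q + x * c * b + 1 * a + c * q + c * b + 1 * q + 3 * (1 * 1) := by ring
    _ ≤ (x * c) * q + x * c * q + x * c * b + (x * c) * q + (x * c) * q + (x * c) * b +
        (x * c) * q + 3 * ((x * c) * q) := by gcongr
    _ ≤ (x * c) * q + x * c * q + x * c * b + (x * c) * q + (x * c) * q + (x * c) * b +
        (x * c) * q + 3 * ((x * c) * q) + 6 * ((x * c) * b) := le_add_of_nonneg_right (zero_le _)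
    _ = 8 * (x * c) * (q + b) := by ring
    _ ≤ r * (qs + b) := by gcongr

theorem pw_three : pw 3 = 8 := by
  have := pw_natCast 3
  norm_num at this
  exact this

/-- In components `≥ 1`, `Q` belongs to `R^tA`, `C` to `R^tAB`, and `bpos n a C` to `At(R^tAB)`. All
four summands are needed because component `0` of the reduct, once its inner `ψ` are removed,
collects all of them in its multiple of `ω`. At the top, `s ≥ t + 3` supplies a factor `8`. Below
it, the slack `3` in the exponents of component `i + 1` supplies the factor `8` again. -/
theorem bpos_rec_le {n : ℕ} {a b : Vec} {t s : ℕ} (hs : t + 3 ≤ s) :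
    let Q := bpos (n + 1) (supVec n t) a
    let Qs := bpos (n + 1) (supVec n s) a
    let C := bpos n Q b
    ∀ i, 1 ≤ i → i ≤ n + 1 →
      (bpos n a C i + a i + C i + Q i + 3 ≤ bpos n Qs b i) ∧ Q i ≤ Qs i := by
  intro Q Qs C
  have hQQ : ∀ i, 1 ≤ i → Q i ≤ Qs i := by
    refine bpos_mono (fun i _ => ?_) fun _ _ _ => le_rfl
    simp only [supVec]
    split_ifs
    · exact Nat.cast_le.2 (by omega)
    · rfl
    · rfl
  have htop : ∀ k : ℕ, bpos (n + 1) (supVec n k) a (n + 1) = pw k * (1 + a (n + 1)) := by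
    intro k
    rw [bpos_of_le _ _ le_rfl, bpos_of_lt _ _ (by omega)]
    simp [supVec]
  have hQa : ∀ i, 1 ≤ i → i ≤ n + 1 → 1 + a i ≤ Q i := by
    intro i h1 hi
    simp only [Q]
    rw [bpos_of_le _ _ hi]
    have : supVec n t i = 1 := by
      simp only [supVec]
      rw [if_neg (by omega), if_pos (by omega)]
    rw [this]
    exact le_mul_of_one_le_left (zero_le _) (one_le_pw _)
  intro i h1 hi
  refine ⟨?_, hQQ i h1⟩
  revert i
  refine down_induction n (fun i h h1 h2 => ?_) fun i h ih h1 h2 => ?_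
  · obtain rfl : i = n + 1 := by omega
    have hC : C (n + 1) = Q (n + 1) := bpos_of_lt _ _ h
    rw [bpos_of_lt _ _ h, bpos_of_lt _ _ h, hC]
    simp only [Q, Qs, htop]
    refine rec_ineq_base (one_le_pw _) ?_
    calc 8 * pw t = pw ((3 + t : ℕ) : NO) := by push_cast; rw [pw_add, pw_three]
      _ ≤ pw s := pw_le_pw (Nat.cast_le.2 (by omega))
  · have ih := ih (by omega) (by omega)
    have hC : C i = pw (C (i + 1)) * (Q i + b i) := bpos_of_le _ _ h
    rw [bpos_of_le a C h, bpos_of_le Qs b h, hC]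
    refine rec_ineq_step (one_le_pw _) (one_le_pw _) ?_ (hQa i h1 h2) (hQQ i h1)
    calc 8 * (pw (bpos n a C (i + 1)) * pw (C (i + 1)))
        = pw (bpos n a C (i + 1) + C (i + 1) + 3) := by
          rw [pw_add, pw_add, pw_three, mul_comm]
      _ ≤ pw (bpos n a C (i + 1) + C (i + 1) + 3 + (a (i + 1) + Q (i + 1))) :=
          pw_le_pw (le_add_of_nonneg_right (zero_le _))
      _ = pw (bpos n a C (i + 1) + a (i + 1) + C (i + 1) + Q (i + 1) + 3) := by
          congr 1; ring
      _ ≤ pw (bpos n Qs b (i + 1)) := pw_le_pw ih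

theorem Psi_om_add_Psi (a b : NO) (k l m : ℕ) :
    Psi (om * a + ((k + Psi (om * b + l) + m : ℕ) : NO)) ≤
      Psi (om * (a + b) + ((k + l + m : ℕ) : NO)) := by
  have := Psi_add_Psi_le (om * a + ((k + m : ℕ) : NO)) (om * b + l)
  refine le_trans (le_of_eq ?_) (this.trans (le_of_eq ?_)) <;> congr 1 <;> push_cast <;> ring

/-- This is the rule `R^{St}AB ▷ At(R^tAB)`, with `s` in place of the value of `St`. Component `0`
of the reduct contains three inner values of `ψ`, those of `At`, `R^tAB` and `R^tA`. Removing them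
leaves a single `ψ` whose multiple of `ω` is smaller than that of the redex by `bpos_rec_le`; the
finite parts then matter only for the norm condition. -/
theorem prec_rec {n t s : ℕ} {a b u : Vec} (ha : Good (n + 1) a) (hb : Good n b)
    (hu : Good 0 u) (hut : nm (u 0) = t) (ht : 1 ≤ t) (hs : t + 3 ≤ s) :
    Prec
      (vres n (vbox n (vres (n + 1) (vbox 0 a u))
        (vres n (vbox n (vres (n + 1) (vbox (n + 1) (supVec n t) a)) b))))
      (vres n (vbox n (vres (n + 1) (vbox (n + 1) (supVec n s) a)) b)) := by
  set Q := bpos (n + 1) (supVec n t) a with hQ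
  set Qs := bpos (n + 1) (supVec n s) a with hQs
  set C := bpos n Q b with hC
  have key := bpos_rec_le (n := n) (a := a) (b := b) hs
  simp only [← hQ, ← hQs, ← hC] at key
  have gA := (ha.vbox hu (by omega)).vres (l := n + 1) le_rfl
  have gQ := ((good_supVec n ht).vbox ha (by omega)).vres (l := n + 1) (by omega)
  have gQs := ((good_supVec n (by omega : 1 ≤ s)).vbox ha (by omega)).vres (l := n + 1) (by omega)
  have gC := (gQ.vbox hb (by omega)).vres (l := n) (by omega)
  have gL := (gA.vbox gC (by omega)).vres (l := n) (by omega)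
  have gR := (gQs.vbox hb (by omega)).vres (l := n) (by omega)
  have eQ : ∀ r : ℕ, ∀ i, 1 ≤ i → i ≤ n + 1 →
      vres (n + 1) (vbox (n + 1) (supVec n r) a) i = bpos (n + 1) (supVec n r) a i := by
    intro r i h1 hi
    rw [vres_of_le _ hi, vbox_pos _ _ (by omega)]
  have eA : ∀ i, 1 ≤ i → i ≤ n + 1 → vres (n + 1) (vbox 0 a u) i = a i := by
    intro i h1 hi
    rw [vres_of_le _ hi, vbox_pos _ _ (by omega), bpos_of_lt _ _ (by omega)]
  have eC : ∀ i, 1 ≤ i → i ≤ n + 1 →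
      bpos n (vres (n + 1) (vbox (n + 1) (supVec n t) a)) b i = C i := 
    bpos_congr (eQ t) fun _ _ _ => rfl
  have eR : ∀ i, 1 ≤ i → i ≤ n + 1 →
      bpos n (vres (n + 1) (vbox (n + 1) (supVec n s) a)) b i = bpos n Qs b i := 
    bpos_congr (eQ s) fun _ _ _ => rfl
  have eL : ∀ i, 1 ≤ i → i ≤ n + 1 →
      bpos n (vres (n + 1) (vbox 0 a u))
        (vres n (vbox n (vres (n + 1) (vbox (n + 1) (supVec n t) a)) b)) i = bpos n a C i :=
    bpos_congr eA fun i h1 hi => by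
      rw [vres_of_le _ hi, vbox_pos _ _ (by omega), eC i h1 (by omega)]
  have h0 : nm (vres n (vbox n (vres (n + 1) (vbox 0 a u))
        (vres n (vbox n (vres (n + 1) (vbox (n + 1) (supVec n t) a)) b))) 0) <
      nm (vres n (vbox n (vres (n + 1) (vbox (n + 1) (supVec n s) a)) b) 0) := by
    rw [vres_of_le _ (by omega), vres_of_le (l := n) (i := 0)
      (vbox n (vres (n + 1) (vbox (n + 1) (supVec n s) a)) b) (by omega),
      vbox_zero n gA.nat gC.nat, vbox_zero n gQs.nat hb.nat, eL 1 le_rfl (by omega),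
      eR 1 le_rfl (by omega), vres_of_le (l := n) (i := 0) _ (by omega),
      vbox_zero n gQ.nat hb.nat, eC 1 le_rfl (by omega)]
    simp only [vres_of_le (l := n + 1) (i := 0) _ (by omega)]
    rw [vbox_zero 0 ha.nat hu.nat, bpos_of_lt a u (by omega : 0 < 1),
      vbox_zero (n + 1) (good_supVec n ht).nat ha.nat,
      vbox_zero (n + 1) (good_supVec n (by omega : 1 ≤ s)).nat ha.nat, supVec_zero, supVec_zero,
      hut, ← hQ, ← hQs]
    simp only [nm_natCast]
    set a0 := nm (a 0)
    set b0 := nm (b 0)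
    set p := Psi (om * Qs 1 + ((s + a0 + (n + 1) : ℕ) : NO)) with hp
    -- The finite part of the redex contains `p`, hence also `s`, `a0` and the level.
    have hpl : s + a0 + (n + 1) ≤ p := by
      refine le_trans ?_ (Psi_add_natCast_le _ _)
      omega
    set L1 := bpos n a C 1
    have step : Psi (om * L1 + ((Psi (om * a 1 + ((a0 + t + 0 : ℕ) : NO)) +
        Psi (om * C 1 + ((Psi (om * Q 1 + ((t + a0 + (n + 1) : ℕ) : NO)) + b0 + n : ℕ) : NO)) +
          n : ℕ) : NO)) ≤
        Psi (om * (L1 + a 1 + C 1 + Q 1) +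
          (((a0 + t) + (t + a0 + (n + 1)) + b0 + n + n : ℕ) : NO)) := by
      have s₁ := Psi_om_add_Psi L1 (C 1) (Psi (om * a 1 + ((a0 + t + 0 : ℕ) : NO)))
        (Psi (om * Q 1 + ((t + a0 + (n + 1) : ℕ) : NO)) + b0 + n) n
      have s₂ := Psi_om_add_Psi (L1 + C 1) (a 1) 0 (a0 + t + 0)
        (Psi (om * Q 1 + ((t + a0 + (n + 1) : ℕ) : NO)) + b0 + n + n)
      have s₃ := Psi_om_add_Psi (L1 + C 1 + a 1) (Q 1) (a0 + t) (t + a0 + (n + 1))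
        (b0 + n + n)
      refine (s₁.trans (le_of_eq ?_)).trans (s₂.trans ((le_of_eq ?_).trans (s₃.trans
        (le_of_eq ?_)))) <;> congr 1 <;> push_cast <;> ring
    refine step.trans_lt (Psi_om_lt ?_ ?_)
    · have := (key 1 le_rfl (by omega)).1
      refine lt_of_lt_of_le ?_ this
      exact lt_add_of_pos_right _ (by norm_num)
    -- `σ` is the finite part of the collapsed argument of the redex. The three nested `bpos` cost
    -- at most `3 * n + 5` iterations of `expG`, which `σ` allows since it exceeds `n`.
    · set σ := p + b0 + n with hσ
      have nQ : ∀ i, nm (Q i) ≤ expG^[n + 2] (t + a0) := fun i => by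
        refine nm_bpos_le' (l := n + 1) (fun j => ?_) ha.norm i
        simpa [supVec_zero] using (good_supVec n ht).norm j
      have nC : ∀ i, nm (C i) ≤ expG^[n + 1 + (n + 2)] (t + a0 + b0) := fun i => by
        refine (nm_bpos_le' (l := n) nQ hb.norm i).trans ?_
        rw [Function.iterate_add_apply _ (n + 1) (n + 2)]
        refine expG_iterate_mono _ ?_
        have : ∀ k x y : ℕ, expG^[k] x + y ≤ expG^[k] (x + y) := by
          intro k x y
          have hm : StrictMono expG^[k] := StrictMono.iterate
            (fun a b h => Nat.pow_lt_pow_right (by norm_num) (by omega)) k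
          induction y with
          | zero => simp
          | succ y ih =>
            have := hm (show x + y < x + (y + 1) by omega)
            omega
        exact this _ _ _
      have nL : nm L1 ≤ expG^[n + 1 + (n + 1 + (n + 2)) + 1] (t + a0 + b0) := by
        refine (nm_bpos_le' (l := n) ha.norm nC 1).trans ?_
        rw [add_assoc (n + 1), Function.iterate_add_apply expG (n + 1) (n + 1 + (n + 2) + 1),
          Function.iterate_succ_apply' expG (n + 1 + (n + 2))]
        refine expG_iterate_mono _ ?_
        have := two_mul_lt_expG (expG^[n + 1 + (n + 2)] (t + a0 + b0))
        have := le_expG_iterate (n + 1 + (n + 2)) (t + a0 + b0)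
        omega
      have m := fun k (h : k ≤ n + 1 + (n + 1 + (n + 2)) + 1) =>
        expG_iterate_le_iterate h (t + a0 + b0)
      have m₁ := m (n + 1 + (n + 2)) (by omega)
      have m₂ := m (n + 2) (by omega)
      have m₃ := expG_iterate_mono (n + 2) (by omega : t + a0 ≤ t + a0 + b0)
      have m₄ := le_expG_iterate (n + 1 + (n + 1 + (n + 2)) + 1) (t + a0 + b0)
      have h₁ := nQ 1
      have h₂ := nC 1
      have h₃ := ha.norm 1
      have h₄ := expG_bound_le_Phi (l := n + 1 + (n + 1 + (n + 2)) + 1) (s := σ)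
        (x := t + a0 + b0) (by omega) (by omega)
      have h₅ := Phi_mono (by omega : σ ≤ nm (bpos n Qs b 1) + σ)
      simp only [nm_add]
      omega
  have h0' := nat_cast_lt gL.nat gR.nat h0
  refine ⟨h0', fun i => ?_⟩
  rcases eq_or_ne i 0 with rfl | hi
  · exact h0'.le
  · rcases le_or_gt i n with h | h
    · rw [vres_of_le _ h, vres_of_le (vbox n _ b) h, vbox_pos _ _ hi, vbox_pos _ _ hi,
        eL i (by omega) (by omega), eR i (by omega) (by omega)]
      refine le_trans ?_ (key i (by omega) (by omega)).1
      calc bpos n a C i ≤ bpos n a C i + (a i + C i + Q i + 3) :=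
            le_add_of_nonneg_right (zero_le _)
        _ = _ := by ring
    · rw [gL.zero i h]
      exact zero_le _

end GodelT

namespace GodelT
open NO

/-! ### Assignments -/

/-- The admissible vectors of level `l`. -/
abbrev GVec (l : ℕ) : Type 1 := {b : Vec // Good l b}

/-- The admissible vector `⟨1, …, 1⟩` of level `l`. -/
noncomputable def oneGVec (l : ℕ) : GVec l := ⟨oneVec l, good_oneVec l⟩

/-- Extension of an environment by a fresh parameter for the variable `X`. -/
def envExt {W : Type 1} (η : TVar → W → Vec) (X : TVar) : TVar → W × GVec X.1.lv → Vec :=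
  fun Y p => if Y = X then p.2.1 else η Y p.1

/-- The vectors `⟨c₀, 1, …, 1, c₀⟩` may be assigned to the applications of the term, provided that
it is some `R_τ` and that `p` holds. -/
def RecAlt (p : Prop) {W : Type 1} : {σ : FType} → Term σ → (W → Vec) → (W → Vec) → Prop
  | _, .recR τ, c, a => p ∧ a = fun w => supVec τ.lv (c w 0)
  | _, _, _, _ => False

theorem RecAlt.comp {p : Prop} {W W' : Type 1} {σ : FType} {B : Term σ} {c a : W' → Vec}
    (φ : W → W') (h : RecAlt p B c a) : RecAlt p B (c ∘ φ) (a ∘ φ) := by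
  cases B with
  | recR τ => obtain ⟨hp, rfl⟩ := h; exact ⟨hp, rfl⟩
  | _ => exact h.elim

theorem RecAlt.subst {p : Prop} {W : Type 1} {σ : FType} {B : Term σ} {c a : W → Vec}
    (h : RecAlt p B c a) (ρ : FType) (k : ℕ) (C : Term ρ) :
    RecAlt p (Term.subst ρ k C B) c a := by
  cases B with
  | recR τ => exact h
  | _ => exact h.elim

theorem RecAlt.rename_iff {p : Prop} {W : Type 1} {σ : FType} {B : Term σ} {c a : W → Vec}
    (ρ : FType) (k m : ℕ) :
    RecAlt p (Term.subst ρ k (.var ρ m) B) c a ↔ RecAlt p B c a := by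
  cases B with
  | var σ n =>
    rw [Term.subst]
    split_ifs with e
    · obtain ⟨rfl, rfl⟩ := e
      exact Iff.rfl
    · exact Iff.rfl
  | lam π n G =>
    rw [Term.subst]
    split_ifs <;> exact Iff.rfl
  | _ => exact Iff.rfl

theorem RecAlt.alphaConv_iff {p : Prop} {W : Type 1} {σ : FType} {A B : Term σ} {c a : W → Vec}
    (h : Term.AlphaConv A B) : RecAlt p A c a ↔ RecAlt p B c a := by
  cases h <;> exact Iff.rfl

/-- `Assign p A W η a`: the family `a` of vectors, which depends on a parameter from `W`, is an
assignment to the term `A` with respect to the environment `η`. In the clause for `λX.G` the family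
`d` may be anything that dominates the assignment `g` to `G` in the appropriate way, and
`R_τ t` may also be treated like `R_τ^t` if `p` holds. -/
def Assign (p : Prop) : {σ : FType} → Term σ → (W : Type 1) → (TVar → W → Vec) → (W → Vec) → Prop
  | _, .var σ k, _, η, a => a = η (σ, k)
  | _, .zero, _, _, a => a = fun _ => oneVec 0
  | _, .succ, _, _, a => a = fun _ => oneVec 1
  | _, .caseD τ, _, _, a => a = fun _ => oneVec (τ.lv + 1)
  | _, .recR τ, _, _, a => a = fun _ => recVec τ.lv
  | _, .recSup τ t, W, η, a => ∃ c, Assign p t W η c ∧ a = fun w => supVec τ.lv (c w 0)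
  | _, .app (σ := σ) (τ := τ) B C, W, η, a =>
      ∃ b c, Assign p B W η b ∧ Assign p C W η c ∧
        (a = (fun w => vres τ.lv (vbox σ.lv (b w) (c w))) ∨ RecAlt p B c a)
  | _, .lam (σ := σ) ρ k G, W, η, a =>
      ∃ (d : W → Vec) (g : W × GVec ρ.lv → Vec),
        (∀ w, Good (max (ρ.lv + 1) σ.lv) (d w)) ∧
        (∀ w (b : GVec ρ.lv) (e : Vec), Good σ.lv e →
          Prec (g (w, b)) (vres σ.lv (vbox ρ.lv (d w + e) b.1))) ∧
        Assign p G (W × GVec ρ.lv) (envExt η (ρ, k)) g ∧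
        a = fun w => d w + g (w, oneGVec ρ.lv)

/-- All vectors of the environment are admissible. -/
def GoodEnv {W : Type 1} (η : TVar → W → Vec) : Prop := ∀ X w, Good X.1.lv (η X w)

theorem GoodEnv.ext {W : Type 1} {η : TVar → W → Vec} (h : GoodEnv η) (X : TVar) :
    GoodEnv (envExt η X) := by
  intro Y p
  rw [envExt]
  split_ifs with e
  · rw [e]; exact p.2.2
  · exact h Y p.1

theorem lv_arrow (σ τ : FType) : (FType.arrow σ τ).lv = max (σ.lv + 1) τ.lv := rfl

theorem lv_nat : FType.nat.lv = 0 := rfl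

theorem lv_iterT (τ : FType) : τ.iterT.lv = τ.lv + 2 := by
  simp only [FType.lv]; omega

theorem lv_recR (τ : FType) : (FType.arrow .nat τ.iterT).lv = τ.lv + 2 := by
  simp only [FType.lv]; omega

theorem lv_caseT (τ : FType) : τ.caseT.lv = τ.lv + 1 := by
  simp only [FType.lv]; omega

theorem lv_step (τ : FType) : (FType.arrow .nat (.arrow τ τ)).lv = τ.lv + 1 := by
  simp only [FType.lv]; omega

theorem lv_case₂ (τ : FType) : (FType.arrow τ (.arrow τ τ)).lv = τ.lv + 1 := by
  simp only [FType.lv]; omega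

theorem lv_endo (τ : FType) : (FType.arrow τ τ).lv = τ.lv + 1 := by
  simp only [FType.lv]; omega

theorem Assign.good {p : Prop} : ∀ {σ : FType} {A : Term σ} {W : Type 1} {η : TVar → W → Vec} {a : W → Vec},
    GoodEnv η → Assign p A W η a → ∀ w, Good σ.lv (a w)
  | _, .var σ k, _, _, _, hη, h, w => by
      subst h
      exact hη (σ, k) w
  | _, .zero, _, _, _, _, h, w => by subst h; exact good_oneVec 0
  | _, .succ, _, _, _, _, h, w => by subst h; exact good_oneVec 1
  | _, .caseD τ, _, _, _, _, h, w => by subst h; rw [lv_caseT]; exact good_oneVec _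
  | _, .recR τ, _, _, _, _, h, w => by subst h; rw [lv_recR]; exact good_recVec _
  | _, .recSup τ t, _, _, _, hη, h, w => by
      obtain ⟨c, hc, rfl⟩ := h
      have := hc.good hη w
      rw [lv_iterT]
      beta_reduce
      rw [this.nat]
      exact good_supVec _ this.pos'
  | _, .app B C, _, _, _, hη, h, w => by
      obtain ⟨b, c, hb, hc, rfl | h⟩ := h
      · refine ((hb.good hη w).vbox (hc.good hη w) ?_).vres ?_ <;> rw [lv_arrow] <;> omega
      · have := hc.good hη w
        clear hb
        cases B with
        | recR τ =>
          obtain ⟨-, rfl⟩ := h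
          rw [lv_iterT]
          beta_reduce
          rw [this.nat]
          exact good_supVec _ this.pos'
        | _ => exact h.elim
  | _, .lam (σ := σ) ρ k G, _, _, _, hη, h, w => by
      obtain ⟨d, g, hd, -, hg, rfl⟩ := h
      have := (hd w).add (hg.good (hη.ext (ρ, k)) (w, oneGVec ρ.lv))
      rwa [max_assoc, max_self] at this

/-- An assignment may be pulled back along a change of parameters, and it depends on the environment
only at the free variables. This gives both weakening by a parameter and specialisation of one. -/
theorem Assign.comp {p : Prop} : ∀ {σ : FType} {A : Term σ} {W W' : Type 1} {η : TVar → W → Vec}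
    {η' : TVar → W' → Vec} {a : W' → Vec} (φ : W → W'),
    (∀ X ∈ A.FV, ∀ w, η X w = η' X (φ w)) → Assign p A W' η' a → Assign p A W η (a ∘ φ)
  | _, .var σ k, _, _, _, _, _, φ, hφ, h => by
      subst h
      exact funext fun w => (hφ _ (by simp [Term.FV]) w).symm
  | _, .zero, _, _, _, _, _, _, _, h => by subst h; rfl
  | _, .succ, _, _, _, _, _, _, _, h => by subst h; rfl
  | _, .caseD τ, _, _, _, _, _, _, _, h => by subst h; rfl
  | _, .recR τ, _, _, _, _, _, _, _, h => by subst h; rfl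
  | _, .recSup τ t, _, _, _, _, _, φ, hφ, h => by
      obtain ⟨c, hc, rfl⟩ := h
      exact ⟨c ∘ φ, hc.comp φ hφ, rfl⟩
  | _, .app B C, _, _, _, _, _, φ, hφ, h => by
      obtain ⟨b, c, hb, hc, h⟩ := h
      exact ⟨b ∘ φ, c ∘ φ, hb.comp φ fun X hX => hφ X (by simp [Term.FV, hX]),
        hc.comp φ fun X hX => hφ X (by simp [Term.FV, hX]),
        h.imp (fun h => by rw [h]; rfl) (RecAlt.comp φ)⟩
  | _, .lam ρ k G, _, _, _, _, _, φ, hφ, h => by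
      obtain ⟨d, g, hd, hdg, hg, rfl⟩ := h
      refine ⟨d ∘ φ, g ∘ Prod.map φ id, fun w => hd _, fun w b e he => hdg (φ w) b e he,
        hg.comp _ fun X hX w => ?_, rfl⟩
      simp only [envExt]
      split_ifs with e
      · rfl
      · exact hφ X (by simp [Term.FV, hX, e]) w.1

/-- Substitution is specialisation of a parameter: `φ` inserts the value of `B` at `X`. Disjointness
keeps the binders of `A` away from the free variables of `B`, so the value of `B` is unaffected when
the environment is extended under a `λ`. -/
theorem Assign.subst {p : Prop} : ∀ {σ : FType} {A : Term σ} {ρ : FType} {k : ℕ} {B : Term ρ} {W W' : Type 1}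
    {η : TVar → W → Vec} {η' : TVar → W' → Vec} {a : W' → Vec} {b : W → Vec} (φ : W → W'),
    Disjoint A.BV B.FV → (∀ X ∈ A.FV, X ≠ (ρ, k) → ∀ w, η X w = η' X (φ w)) →
    (∀ w, b w = η' (ρ, k) (φ w)) → Assign p B W η b → Assign p A W' η' a →
    Assign p (Term.subst ρ k B A) W η (a ∘ φ)
  | _, .var σ m, ρ, k, B, _, _, η, η', _, b, φ, _, hφ, hb, hB, h => by
      subst h
      rw [Term.subst]
      split_ifs with e
      · obtain ⟨rfl, rfl⟩ := e
        convert hB using 1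
        exact funext fun w => (hb w).symm
      · refine funext fun w => (hφ _ (by simp [Term.FV]) ?_ w).symm
        rintro ⟨⟩
        exact e ⟨rfl, rfl⟩
  | _, .zero, _, _, _, _, _, _, _, _, _, _, _, _, _, _, h => by subst h; rfl
  | _, .succ, _, _, _, _, _, _, _, _, _, _, _, _, _, _, h => by subst h; rfl
  | _, .caseD τ, _, _, _, _, _, _, _, _, _, _, _, _, _, _, h => by subst h; rfl
  | _, .recR τ, _, _, _, _, _, _, _, _, _, _, _, _, _, _, h => by subst h; rfl
  | _, .recSup τ t, _, _, _, _, _, _, _, _, _, φ, hd, hφ, hb, hB, h => by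
      obtain ⟨c, hc, rfl⟩ := h
      exact ⟨c ∘ φ, Assign.subst φ hd hφ hb hB hc, rfl⟩
  | _, .app C D, _, _, _, _, _, _, _, _, _, φ, hd, hφ, hb, hB, h => by
      obtain ⟨c, d, hc, hd', h⟩ := h
      simp only [Term.BV, Finset.disjoint_union_left] at hd
      exact ⟨c ∘ φ, d ∘ φ, Assign.subst φ hd.1 (fun X hX => hφ X (by simp [Term.FV, hX])) hb hB hc,
        Assign.subst φ hd.2 (fun X hX => hφ X (by simp [Term.FV, hX])) hb hB hd',
        h.imp (fun h => by rw [h]; rfl) fun h => (h.comp φ).subst _ _ _⟩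
  | _, .lam π m G, ρ, k, B, _, _, η, η', _, b, φ, hd, hφ, hb, hB, h => by
      rw [Term.subst]
      split_ifs with e
      -- The binder is the variable to be replaced: the term is unchanged, and its value does not
      -- depend on that variable.
      · refine h.comp φ fun X hX w => hφ X hX ?_ w
        rw [← e]
        simp only [Term.FV, Finset.mem_erase] at hX
        exact hX.1
      · obtain ⟨d, g, hd', hdg, hg, rfl⟩ := h
        simp only [Term.BV, Finset.disjoint_insert_left] at hd
        refine ⟨d ∘ φ, g ∘ Prod.map φ id, fun w => hd' _, fun w b e he => hdg (φ w) b e he,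
          Assign.subst (b := b ∘ Prod.fst) _ hd.2 (fun X hX hne w => ?_) (fun w => ?_)
            (hB.comp _ fun X hX w => ?_) hg, rfl⟩
        · simp only [envExt]
          split_ifs with e'
          · rfl
          · exact hφ X (by simp [Term.FV, hX, e']) hne w.1
        · simp only [envExt, if_neg (Ne.symm e)]
          exact hb w.1
        · simp only [envExt]
          rw [if_neg]
          rintro rfl
          exact hd.1 hX

/-! ### Invariance under `α`-conversion -/

/-- An equivalence is required because `AlphaEq` also uses conversions backwards. -/
theorem Assign.rename_iff {p : Prop} : ∀ {σ : FType} {A : Term σ} {ρ : FType} {k m : ℕ} {W : Type 1}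
    {η η' : TVar → W → Vec} {a : W → Vec}, (ρ, m) ∉ A.BV →
    (∀ X ∈ A.FV, X ≠ (ρ, k) → η X = η' X) → η (ρ, m) = η' (ρ, k) →
    (Assign p (Term.subst ρ k (.var ρ m) A) W η a ↔ Assign p A W η' a)
  | _, .var σ n, ρ, k, m, _, η, η', a, _, hη, hb => by
      rw [Term.subst]
      split_ifs with e
      · obtain ⟨rfl, rfl⟩ := e
        change a = _ ↔ a = _
        rw [hb]
      · change a = _ ↔ a = _
        rw [hη (σ, n) (by simp [Term.FV])]
        rintro ⟨⟩
        exact e ⟨rfl, rfl⟩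
  | _, .zero, _, _, _, _, _, _, _, _, _, _ => Iff.rfl
  | _, .succ, _, _, _, _, _, _, _, _, _, _ => Iff.rfl
  | _, .caseD τ, _, _, _, _, _, _, _, _, _, _ => Iff.rfl
  | _, .recR τ, _, _, _, _, _, _, _, _, _, _ => Iff.rfl
  | _, .recSup τ t, _, _, _, _, _, _, _, hd, hη, hb =>
      exists_congr fun c => and_congr (Assign.rename_iff hd hη hb) Iff.rfl
  | _, .app C D, _, _, _, _, _, _, _, hd, hη, hb => by
      simp only [Term.BV, Finset.mem_union, not_or] at hd
      exact exists_congr fun c => exists_congr fun d => and_congr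
        (Assign.rename_iff hd.1 (fun X hX => hη X (by simp [Term.FV, hX])) hb)
        (and_congr (Assign.rename_iff hd.2 (fun X hX => hη X (by simp [Term.FV, hX])) hb)
          (or_congr Iff.rfl (RecAlt.rename_iff _ _ _)))
  | _, .lam π n G, ρ, k, m, W, η, η', a, hd, hη, hb => by
      rw [Term.subst]
      split_ifs with e
      · have : ∀ X ∈ (Term.lam π n G).FV, η X = η' X := fun X hX => hη X hX (by
          rw [← e]
          simp only [Term.FV, Finset.mem_erase] at hX
          exact hX.1)
        exact ⟨fun h => h.comp id fun X hX w => by rw [this X hX]; rfl,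
          fun h => h.comp id fun X hX w => by rw [this X hX]; rfl⟩
      · simp only [Term.BV, Finset.mem_insert, not_or] at hd
        refine exists_congr fun d => exists_congr fun g => and_congr Iff.rfl (and_congr Iff.rfl
          (and_congr (Assign.rename_iff hd.2 (fun X hX hne => ?_) ?_) Iff.rfl))
        · funext w
          simp only [envExt]
          split_ifs with e'
          · rfl
          · rw [hη X (by simp [Term.FV, hX, e']) hne]
        · funext w
          simp only [envExt, if_neg hd.1, if_neg (Ne.symm e), hb]

theorem Assign.alphaConv_iff {p : Prop} {σ : FType} {A B : Term σ} (h : Term.AlphaConv A B) :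
    ∀ {W : Type 1} {η : TVar → W → Vec} {a : W → Vec}, Assign p A W η a ↔ Assign p B W η a := by
  induction h with
  | rename ρ k m B h₁ h₂ =>
    intro W η a
    refine exists_congr fun d => exists_congr fun g => and_congr Iff.rfl (and_congr Iff.rfl
      (and_congr (Assign.rename_iff h₂ (fun X hX hne => ?_) ?_).symm Iff.rfl))
    · funext w
      simp only [envExt]
      rw [if_neg hne, if_neg]
      rintro rfl
      exact h₁ hX
    · funext w
      simp only [envExt, if_true]
  | appFun h ih =>
    intro W η a
    exact exists_congr fun c => exists_congr fun d => and_congr ih (and_congr Iff.rfl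
      (or_congr Iff.rfl (RecAlt.alphaConv_iff h)))
  | appArg _ ih =>
    intro W η a
    exact exists_congr fun c => exists_congr fun d => and_congr Iff.rfl (and_congr ih Iff.rfl)
  | lamBody _ ih =>
    intro W η a
    exact exists_congr fun c => exists_congr fun d => and_congr Iff.rfl (and_congr Iff.rfl
      (and_congr ih Iff.rfl))
  | supArg _ ih =>
    intro W η a
    exact exists_congr fun c => and_congr ih Iff.rfl

theorem Assign.alphaEq_iff {p : Prop} {σ : FType} {A B : Term σ} (h : Term.AlphaEq A B) {W : Type 1}
    {η : TVar → W → Vec} {a : W → Vec} : Assign p A W η a ↔ Assign p B W η a := by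
  induction h with
  | rel _ _ h => exact Assign.alphaConv_iff h
  | refl => exact Iff.rfl
  | symm _ _ _ ih => exact ih.symm
  | trans _ _ _ _ _ ih₁ ih₂ => exact ih₁.trans ih₂

/-! ### Assignments decrease under reduction -/

section Reduction

variable {p : Prop} {W : Type 1} {η : TVar → W → Vec} {a : W → Vec}

/-- Through this an assignment made for `λβR'` can also be used in `λβR`. -/
theorem Assign.of_false : ∀ {σ : FType} {A : Term σ} {W : Type 1} {η : TVar → W → Vec}
    {a : W → Vec}, Assign False A W η a → Assign p A W η a
  | _, .var _ _, _, _, _, h | _, .zero, _, _, _, h | _, .succ, _, _, _, h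
  | _, .caseD _, _, _, _, h | _, .recR _, _, _, _, h => h
  | _, .recSup _ _, _, _, _, h => by
      obtain ⟨c, hc, h⟩ := h
      exact ⟨c, hc.of_false, h⟩
  | _, .app B _, _, _, _, h => by
      obtain ⟨b, c, hb, hc, h⟩ := h
      refine ⟨b, c, hb.of_false, hc.of_false, h.imp_right fun h => ?_⟩
      clear hb
      cases B with
      | recR τ => exact h.1.elim
      | _ => exact h
  | _, .lam _ _ _, _, _, _, h => by
      obtain ⟨d, g, hd, hdg, hg, h⟩ := h
      exact ⟨d, g, hd, hdg, hg.of_false, h⟩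

theorem Assign.case_zero {τ : FType} {A B : Term τ} (hη : GoodEnv η)
    (h : Assign p (.app (.app (.app (.caseD τ) .zero) A) B) W η a) :
    ∃ b, Assign p A W η b ∧ ∀ w, Prec (b w) (a w) := by
  obtain ⟨_, b, ⟨_, a, ⟨d, t, rfl, ht, rfl | h⟩, ha, rfl | h⟩, hb, rfl | h⟩ := h
  all_goals try exact h.elim
  refine ⟨a, ha, fun w => ?_⟩
  have gd : Good (τ.lv + 1) (vres (τ.lv + 1) (vbox 0 (oneVec (τ.lv + 1)) (t w))) :=
    ((good_oneVec (τ.lv + 1)).vbox (ht.good hη w) (by simp [FType.lv])).vres le_rfl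
  have := prec_case gd (ha.good hη w) (hb.good hη w)
  simpa only [lv_nat, lv_endo, lv_case₂] using this

theorem Assign.case_succ {τ : FType} {t : Term .nat} {A B : Term τ} (hη : GoodEnv η)
    (h : Assign p (.app (.app (.app (.caseD τ) (.app .succ t)) A) B) W η a) :
    ∃ b, Assign p B W η b ∧ ∀ w, Prec (b w) (a w) := by
  obtain ⟨_, b, ⟨_, a, ⟨d, t, rfl, ht, rfl | h⟩, ha, rfl | h⟩, hb, rfl | h⟩ := h
  all_goals try exact h.elim
  refine ⟨b, hb, fun w => ?_⟩
  have gd : Good (τ.lv + 1) (vres (τ.lv + 1) (vbox 0 (oneVec (τ.lv + 1)) (t w))) :=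
    ((good_oneVec (τ.lv + 1)).vbox (ht.good hη w) (by simp [FType.lv])).vres le_rfl
  have := prec_vbox_right ((gd.vbox (ha.good hη w) (by omega)).vres (l := τ.lv + 1) le_rfl)
    (hb.good hη w) (by omega)
  simpa only [lv_nat, lv_endo, lv_case₂] using this

theorem prec_iter_zero {n : ℕ} {t a b : Vec} (ht : Good 0 t) (ha : Good (n + 1) a)
    (hb : Good n b) :
    Prec b (vres n (vbox n (vres (n + 1) (vbox (n + 1) (supVec n (t 0)) a)) b)) := by
  have gs : Good (n + 2) (supVec n (t 0)) := by rw [ht.nat]; exact good_supVec _ ht.pos'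
  exact prec_vbox_right ((gs.vbox ha (by omega)).vres (l := n + 1) (by omega)) hb (by omega)

theorem prec_iter_succ {n : ℕ} {t a b : Vec} (ht : Good 0 t) (ha : Good (n + 1) a)
    (hb : Good n b) :
    Prec
      (vres n (vbox n (vres (n + 1) (vbox 0 a t))
        (vres n (vbox n (vres (n + 1) (vbox (n + 1) (supVec n (t 0)) a)) b))))
      (vres n (vbox n (vres (n + 1) (vbox (n + 1)
        (supVec n (vres 0 (vbox 0 (oneVec 1) t) 0)) a)) b)) := by
  have gs : Good 0 (vres 0 (vbox 0 (oneVec 1) t)) :=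
    ((good_oneVec 1).vbox ht (by omega)).vres (by omega)
  have := prec_rec ha hb ht rfl ht.pos' (succ_vbox ht)
  rwa [← ht.nat, ← gs.nat] at this

/-- Treating `R t` like `R^t` makes the vector of `R t A B` smaller. With transitivity, the recursor
rules of `λβR` follow from those for `R^t`. -/
theorem prec_iter_rec {n : ℕ} {t a b : Vec} (ht : Good 0 t) (ha : Good (n + 1) a)
    (hb : Good n b) :
    Prec (vres n (vbox n (vres (n + 1) (vbox (n + 1) (supVec n (t 0)) a)) b))
      (vres n (vbox n (vres (n + 1) (vbox (n + 1) (vres (n + 2) (vbox 0 (recVec n) t)) a)) b)) := by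
  have gs : Good (n + 2) (supVec n (t 0)) := by rw [ht.nat]; exact good_supVec _ ht.pos'
  have gr : Good (n + 2) (vres (n + 2) (vbox 0 (recVec n) t)) :=
    ((good_recVec n).vbox ht (by omega)).vres le_rfl
  exact ((((prec_supVec ht).vbox_left gs gr ha).vres (n + 1)).vbox_left
    ((gs.vbox ha (by omega)).vres (by omega)) ((gr.vbox ha (by omega)).vres (by omega)) hb).vres n

theorem Assign.sup {τ : FType} {t : Term .nat} (hη : GoodEnv η)
    (h : Assign False (.app (.recR τ) t) W η a) :
    ∃ b, Assign False (.recSup τ t) W η b ∧ ∀ w, Prec (b w) (a w) := by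
  obtain ⟨_, t, rfl, ht, rfl | h⟩ := h
  · refine ⟨_, ⟨t, ht, rfl⟩, fun w => ?_⟩
    have := prec_supVec (n := τ.lv) (ht.good hη w)
    simpa only [lv_nat, lv_iterT] using this
  · exact h.1.elim

theorem Assign.iter_zero {τ : FType} {A : Term (.arrow .nat (.arrow τ τ))} {B : Term τ}
    (hη : GoodEnv η) (h : Assign p (.app (.app (.recSup τ .zero) A) B) W η a) :
    ∃ b, Assign p B W η b ∧ ∀ w, Prec (b w) (a w) := by
  obtain ⟨_, b, ⟨_, a, ⟨t, ht, rfl⟩, ha, rfl | h⟩, hb, rfl | h⟩ := h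
  all_goals try exact h.elim
  refine ⟨b, hb, fun w => ?_⟩
  have ga := ha.good hη w
  rw [lv_step] at ga
  simpa only [lv_nat, lv_endo, lv_step] using prec_iter_zero (ht.good hη w) ga (hb.good hη w)

theorem Assign.iter_succ {τ : FType} {t : Term .nat} {A : Term (.arrow .nat (.arrow τ τ))}
    {B : Term τ} (hη : GoodEnv η)
    (h : Assign p (.app (.app (.recSup τ (.app .succ t)) A) B) W η a) :
    ∃ b, Assign p (.app (.app A t) (.app (.app (.recSup τ t) A) B)) W η b ∧
      ∀ w, Prec (b w) (a w) := by
  obtain ⟨_, b, ⟨_, a, ⟨s, ⟨_, t, rfl, ht, rfl | h⟩, rfl⟩, ha, rfl | h⟩, hb, rfl | h⟩ := h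
  all_goals try exact h.elim
  refine ⟨_, ⟨_, _, ⟨a, t, ha, ht, .inl rfl⟩,
    ⟨_, b, ⟨_, a, ⟨t, ht, rfl⟩, ha, .inl rfl⟩, hb, .inl rfl⟩, .inl rfl⟩, fun w => ?_⟩
  have ga := ha.good hη w
  rw [lv_step] at ga
  simpa only [lv_nat, lv_endo, lv_step] using prec_iter_succ (ht.good hη w) ga (hb.good hη w)

theorem Assign.rec_zero {τ : FType} {A : Term (.arrow .nat (.arrow τ τ))} {B : Term τ}
    (hη : GoodEnv η) (h : Assign True (.app (.app (.app (.recR τ) .zero) A) B) W η a) :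
    ∃ b, Assign True B W η b ∧ ∀ w, Prec (b w) (a w) := by
  obtain ⟨_, b, ⟨_, a, ⟨_, t, rfl, ht, h'⟩, ha, rfl | h⟩, hb, rfl | h⟩ := h
  all_goals try exact h.elim
  refine ⟨b, hb, fun w => ?_⟩
  have ga := ha.good hη w
  rw [lv_step] at ga
  have h := prec_iter_zero (ht.good hη w) ga (hb.good hη w)
  obtain rfl | ⟨-, rfl⟩ := h'
  · simpa only [lv_nat, lv_endo, lv_step, lv_iterT] using
      h.trans (prec_iter_rec (ht.good hη w) ga (hb.good hη w))
  · simpa only [lv_nat, lv_endo, lv_step] using h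

theorem Assign.rec_succ {τ : FType} {t : Term .nat} {A : Term (.arrow .nat (.arrow τ τ))}
    {B : Term τ} (hη : GoodEnv η)
    (h : Assign True (.app (.app (.app (.recR τ) (.app .succ t)) A) B) W η a) :
    ∃ b, Assign True (.app (.app A t) (.app (.app (.app (.recR τ) t) A) B)) W η b ∧
      ∀ w, Prec (b w) (a w) := by
  obtain ⟨_, b, ⟨_, a, ⟨_, s, rfl, ⟨_, t, rfl, ht, rfl | h⟩, h'⟩, ha, rfl | h⟩, hb, rfl | h⟩ := h
  all_goals try exact h.elim
  -- The recursive call `R t` receives the alternative vector, as if it were `R^t`.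
  refine ⟨_, ⟨_, _, ⟨a, t, ha, ht, .inl rfl⟩,
    ⟨_, b, ⟨_, a, ⟨_, t, rfl, ht, .inr ⟨trivial, rfl⟩⟩, ha, .inl rfl⟩, hb, .inl rfl⟩, .inl rfl⟩,
    fun w => ?_⟩
  have ga := ha.good hη w
  rw [lv_step] at ga
  have gt := ht.good hη w
  have gs : Good 0 (vres 0 (vbox 0 (oneVec 1) (t w))) :=
    ((good_oneVec 1).vbox gt (by simp [FType.lv])).vres (by omega)
  have h := prec_iter_succ gt ga (hb.good hη w)
  obtain rfl | ⟨-, rfl⟩ := h'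
  · simpa only [lv_nat, lv_endo, lv_step, lv_iterT] using
      h.trans (prec_iter_rec gs ga (hb.good hη w))
  · simpa only [lv_nat, lv_endo, lv_step] using h

/-- The domination clause of `λX.A`, taken at the value of `B` and with `e` the summand `g(1)`, is
exactly the required decrease; by `Assign.subst` the dominated family is assigned to the contractum.
-/
theorem Assign.beta {ρ σ : FType} {k : ℕ} {A : Term σ} {B : Term ρ} (hη : GoodEnv η)
    (hd : Disjoint (Term.lam ρ k A).BV B.FV) (h : Assign p (.app (.lam ρ k A) B) W η a) :
    ∃ b, Assign p (Term.subst ρ k B A) W η b ∧ ∀ w, Prec (b w) (a w) := by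
  obtain ⟨_, c, ⟨d, g, hd', hdg, hg, rfl⟩, hc, rfl | h⟩ := h
  · simp only [Term.BV, Finset.disjoint_insert_left] at hd
    refine ⟨_, Assign.subst (η' := envExt η (ρ, k)) (b := c)
      (fun w => (w, (⟨c w, hc.good hη w⟩ : GVec ρ.lv))) hd.2 (fun X hX hne w => ?_)
      (fun w => ?_) hc hg, fun w => hdg w ⟨c w, hc.good hη w⟩ _ (hg.good (hη.ext (ρ, k)) _)⟩
    · simp only [envExt, if_neg hne]
    · simp only [envExt, if_true]
  · exact h.elim

/-! ### Reduction inside applications and abstractions. -/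

theorem Assign.app_left {σ τ : FType} {A B : Term (.arrow σ τ)} {C : Term σ} (hη : GoodEnv η)
    (ih : ∀ {a}, Assign p A W η a → ∃ b, Assign p B W η b ∧ ∀ w, Prec (b w) (a w))
    (hA : ∀ c a : W → Vec, ¬ RecAlt p A c a) (h : Assign p (.app A C) W η a) :
    ∃ b, Assign p (.app B C) W η b ∧ ∀ w, Prec (b w) (a w) := by
  obtain ⟨a, c, ha, hc, rfl | h⟩ := h
  · obtain ⟨b, hb, h⟩ := ih ha
    exact ⟨_, ⟨b, c, hb, hc, .inl rfl⟩, fun w =>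
      ((h w).vbox_left (hb.good hη w) (ha.good hη w) (hc.good hη w)).vres _⟩
  · exact (hA _ _ h).elim

theorem Prec.supVec {t s : Vec} (h : Prec t s) (n : ℕ) :
    Prec (supVec n (t 0)) (GodelT.supVec n (s 0)) := by
  refine ⟨by simpa only [supVec_zero] using h.1, fun i => ?_⟩
  simp only [GodelT.supVec]
  split_ifs
  · exact h.1.le
  · rfl
  · rfl

theorem Assign.app_right {σ τ : FType} {A : Term (.arrow σ τ)} {B C : Term σ} (hη : GoodEnv η)
    (ih : ∀ {a}, Assign p B W η a → ∃ b, Assign p C W η b ∧ ∀ w, Prec (b w) (a w))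
    (h : Assign p (.app A B) W η a) :
    ∃ b, Assign p (.app A C) W η b ∧ ∀ w, Prec (b w) (a w) := by
  obtain ⟨a, b, ha, hb, h⟩ := h
  obtain ⟨c, hc, hcb⟩ := ih hb
  obtain rfl | h := h
  · exact ⟨_, ⟨a, c, ha, hc, .inl rfl⟩, fun w =>
      ((hcb w).vbox_right (ha.good hη w) (hc.good hη w) (hb.good hη w)).vres _⟩
  · cases A with
    | recR τ =>
      obtain ⟨hp, rfl⟩ := h
      exact ⟨_, ⟨a, c, ha, hc, .inr ⟨hp, rfl⟩⟩, fun w => (hcb w).supVec _⟩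
    | _ => exact h.elim

/-- The dominating family `d` is retained although the body has changed: it still dominates by
transitivity, and the decrease takes place in the summand `g(1)`. The quantifier over all `e` makes
the domination clause independent of that summand. -/
theorem Assign.lam_body {ρ σ : FType} {k : ℕ} {A B : Term σ} (hη : GoodEnv η)
    (ih : ∀ {W : Type 1} {η : TVar → W → Vec} {a : W → Vec}, GoodEnv η → Assign p A W η a →
      ∃ b, Assign p B W η b ∧ ∀ w, Prec (b w) (a w)) (h : Assign p (.lam ρ k A) W η a) :
    ∃ b, Assign p (.lam ρ k B) W η b ∧ ∀ w, Prec (b w) (a w) := by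
  obtain ⟨d, g, hd, hdg, hg, rfl⟩ := h
  obtain ⟨g', hg', h⟩ := ih (hη.ext (ρ, k)) hg
  refine ⟨_, ⟨d, g', hd, fun w b e he => (h _).trans (hdg w b e he), hg', rfl⟩,
    fun w => ⟨?_, fun i => ?_⟩⟩
  · simp only [Pi.add_apply]
    gcongr
    exact (h _).1
  · simp only [Pi.add_apply]
    gcongr
    exact (h _).2 i

theorem Assign.red {σ : FType} {A B : Term σ} (h : Term.Red A B) :
    ∀ {W : Type 1} {η : TVar → W → Vec} {a : W → Vec}, GoodEnv η → Assign True A W η a →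
      ∃ b, Assign True B W η b ∧ ∀ w, Prec (b w) (a w) := by
  induction h with
  | D_zero A B => exact Assign.case_zero
  | D_succ t A B => exact Assign.case_succ
  | R_zero A B => exact Assign.rec_zero
  | R_succ t A B => exact Assign.rec_succ
  | beta k A B hd => exact fun hη => Assign.beta hη hd
  -- A term that reduces is not the constant `R_τ`, so the alternative clause is not in force.
  | appFun h ih => exact fun hη => Assign.app_left hη (ih hη) fun c a hA => by cases h <;> exact hA
  | appArg _ ih => exact fun hη => Assign.app_right hη (ih hη)
  | xi _ ih => exact fun hη => Assign.lam_body hη ih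

theorem Assign.red' {σ : FType} {A B : Term σ} (h : Term.Red' A B) :
    ∀ {W : Type 1} {η : TVar → W → Vec} {a : W → Vec}, GoodEnv η → Assign False A W η a →
      ∃ b, Assign False B W η b ∧ ∀ w, Prec (b w) (a w) := by
  induction h with
  | D_zero A B => exact Assign.case_zero
  | D_succ t A B => exact Assign.case_succ
  | R_sup t => exact Assign.sup
  | R_zero A B => exact Assign.iter_zero
  | R_succ t A B => exact Assign.iter_succ
  | beta k A B hd => exact fun hη => Assign.beta hη hd
  | appFun h ih => exact fun hη => Assign.app_left hη (ih hη) fun c a hA => by cases h <;> exact hA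
  | appArg _ ih => exact fun hη => Assign.app_right hη (ih hη)
  | xi _ ih => exact fun hη => Assign.lam_body hη ih
  | supArg _ ih =>
    rintro W η _ hη ⟨c, hc, rfl⟩
    obtain ⟨c', hc', h⟩ := ih hη hc
    exact ⟨_, ⟨c', hc', rfl⟩, fun w => (h w).supVec _⟩

end Reduction

end GodelT

namespace GodelT
open NO

/-! ### Evaluation of ordinal terms -/

/-- Valuations of the variable vectors by admissible vectors. -/
abbrev GVal : Type 1 := ∀ X : TVar, GVec X.1.lv

/-- The value of an ordinal term. -/
noncomputable def oeval (v : GVal) : OTerm OVar → NO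
  | .var x => (v x.1).1 x.2
  | .zero => 0
  | .one => 1
  | .omega => om
  | .add f g => oeval v f + oeval v g
  | .exp2 f g => pw (oeval v f) * oeval v g
  | .psi f g => ((Psi (om * oeval v f + oeval v g) : ℕ) : NO)

/-- `Cls h i`: the term `h` belongs to the class `C_i` of the terms that may occur as component `i`
of a vector. -/
def Cls : OTerm OVar → ℕ → Prop
  | .var x, i => x.2.1 = i
  | .zero, _ => False
  | .one, _ => True
  | .omega, i => 1 ≤ i
  | .add f g, i => Cls f i ∧ Cls g i
  | .exp2 f g, i => 1 ≤ i ∧ Cls f (i + 1) ∧ Cls g i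
  | .psi f g, i => i = 0 ∧ Cls f 1 ∧ Cls g 0

open OTerm

theorem Cls.eval {h : OTerm OVar} {i : ℕ} (hi : Cls h i) (v : GVal) :
    1 ≤ oeval v h ∧ (i = 0 → oeval v h = (nm (oeval v h) : NO)) := by
  induction h generalizing i with
  | var x =>
    subst hi
    refine ⟨(v x.1).2.pos _ (by have := x.2.2; omega), fun h => ?_⟩
    have := (v x.1).2.nat
    rwa [← h] at this
  | zero => exact hi.elim
  | one => exact ⟨le_rfl, fun _ => by simp [oeval]⟩
  | omega => exact ⟨one_le_om, fun h => by rw [h] at hi; exact absurd hi (by simp [Cls])⟩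
  | add f g ihf ihg =>
    refine ⟨(ihf hi.1).1.trans (le_add_of_nonneg_right (zero_le _)), fun h => ?_⟩
    rw [oeval, nm_add, Nat.cast_add, ← (ihf hi.1).2 h, ← (ihg hi.2).2 h]
  | exp2 f g _ ihg =>
    refine ⟨?_, fun h => ?_⟩
    · exact one_le_mul (one_le_pw _) (ihg hi.2.2).1
    · have := hi.1
      omega
  | psi f g ihf ihg =>
    refine ⟨?_, fun _ => by simp [oeval]⟩
    have h := Phi_lt_Psi (ihf hi.2.1).1 (nm (oeval v g))
    rw [← (ihg hi.2.2).2 rfl] at h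
    rw [oeval]
    exact_mod_cast (by omega : 1 ≤ Psi _)

theorem Cls.one_le {h : OTerm OVar} {i : ℕ} (hi : Cls h i) (v : GVal) : 1 ≤ oeval v h :=
  (hi.eval v).1

theorem Cls.nat {h : OTerm OVar} (hi : Cls h 0) (v : GVal) : oeval v h = (nm (oeval v h) : NO) :=
  (hi.eval v).2 rfl

theorem oeval_update_of_free {X : TVar} {h : OTerm OVar} (hX : h.occurs X = false) (v : GVal)
    (b : GVec X.1.lv) : oeval (Function.update v X b) h = oeval v h := by
  induction h with
  | var x =>
    rw [oeval, oeval, Function.update_of_ne]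
    simpa [occurs] using hX
  | zero => rfl
  | one => rfl
  | omega => rfl
  | add f g ihf ihg | exp2 f g ihf ihg | psi f g ihf ihg =>
    simp only [occurs, Bool.or_eq_false_iff] at hX
    simp only [oeval, ihf hX.1, ihg hX.2]

theorem oeval_substOne (X : TVar) (h : OTerm OVar) (v : GVal) :
    oeval v (h.substOne X) = oeval (Function.update v X (oneGVec X.1.lv)) h := by
  induction h with
  | var x =>
    simp only [substOne, OTerm.bind]
    split_ifs with e
    · obtain ⟨Y, i⟩ := x
      obtain rfl : Y = X := e
      simp only [oeval, Function.update_self, oneGVec, oneVec]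
      rw [if_pos (by have := i.2; omega)]
    · rw [oeval, oeval, Function.update_of_ne e]
  | zero => rfl
  | one => rfl
  | omega => rfl
  | add f g ihf ihg | exp2 f g ihf ihg | psi f g ihf ihg =>
    simp only [substOne, OTerm.bind, oeval] at *
    rw [ihf, ihg]

theorem Cls.substOne {X : TVar} {h : OTerm OVar} {i : ℕ} (hi : Cls h i) :
    Cls (h.substOne X) i := by
  induction h generalizing i with
  | var x =>
    simp only [OTerm.substOne, OTerm.bind]
    split_ifs
    · trivial
    · exact hi
  | zero => exact hi
  | one => exact hi
  | omega => exact hi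
  | add f g ihf ihg => exact ⟨ihf hi.1, ihg hi.2⟩
  | exp2 f g ihf ihg => exact ⟨hi.1, ihf hi.2.1, ihg hi.2.2⟩
  | psi f g ihf ihg => exact ⟨hi.1, ihf hi.2.1, ihg hi.2.2⟩

/-- Below a component `i ≥ 1` no `ψ` can occur, and passing to an exponent only raises the index;
hence only variables with index at least `i` appear. -/
theorem Cls.free {X : TVar} {h : OTerm OVar} {i : ℕ} (hi : Cls h i) (hX : X.1.lv < i) :
    h.occurs X = false := by
  induction h generalizing i with
  | var x =>
    obtain ⟨Y, k⟩ := x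
    simp only [occurs, decide_eq_false_iff_not]
    rintro rfl
    have := k.2
    change k.1 = i at hi
    omega
  | zero => rfl
  | one => rfl
  | omega => rfl
  | add f g ihf ihg =>
    rw [occurs, ihf hi.1 hX, ihg hi.2 hX]; rfl
  | exp2 f g ihf ihg =>
    rw [occurs, ihf hi.2.1 (by omega), ihg hi.2.2 hX]; rfl
  | psi f g ihf ihg =>
    have := hi.1
    omega

theorem deltaPart_of_free {X : TVar} {h : OTerm OVar} (hX : h.occurs X = false) (i j : ℕ) :
    deltaPart X h i j = if i = j then .add h .one else .one := by
  cases h <;> simp_all [deltaPart]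

theorem sz_of_free {X : TVar} {h : OTerm OVar} (hX : h.occurs X = false) : sz X h = 1 := by
  cases h <;> simp_all [sz]

theorem one_le_sz (X : TVar) (h : OTerm OVar) : 1 ≤ sz X h := by
  cases h <;> simp only [sz] <;> (try split_ifs) <;> omega

theorem Cls.nmul {h : OTerm OVar} {i k : ℕ} (hi : Cls h i) (hk : 1 ≤ k) : Cls (nmul k h) i := by
  induction k, hk using Nat.le_induction with
  | base => exact hi
  | succ k hk ih =>
    obtain ⟨k, rfl⟩ := Nat.exists_eq_add_of_le' hk
    exact ⟨ih, hi⟩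

theorem oeval_nmul (v : GVal) (h : OTerm OVar) (k : ℕ) : oeval v (nmul k h) = k * oeval v h := by
  induction k with
  | zero => simp [nmul, oeval]
  | succ k ih =>
    rcases k with _ | k
    · simp [nmul]
    · rw [nmul, oeval, ih]
      push_cast
      ring

theorem Cls.deltaPart {X : TVar} {h : OTerm OVar} {i j : ℕ} (hi : Cls h i)
    (hij : 1 ≤ j ∨ i = 0) : Cls (deltaPart X h i j) j := by
  have key : ∀ {h : OTerm OVar} {i : ℕ}, Cls h i → (h.occurs X = true → Cls (OTerm.deltaPart X h i j) j) →
      Cls (OTerm.deltaPart X h i j) j := by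
    intro h i hi hX
    cases e : h.occurs X
    · rw [deltaPart_of_free e]
      split_ifs with e
      · exact ⟨e ▸ hi, trivial⟩
      · trivial
    · exact hX e
  refine key hi fun hX => ?_
  induction h generalizing i j with
  | var x => simp only [OTerm.deltaPart, if_pos hX]; trivial
  | zero => simp [occurs] at hX
  | one => simp [occurs] at hX
  | omega => simp [occurs] at hX
  | add f g ihf ihg =>
    simp only [OTerm.deltaPart, if_pos hX]
    exact ⟨⟨key hi.1 (ihf hi.1 hij key), key hi.2 (ihg hi.2 hij key)⟩, trivial⟩
  | exp2 f g ihf ihg =>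
    simp only [OTerm.deltaPart, if_pos hX]
    have hj : 1 ≤ j := by have := hi.1; omega
    exact ⟨⟨Cls.nmul (key hi.2.1 (ihf hi.2.1 (.inl hj) key)) (by omega),
      key hi.2.2 (ihg hi.2.2 (.inl hj) key)⟩, trivial⟩
  | psi f g ihf ihg =>
    simp only [OTerm.deltaPart, if_pos hX]
    split_ifs with e
    · subst e
      exact ⟨rfl, hi.2.1.substOne, key hi.2.2 (ihg hi.2.2 (.inr rfl) key)⟩
    · exact ⟨key hi.2.1 (ihf hi.2.1 (.inl (by omega)) key),
        key hi.2.2 (ihg hi.2.2 (.inr rfl) key)⟩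

end GodelT

namespace GodelT
open NO OTerm

/-! ### The main lemma on the operator `δ` -/

/-- The values of the components `(δ^x_i h)_j`. -/
noncomputable def dval (v : GVal) (X : TVar) (i : ℕ) (h : OTerm OVar) : Vec := fun j =>
  oeval v (deltaPart X h i j)

theorem dval_of_free {X : TVar} {h : OTerm OVar} (hX : h.occurs X = false) (v : GVal) (i j : ℕ) :
    dval v X i h j = if i = j then oeval v h + 1 else 1 := by
  rw [dval, deltaPart_of_free hX]
  split_ifs <;> rfl

theorem dval_add {X : TVar} {f g : OTerm OVar} (hX : (add f g).occurs X = true) (v : GVal)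
    (i j : ℕ) : dval v X i (add f g) j = dval v X i f j + dval v X i g j + 1 := by
  simp only [dval, deltaPart, if_pos hX, oeval]

theorem dval_exp2 {X : TVar} {f g : OTerm OVar} (hX : (exp2 f g).occurs X = true) (v : GVal)
    (i j : ℕ) :
    dval v X i (exp2 f g) j = 2 * dval v X (i + 1) f j + dval v X i g j + 1 := by
  simp only [dval, deltaPart, if_pos hX, oeval, oeval_nmul, Nat.cast_ofNat]

theorem dval_psi {X : TVar} {f g : OTerm OVar} (hX : (OTerm.psi f g).occurs X = true) (v : GVal)
    (i j : ℕ) : dval v X i (OTerm.psi f g) j = if j = 0 then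
      ((Psi (om * oeval (Function.update v X (oneGVec X.1.lv)) f + dval v X 0 g 0) : ℕ) : NO)
      else dval v X 1 f j + dval v X 0 g j := by
  simp only [dval, deltaPart, if_pos hX]
  split_ifs
  · rw [oeval, oeval_substOne]
  · rfl

theorem dval_var {X : TVar} {x : OVar} (hX : (OTerm.var x).occurs X = true) (v : GVal)
    (i j : ℕ) : dval v X i (.var x) j = 1 := by
  simp only [dval, deltaPart, if_pos hX, oeval]

theorem Cls.one_le_dval {X : TVar} {h : OTerm OVar} {i : ℕ} (hi : Cls h i) {j : ℕ}
    (hij : 1 ≤ j ∨ i = 0) (v : GVal) : 1 ≤ dval v X i h j :=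
  (hi.deltaPart hij).one_le v

theorem bpos_mono' {l : ℕ} {f f' g g' : Vec} (hf : ∀ i, 1 ≤ i → i ≤ l + 1 → f i ≤ f' i)
    (hg : ∀ i, 1 ≤ i → i ≤ l → g i ≤ g' i) :
    ∀ i, 1 ≤ i → i ≤ l + 1 → bpos l f g i ≤ bpos l f' g' i := by
  refine down_induction l (fun i h h1 h2 => ?_) fun i h ih h1 h2 => ?_
  · rw [bpos_of_lt _ _ h, bpos_of_lt _ _ h]; exact hf i h1 h2
  · rw [bpos_of_le _ _ h, bpos_of_le _ _ h]
    have := ih (by omega) (by omega)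
    have := hf i h1 h2
    have := hg i h1 h
    gcongr

theorem add_le_mul_of_two_le {x y : NO} (hx : 2 ≤ x) (hy : 2 ≤ y) : x + y ≤ x * y := by
  wlog h : x ≤ y generalizing x y
  · rw [add_comm, mul_comm]
    exact this hy hx (le_of_not_ge h)
  calc x + y ≤ y + y := by gcongr
    _ = 2 * y := (two_mul y).symm
    _ ≤ x * y := by gcongr

/-- A version of `bpos_add_lt` without slack: as `d` and `e` are positive, both powers are at least
`2`, and then `x + y ≤ x * y`. It serves the clause of `δ` for `ψ`, which is a plain sum in positive
components. -/
theorem bpos_add_le {l : ℕ} {d e f b : Vec} (hd : ∀ i, 1 ≤ i → i ≤ l + 1 → 1 ≤ d i)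
    (he : ∀ i, 1 ≤ i → i ≤ l + 1 → 1 ≤ e i) (h : ∀ i, 1 ≤ i → i ≤ l + 1 → d i + e i ≤ f i) :
    ∀ i, 1 ≤ i → i ≤ l + 1 → bpos l d b i + bpos l e b i ≤ bpos l f b i := by
  refine down_induction l (fun i h' h1 h2 => ?_) fun i h' ih h1 h2 => ?_
  · simp only [bpos_of_lt _ _ h']
    exact h i h1 h2
  · simp only [bpos_of_le _ _ h']
    have ih := pw_le_pw (ih (by omega) (by omega))
    rw [pw_add] at ih
    have hx : 2 ≤ pw (bpos l d b (i + 1)) := by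
      rw [← pw_one]
      exact pw_le_pw ((hd (i + 1) (by omega) (by omega)).trans (le_bpos _ _ _))
    have hy : 2 ≤ pw (bpos l e b (i + 1)) := by
      rw [← pw_one]
      exact pw_le_pw ((he (i + 1) (by omega) (by omega)).trans (le_bpos _ _ _))
    have hx' := one_le_pw (bpos l d b (i + 1))
    have hy' := one_le_pw (bpos l e b (i + 1))
    generalize pw (bpos l d b (i + 1)) = x at *
    generalize pw (bpos l e b (i + 1)) = y at *
    have hxy : x ≤ x * y := le_mul_of_one_le_right (zero_le _) hy'
    have hyx : y ≤ x * y := le_mul_of_one_le_left (zero_le _) hx'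
    calc x * (d i + b i) + y * (e i + b i)
        = x * d i + y * e i + (x + y) * b i := by ring
      _ ≤ (x * y) * d i + (x * y) * e i + (x * y) * b i := by
          gcongr
          exact add_le_mul_of_two_le hx hy
      _ = x * y * (d i + e i + b i) := by ring
      _ ≤ _ := by
          gcongr
          exact h i h1 h2

/-- The main property of `δ` in positive components: `□ b` recovers more than the value of `h` at
`b`. For `2^f · g`, induction at `i + 1` bounds the exponent `f`; since `δ` of the term adds the
contributions of `f` and `g` at `i + 1`, the new exponent covers `f` and the exponent already used
for `g`. -/
theorem oeval_update_lt_bpos {X : TVar} {h : OTerm OVar} {i : ℕ} (hi : Cls h i) (h1 : 1 ≤ i)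
    (h2 : i ≤ X.1.lv + 1) (v : GVal) (b : GVec X.1.lv) :
    oeval (Function.update v X b) h < bpos X.1.lv (dval v X i h) b.1 i := by
  have free : ∀ {h : OTerm OVar} {i : ℕ}, h.occurs X = false →
      oeval (Function.update v X b) h < bpos X.1.lv (dval v X i h) b.1 i := by
    intro h i hX
    rw [oeval_update_of_free hX]
    refine lt_of_lt_of_le ?_ (le_bpos _ _ _)
    rw [dval_of_free hX, if_pos rfl]
    exact lt_add_of_pos_right _ zero_lt_one
  induction h generalizing i with
  | var x =>
    cases hX : (OTerm.var x).occurs X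
    · exact free hX
    · obtain ⟨Y, k⟩ := x
      obtain rfl : Y = X := by simpa [occurs] using hX
      obtain rfl : k.1 = i := hi
      have hk : k.1 ≤ Y.1.lv := by have := k.2; omega
      rw [bpos_of_le _ _ hk, dval_var hX, oeval, Function.update_self]
      calc b.1 k < 1 + b.1 k := lt_add_of_pos_left _ zero_lt_one
        _ = 1 * (1 + b.1 k) := (one_mul _).symm
        _ ≤ _ := by gcongr; exact one_le_pw _
  | zero => exact free rfl
  | one => exact free rfl
  | omega => exact free rfl
  | add f g ihf ihg =>
    cases hX : (OTerm.add f g).occurs X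
    · exact free hX
    · have := bpos_add_lt (b := b.1) (fun j _ _ => (dval_add hX v i j).ge) i h1 h2
      refine lt_of_lt_of_le ?_ ((le_add_of_nonneg_right zero_le_one).trans this)
      exact add_lt_add (ihf hi.1 h1 h2) (ihg hi.2 h1 h2)
  | exp2 f g ihf ihg =>
    cases hX : (OTerm.exp2 f g).occurs X
    · exact free hX
    -- Above the level of `X` the term would be `x`-free.
    · have hi' : i ≤ X.1.lv := by
        by_contra h'
        rw [hi.free (by omega)] at hX
        exact absurd hX (by simp)
      have e := bpos_add_lt (l := X.1.lv) (b := b.1) (d := dval v X (i + 1) f)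
        (e := dval v X i g) (f := dval v X i (exp2 f g)) (fun j _ _ => by
          rw [dval_exp2 hX, two_mul]
          gcongr
          exact le_add_of_nonneg_right (zero_le _)) (i + 1) (by omega) (by omega)
      have e := pw_le_pw ((le_add_of_nonneg_right zero_le_one).trans e)
      rw [pw_add] at e
      have hf := (pw_lt_pw (ihf hi.2.1 (by omega) (by omega))).le
      have hg := ihg hi.2.2 h1 h2
      rw [bpos_of_le _ _ hi'] at hg ⊢
      rw [oeval]
      calc pw (oeval (Function.update v X b) f) * oeval (Function.update v X b) g
          < pw (oeval (Function.update v X b) f) *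
            (pw (bpos X.1.lv (dval v X i g) b.1 (i + 1)) * (dval v X i g i + b.1 i)) :=
            mul_lt_mul_of_pos_left hg (pw_pos _)
        _ ≤ pw (bpos X.1.lv (dval v X (i + 1) f) b.1 (i + 1)) *
            (pw (bpos X.1.lv (dval v X i g) b.1 (i + 1)) * (dval v X i g i + b.1 i)) := by
            gcongr
        _ ≤ _ := by
            rw [← mul_assoc]
            gcongr
            rw [dval_exp2 hX]
            calc dval v X i g i ≤ dval v X i g i + (2 * dval v X (i + 1) f i + 1) :=
                  le_add_of_nonneg_right (zero_le _)
              _ = _ := by ring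
  | psi f g _ _ =>
    have := hi.1
    omega

/-- In `2^f · g` one factor `2` comes from the coefficient of `δ f` and another from `nm_le_pw`. The
weight `2` of `f` in `sz` pays for the first, and the power of two, which doubles as `i` decreases
by one, for the second. -/
theorem nm_dval_le {X : TVar} {h : OTerm OVar} {i : ℕ} (hi : Cls h i) (h1 : 1 ≤ i)
    (h2 : i ≤ X.1.lv + 1) (v : GVal) (j : ℕ) :
    nm (dval v X i h j) ≤ 2 ^ (X.1.lv + 2 - i) *
      (sz X h * nm (oeval (Function.update v X (oneGVec X.1.lv)) h)) := by
  have hp : 2 ≤ 2 ^ (X.1.lv + 2 - i) := by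
    calc 2 = 2 ^ 1 := rfl
      _ ≤ _ := Nat.pow_le_pow_right (by norm_num) (by omega)
  have free : ∀ {h : OTerm OVar} {i : ℕ}, Cls h i → 2 ≤ 2 ^ (X.1.lv + 2 - i) →
      h.occurs X = false → nm (dval v X i h j) ≤ 2 ^ (X.1.lv + 2 - i) *
      (sz X h * nm (oeval (Function.update v X (oneGVec X.1.lv)) h)) := by
    intro h i hi hp hX
    rw [oeval_update_of_free hX, dval_of_free hX, sz_of_free hX]
    have := nm_pos (hi.one_le v)
    have : nm (if i = j then oeval v h + 1 else 1) ≤ nm (oeval v h) + 1 := by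
      split_ifs <;> simp
    nlinarith
  induction h generalizing i with
  | var x =>
    cases hX : (OTerm.var x).occurs X
    · exact free hi hp hX
    · rw [dval_var hX]
      have := nm_pos (hi.one_le (Function.update v X (oneGVec X.1.lv)))
      simp only [nm_one, sz, one_mul]
      nlinarith
  | zero => exact hi.elim
  | one => exact free hi hp rfl
  | omega => exact free hi hp rfl
  | add f g ihf ihg =>
    cases hX : (OTerm.add f g).occurs X
    · exact free hi hp hX
    · rw [dval_add hX, sz, if_pos hX, oeval]
      simp only [nm_add, nm_one]
      have hf := ihf hi.1 h1 h2 hp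
      have hg := ihg hi.2 h1 h2 hp
      have := nm_pos (hi.1.one_le (Function.update v X (oneGVec X.1.lv)))
      generalize 2 ^ (X.1.lv + 2 - i) = p at *
      generalize nm (oeval (Function.update v X (oneGVec X.1.lv)) f) = x at *
      generalize nm (oeval (Function.update v X (oneGVec X.1.lv)) g) = y at *
      generalize sz X f = s at *
      generalize sz X g = t at *
      calc _ ≤ p * (s * x) + p * (t * y) + 1 := by omega
        _ ≤ p * (s * x) + p * (t * y) + (p * (s * y) + p * (t * x) + p * (x + y)) := by
            nlinarith [Nat.zero_le (p * (s * y)), Nat.zero_le (p * (t * x)), Nat.zero_le (p * y)]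
        _ = _ := by ring
  | exp2 f g ihf ihg =>
    cases hX : (OTerm.exp2 f g).occurs X
    · exact free hi hp hX
    · have hi' : i ≤ X.1.lv := by
        by_contra h'
        rw [hi.free (by omega)] at hX
        exact absurd hX (by simp)
      rw [dval_exp2 hX, sz, if_pos hX, oeval, two_mul]
      simp only [nm_add, nm_one]
      have hf := ihf hi.2.1 (by omega) (by omega) (by
        calc 2 = 2 ^ 1 := rfl
          _ ≤ _ := Nat.pow_le_pow_right (by norm_num) (by omega))
      have hg := ihg hi.2.2 h1 h2 hp
      have h₁ := nm_pos (hi.one_le (Function.update v X (oneGVec X.1.lv)))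
      have h₂ : nm (oeval (Function.update v X (oneGVec X.1.lv)) f) ≤
          2 * nm (oeval (Function.update v X (oneGVec X.1.lv)) (exp2 f g)) := by
        refine (nm_le_pw _).trans ?_
        rw [oeval]
        gcongr
        exact nm_le_mul_left (one_le_iff_pos.1 (hi.2.2.one_le _))
      have h₃ : nm (oeval (Function.update v X (oneGVec X.1.lv)) g) ≤
          nm (oeval (Function.update v X (oneGVec X.1.lv)) (exp2 f g)) := by
        rw [oeval]
        exact nm_le_mul_right (pw_pos _)
      rw [← oeval]
      rw [show X.1.lv + 2 - i = (X.1.lv + 2 - (i + 1)) + 1 by omega, pow_succ] at hp hg ⊢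
      generalize 2 ^ (X.1.lv + 2 - (i + 1)) = p at *
      generalize nm (oeval (Function.update v X (oneGVec X.1.lv)) f) = x at *
      generalize nm (oeval (Function.update v X (oneGVec X.1.lv)) g) = y at *
      generalize nm (oeval (Function.update v X (oneGVec X.1.lv)) (exp2 f g)) = z at *
      generalize sz X f = s at *
      generalize sz X g = t at *
      have e₁ : p * (s * x) ≤ p * (s * (2 * z)) := by gcongr
      have e₂ : p * 2 * (t * y) ≤ p * 2 * (t * z) := by gcongr
      have e₃ : 1 ≤ p * 2 * z := by nlinarith
      calc _ ≤ p * (s * (2 * z)) + p * (s * (2 * z)) + p * 2 * (t * z) + p * 2 * z := by omega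
        _ = _ := by ring
  | psi f g _ _ =>
    have := hi.1
    omega

/-- Each operation on terms containing `x` costs one `expG`. In `2^f · g` the norm of `f` may be
twice that of the whole; one extra iteration covers this, and the double weight of `f` in `sz`
provides it. -/
theorem nm_oeval_update_le {X : TVar} {h : OTerm OVar} {i : ℕ} (hi : Cls h i) (h1 : 1 ≤ i)
    (v : GVal) (b : GVec X.1.lv) :
    nm (oeval (Function.update v X b) h) ≤ expG^[sz X h]
      (nm (oeval (Function.update v X (oneGVec X.1.lv)) h) + nm (b.1 0)) := by
  have free : ∀ {h : OTerm OVar}, h.occurs X = false →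
      nm (oeval (Function.update v X b) h) ≤ expG^[sz X h]
      (nm (oeval (Function.update v X (oneGVec X.1.lv)) h) + nm (b.1 0)) := by
    intro h hX
    rw [oeval_update_of_free hX, oeval_update_of_free hX]
    exact (Nat.le_add_right _ _).trans (le_expG_iterate _ _)
  induction h generalizing i with
  | var x =>
    cases hX : (OTerm.var x).occurs X
    · exact free hX
    · obtain ⟨Y, k⟩ := x
      obtain rfl : Y = X := by simpa [occurs] using hX
      rw [oeval, Function.update_self]
      exact (b.2.norm k).trans ((Nat.le_add_left _ _).trans (le_expG_iterate _ _))
  | zero => exact free rfl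
  | one => exact free rfl
  | omega => exact free rfl
  | add f g ihf ihg =>
    cases hX : (OTerm.add f g).occurs X
    · exact free hX
    · rw [oeval, oeval, sz, if_pos hX, nm_add, nm_add, Function.iterate_succ_apply']
      have hf := ihf hi.1 h1
      have hg := ihg hi.2 h1
      generalize nm (oeval (Function.update v X (oneGVec X.1.lv)) f) = x at *
      generalize nm (oeval (Function.update v X (oneGVec X.1.lv)) g) = y at *
      have h₁ := (expG_iterate_mono (sz X f) (by omega : x + nm (b.1 0) ≤ x + y + nm (b.1 0))).trans
        (expG_iterate_le_iterate (by omega : sz X f ≤ sz X f + sz X g) _)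
      have h₂ := (expG_iterate_mono (sz X g) (by omega : y + nm (b.1 0) ≤ x + y + nm (b.1 0))).trans
        (expG_iterate_le_iterate (by omega : sz X g ≤ sz X f + sz X g) _)
      have h₃ := two_mul_lt_expG (expG^[sz X f + sz X g] (x + y + nm (b.1 0)))
      omega
  | exp2 f g ihf ihg =>
    cases hX : (OTerm.exp2 f g).occurs X
    · exact free hX
    · have hf := ihf hi.2.1 (by omega)
      have hg := ihg hi.2.2 h1
      have h₂ : nm (oeval (Function.update v X (oneGVec X.1.lv)) f) ≤
          2 * nm (oeval (Function.update v X (oneGVec X.1.lv)) (exp2 f g)) := by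
        refine (nm_le_pw _).trans ?_
        rw [oeval]
        gcongr
        exact nm_le_mul_left (one_le_iff_pos.1 (hi.2.2.one_le _))
      have h₃ : nm (oeval (Function.update v X (oneGVec X.1.lv)) g) ≤
          nm (oeval (Function.update v X (oneGVec X.1.lv)) (exp2 f g)) := by
        rw [oeval]
        exact nm_le_mul_right (pw_pos _)
      rw [sz, if_pos hX, Function.iterate_succ_apply']
      generalize nm (oeval (Function.update v X (oneGVec X.1.lv)) (exp2 f g)) = z at *
      generalize nm (oeval (Function.update v X (oneGVec X.1.lv)) f) = x at *
      generalize nm (oeval (Function.update v X (oneGVec X.1.lv)) g) = y at *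
      rw [oeval]
      refine (nm_mul_le _ _).trans ((Nat.mul_le_mul_right _ (nm_pw_le _)).trans ?_)
      refine two_pow_mul_le_expG (hf.trans ?_) (hg.trans ?_)
      · have hs := one_le_sz X f
        calc expG^[sz X f] (x + nm (b.1 0)) ≤ expG^[sz X f] (expG (z + nm (b.1 0))) := by
              refine expG_iterate_mono _ ?_
              have := two_mul_lt_expG (z + nm (b.1 0))
              omega
          _ = expG^[sz X f + 1] (z + nm (b.1 0)) := (Function.iterate_succ_apply _ _ _).symm
          _ ≤ _ := expG_iterate_le_iterate (by omega) _
      · exact (expG_iterate_mono _ (by omega)).trans (expG_iterate_le_iterate (by omega) _)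
  | psi f g _ _ =>
    have := hi.1
    omega

end GodelT

namespace GodelT
open NO OTerm

/-! ### Component `0` of `δ^x`: norms and domination. -/

theorem Cls.dval_nat {X : TVar} {h : OTerm OVar} (hi : Cls h 0) (v : GVal) :
    dval v X 0 h 0 = (nm (dval v X 0 h 0) : NO) :=
  (hi.deltaPart (.inr rfl)).nat v

theorem nm_oeval_one_le_dval {X : TVar} {h : OTerm OVar} (hi : Cls h 0) (v : GVal) :
    nm (oeval (Function.update v X (oneGVec X.1.lv)) h) ≤ nm (dval v X 0 h 0) := by
  have free : ∀ {h : OTerm OVar}, h.occurs X = false →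
      nm (oeval (Function.update v X (oneGVec X.1.lv)) h) ≤ nm (dval v X 0 h 0) := by
    intro h hX
    rw [oeval_update_of_free hX, dval_of_free hX, if_pos rfl, nm_add]
    omega
  induction h with
  | var x =>
    cases hX : (OTerm.var x).occurs X
    · exact free hX
    · obtain ⟨Y, k⟩ := x
      obtain rfl : Y = X := by simpa [occurs] using hX
      rw [dval_var hX, oeval, Function.update_self]
      simp only [oneGVec, oneVec]
      split_ifs <;> simp
  | zero => exact free rfl
  | one => exact free rfl
  | omega => exact free rfl
  | add f g ihf ihg =>
    cases hX : (OTerm.add f g).occurs X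
    · exact free hX
    · rw [dval_add hX, oeval]
      simp only [nm_add]
      have := ihf hi.1
      have := ihg hi.2
      omega
  | exp2 f g _ _ =>
    have := hi.1
    omega
  | psi f g _ ihg =>
    cases hX : (OTerm.psi f g).occurs X
    · exact free hX
    · rw [dval_psi hX, if_pos rfl, oeval, nm_natCast, nm_natCast, hi.2.2.nat, hi.2.2.dval_nat]
      have := ihg hi.2.2
      refine Psi_le_Psi (by gcongr) ?_
      simp only [nm_add, nm_natCast]
      exact le_Phi (by omega)

theorem nm_le_dval_psi {X : TVar} {f g : OTerm OVar} (hi : Cls (.psi f g) 0)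
    (hX : (OTerm.psi f g).occurs X = true) (v : GVal) :
    nm (oeval (Function.update v X (oneGVec X.1.lv)) f) + nm (dval v X 0 g 0) ≤
      nm (dval v X 0 (.psi f g) 0) := by
  rw [dval_psi hX, if_pos rfl, nm_natCast, hi.2.2.dval_nat, nm_natCast]
  refine le_trans (le_Phi ?_) (Phi_lt_Psi (hi.2.1.one_le _) _).le
  omega

/-- This is the reason for the factor `2^n · sz` in component `0` of `δ`: with it, component `0`
bounds the norms of the others. -/
theorem nm_dval_zero_le {X : TVar} {h : OTerm OVar} (hi : Cls h 0) (v : GVal) (j : ℕ) :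
    nm (dval v X 0 h j) ≤ 2 ^ (X.1.lv + 1) * sz X h * nm (dval v X 0 h 0) := by
  have hS : ∀ h : OTerm OVar, 1 ≤ 2 ^ (X.1.lv + 1) * sz X h := fun h =>
    Nat.mul_pos (Nat.pow_pos (by norm_num)) (one_le_sz X h)
  rcases eq_or_ne j 0 with rfl | hj
  · exact Nat.le_mul_of_pos_left _ (hS h)
  have free : ∀ {h : OTerm OVar}, Cls h 0 → h.occurs X = false →
      nm (dval v X 0 h j) ≤ 2 ^ (X.1.lv + 1) * sz X h * nm (dval v X 0 h 0) := by
    intro h hi hX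
    rw [dval_of_free hX, if_neg (Ne.symm hj), nm_one]
    exact Nat.mul_pos (hS h) (nm_pos (hi.one_le_dval (.inr rfl) v))
  induction h with
  | var x =>
    cases hX : (OTerm.var x).occurs X
    · exact free hi hX
    · rw [dval_var hX, dval_var hX, nm_one, mul_one]
      exact hS _
  | zero => exact hi.elim
  | one => exact free hi rfl
  | omega => exact free hi rfl
  | add f g ihf ihg =>
    cases hX : (OTerm.add f g).occurs X
    · exact free hi hX
    · rw [dval_add hX, dval_add hX, sz, if_pos hX]
      simp only [nm_add, nm_one]
      have hf := ihf hi.1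
      have hg := ihg hi.2
      have hp : 1 ≤ 2 ^ (X.1.lv + 1) := Nat.one_le_two_pow
      generalize 2 ^ (X.1.lv + 1) = p at *
      generalize nm (dval v X 0 f 0) = x at *
      generalize nm (dval v X 0 g 0) = y at *
      generalize sz X f = s at *
      generalize sz X g = t at *
      calc _ ≤ p * s * x + p * t * y + p := by omega
        _ ≤ p * s * x + p * t * y + p + (p * s * (y + 1) + p * t * (x + 1) + p * (x + y)) :=
            Nat.le_add_right _ _
        _ = _ := by ring
  | exp2 f g _ _ =>
    have := hi.1
    omega
  | psi f g _ ihg =>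
    cases hX : (OTerm.psi f g).occurs X
    · exact free hi hX
    · have h₁ := nm_le_dval_psi hi hX v
      have hf := nm_dval_le (X := X) hi.2.1 le_rfl (by omega) v j
      have hg := ihg hi.2.2
      rw [show X.1.lv + 2 - 1 = X.1.lv + 1 by omega] at hf
      rw [dval_psi hX v 0 j, if_neg hj, sz, if_pos hX, nm_add]
      generalize 2 ^ (X.1.lv + 1) = p at *
      generalize nm (dval v X 0 (OTerm.psi f g) 0) = z at *
      generalize nm (dval v X 0 g 0) = y at *
      generalize nm (oeval (Function.update v X (oneGVec X.1.lv)) f) = x at *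
      generalize sz X f = s at *
      generalize sz X g = t at *
      have e₁ : p * (s * x) ≤ p * (s * z) := by gcongr; omega
      have e₂ : p * t * y ≤ p * t * z := by gcongr; omega
      calc _ ≤ p * (s * z) + p * t * z + p * z := by omega
        _ = _ := by ring

/-- The vector `δ^x_0 h` with its component `0` multiplied by the norm controlling factor. -/
noncomputable def dbound (v : GVal) (X : TVar) (h : OTerm OVar) : Vec := fun j =>
  if j = 0 then ((2 ^ (X.1.lv + 1) * sz X h : ℕ) : NO) * dval v X 0 h 0
  else if j ≤ X.1.lv + 1 then dval v X 0 h j else 0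

theorem dbound_zero (v : GVal) (X : TVar) (h : OTerm OVar) :
    dbound v X h 0 = ((2 ^ (X.1.lv + 1) * sz X h : ℕ) : NO) * dval v X 0 h 0 := if_pos rfl

theorem nm_dbound_zero (v : GVal) (X : TVar) {h : OTerm OVar} (hi : Cls h 0) :
    nm (dbound v X h 0) = 2 ^ (X.1.lv + 1) * sz X h * nm (dval v X 0 h 0) := by
  rw [dbound_zero, hi.dval_nat, ← Nat.cast_mul, nm_natCast, nm_natCast]

theorem dbound_of_le (v : GVal) {X : TVar} (h : OTerm OVar) {j : ℕ} (h1 : 1 ≤ j)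
    (h2 : j ≤ X.1.lv + 1) : dbound v X h j = dval v X 0 h j := by
  rw [dbound, if_neg (by omega), if_pos h2]

theorem good_dbound (v : GVal) (X : TVar) {h : OTerm OVar} (hi : Cls h 0) :
    Good (X.1.lv + 1) (dbound v X h) := by
  have hS : 1 ≤ 2 ^ (X.1.lv + 1) * sz X h :=
    Nat.mul_pos (Nat.pow_pos (by norm_num)) (one_le_sz X h)
  refine ⟨?_, fun i h2 => ?_, fun i => ?_, fun i h2 => ?_⟩
  · have := hi.dval_nat (X := X) v
    rw [nm_dbound_zero v X hi, dbound_zero, Nat.cast_mul _ (nm _), ← this]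
  · rcases Nat.eq_zero_or_pos i with rfl | h1
    · rw [dbound_zero]
      exact one_le_mul (by exact_mod_cast hS) (hi.one_le_dval (.inr rfl) v)
    · rw [dbound_of_le v h h1 h2]
      exact hi.one_le_dval (.inr rfl) v
  · rw [nm_dbound_zero v X hi]
    rcases Nat.eq_zero_or_pos i with rfl | h1
    · rw [nm_dbound_zero v X hi]
    · rcases le_or_gt i (X.1.lv + 1) with h2 | h2
      · rw [dbound_of_le v h h1 h2]
        exact nm_dval_zero_le hi v i
      · rw [dbound, if_neg (by omega), if_neg (by omega), nm_zero]
        exact Nat.zero_le _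
  · rw [dbound, if_neg (by omega), if_neg (by omega)]

theorem le_vbox_zero {l m : ℕ} {f g : Vec} (hf : Good m f) (hg : Good l g) :
    nm (f 0) + nm (g 0) + l ≤ nm (vbox l f g 0) := by
  rw [vbox_zero l hf.nat hg.nat, nm_natCast]
  exact (Nat.le_add_left _ _).trans (Psi_add_natCast_le _ _)

/-- In the case `ψ(ω·f + g)` let `F`, `G` be the values of `f`, `g` at `b`. Induction gives `G ≤
ψ(ω·P + s₁)`, so the value is at most `ψ(ω·(F + P) + s₁)`, where `P` comes from `δ g`. The vector
`δ` of the whole term yields `Q > F + P`, because it adds `δ f` and `δ g` in positive components. -/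
theorem oeval_update_le_vbox {X : TVar} {h : OTerm OVar} (hi : Cls h 0) (v : GVal)
    (b : GVec X.1.lv) :
    nm (oeval (Function.update v X b) h) ≤ nm (vbox X.1.lv (dbound v X h) b.1 0) := by
  have free : ∀ {h : OTerm OVar}, Cls h 0 → h.occurs X = false →
      nm (oeval (Function.update v X b) h) ≤ nm (vbox X.1.lv (dbound v X h) b.1 0) := by
    intro h hi hX
    have h₁ := le_vbox_zero (good_dbound v X hi) b.2
    have h₂ := nm_dval_zero_le (X := X) hi v 0
    rw [nm_dbound_zero v X hi] at h₁
    rw [oeval_update_of_free hX]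
    have h₃ : nm (dval v X 0 h 0) = nm (oeval v h) + 1 := by
      rw [dval_of_free hX, if_pos rfl, nm_add, nm_one]
    omega
  induction h with
  | var x =>
    cases hX : (OTerm.var x).occurs X
    · exact free hi hX
    · have h₁ := le_vbox_zero (good_dbound v X hi) b.2
      obtain ⟨Y, k⟩ := x
      obtain rfl : Y = X := by simpa [occurs] using hX
      rw [oeval, Function.update_self]
      exact (b.2.norm k).trans (by omega)
  | zero => exact hi.elim
  | one => exact free hi rfl
  | omega => exact free hi rfl
  | add f g ihf ihg =>
    cases hX : (OTerm.add f g).occurs X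
    · exact free hi hX
    · have gf := good_dbound v X hi.1
      have gg := good_dbound v X hi.2
      have gh := good_dbound v X hi
      have := vbox_add_lt b.2 gf.nat gg.nat gh.nat (fun i _ => gf.norm i) (fun i _ => gg.norm i)
        (fun i h2 => ?_)
      · rw [oeval, nm_add]
        exact (add_le_add (ihf hi.1) (ihg hi.2)).trans this.le
      · rcases Nat.eq_zero_or_pos i with rfl | h1
        · rw [gf.nat, gg.nat, gh.nat, nm_dbound_zero v X hi.1, nm_dbound_zero v X hi.2,
            nm_dbound_zero v X hi, dval_add hX, sz, if_pos hX]
          simp only [nm_add, nm_one]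
          have hp : 1 ≤ 2 ^ (X.1.lv + 1) := Nat.one_le_two_pow
          generalize 2 ^ (X.1.lv + 1) = p at *
          generalize nm (dval v X 0 f 0) = x at *
          generalize nm (dval v X 0 g 0) = y at *
          generalize sz X f = s at *
          generalize sz X g = t at *
          norm_cast
          calc _ ≤ p * s * x + p * t * y + p := by omega
            _ ≤ p * s * x + p * t * y + p + (p * s * (y + 1) + p * t * (x + 1) + p * (x + y)) :=
                Nat.le_add_right _ _
            _ = _ := by ring
        · rw [dbound_of_le v _ h1 h2, dbound_of_le v _ h1 h2, dbound_of_le v _ h1 h2, dval_add hX]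
  | exp2 f g _ _ =>
    have := hi.1
    omega
  | psi f g _ ihg =>
    cases hX : (OTerm.psi f g).occurs X
    · exact free hi hX
    · have gg := good_dbound v X hi.2.2
      have gh := good_dbound v X hi
      have ihg := ihg hi.2.2
      have hg := hi.2.2.nat (Function.update v X b)
      have hfb := oeval_update_lt_bpos hi.2.1 le_rfl (by omega) v b
      have hfn := nm_oeval_update_le hi.2.1 le_rfl v b
      have hd := nm_le_dval_psi hi hX v
      have hfpos : 1 ≤ oeval (Function.update v X b) f := hi.2.1.one_le _
      rw [vbox_zero _ gg.nat b.2.nat, nm_natCast] at ihg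
      rw [vbox_zero _ gh.nat b.2.nat, nm_natCast, oeval, nm_natCast, hg]
      generalize oeval (Function.update v X b) f = F at *
      generalize nm (oeval (Function.update v X b) g) = G at *
      have hP : F + bpos X.1.lv (dbound v X g) b.1 1 <
          bpos X.1.lv (dbound v X (OTerm.psi f g)) b.1 1 := by
        refine (add_lt_add_of_lt_of_le hfb le_rfl).trans_le
          (bpos_add_le (fun i h1 h2 => hi.2.1.one_le_dval (.inl h1) v)
            (fun i h1 h2 => gg.pos i h2) (fun i h1 h2 => ?_) 1 le_rfl (by omega))
        rw [dbound_of_le v _ h1 h2, dbound_of_le v _ h1 h2, dval_psi hX, if_neg (by omega)]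
      have hgn := nm_bpos_le' (l := X.1.lv) gg.norm b.2.norm 1
      have hb0 := b.2.pos'
      generalize bpos X.1.lv (dbound v X g) b.1 1 = P at *
      generalize bpos X.1.lv (dbound v X (OTerm.psi f g)) b.1 1 = Q at *
      -- The norm factor makes `s₂` large enough to bound both the number `sz X f` of iterations of
      -- `expG` and the argument at which they start.
      have hs₁ : sz X f ≤ nm (dbound v X (OTerm.psi f g) 0) ∧
          nm (dval v X 0 (OTerm.psi f g) 0) ≤ nm (dbound v X (OTerm.psi f g) 0) ∧
          nm (dbound v X g 0) ≤ nm (dbound v X (OTerm.psi f g) 0) := by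
        rw [nm_dbound_zero v X hi, nm_dbound_zero v X hi.2.2, sz, if_pos hX]
        have hp : 1 ≤ 2 ^ (X.1.lv + 1) := Nat.one_le_two_pow
        have hz := nm_pos (hi.one_le_dval (X := X) (j := 0) (.inr rfl) v)
        generalize 2 ^ (X.1.lv + 1) = p at *
        generalize nm (dval v X 0 (OTerm.psi f g) 0) = z at *
        generalize nm (dval v X 0 g 0) = y at *
        refine ⟨?_, ?_, ?_⟩
        · calc sz X f ≤ sz X f + sz X g + 1 := by omega
            _ = 1 * (sz X f + sz X g + 1) * 1 := by ring
            _ ≤ _ := by gcongr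
        · calc z = 1 * 1 * z := by ring
            _ ≤ _ := by gcongr; omega
        · gcongr <;> omega
      obtain ⟨hs₁, hs₂, hs₃⟩ := hs₁
      set s₁ := nm (dbound v X g 0) + nm (b.1 0) + X.1.lv with hs₁'
      set s₂ := nm (dbound v X (OTerm.psi f g) 0) + nm (b.1 0) + X.1.lv with hs₂'
      calc Psi (om * F + G) ≤ Psi (om * F + ((0 + Psi (om * P + s₁) + 0 : ℕ) : NO)) := by
            refine Psi_le_Psi (by gcongr; omega) ?_
            simp only [nm_add, nm_natCast]
            exact le_Phi (by omega)
        _ ≤ Psi (om * (F + P) + ((0 + s₁ + 0 : ℕ) : NO)) := Psi_om_add_Psi _ _ _ _ _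
        _ ≤ Psi (om * Q + s₂) := by
            refine (Psi_om_lt hP ?_).le
            obtain ⟨L, hL₁, hL₂, hL₃⟩ : ∃ L, sz X f ≤ L ∧ X.1.lv + 1 ≤ L ∧ L ≤ s₂ + 1 :=
              ⟨max (sz X f) (X.1.lv + 1), le_max_left _ _, le_max_right _ _, by omega⟩
            have b₁ := hfn.trans ((expG_iterate_mono (sz X f) (by omega :
              nm (oeval (Function.update v X (oneGVec X.1.lv)) f) + nm (b.1 0) ≤ s₂)).trans
                (expG_iterate_le_iterate hL₁ s₂))
            have b₂ := hgn.trans ((expG_iterate_mono (X.1.lv + 1) (by omega :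
              nm (dbound v X g 0) + nm (b.1 0) ≤ s₂)).trans
                (expG_iterate_le_iterate hL₂ s₂))
            have b₃ := expG_bound_le_Phi (l := L) (s := s₂) (x := s₂) (by omega) le_rfl
            have b₄ := Phi_mono (by omega : s₂ ≤ nm Q + s₂)
            rw [nm_add]
            omega

end GodelT

namespace GodelT
open NO OTerm

/-! ### Vectors of ordinal terms -/

/-- The value of a vector of ordinal terms. -/
noncomputable def veval (v : GVal) (h : OVec OVar) : Vec := fun i => oeval v (h.get i)

/-- The vector has level `m`, and its components belong to the appropriate classes. -/
structure ClsVec (m : ℕ) (h : OVec OVar) : Prop where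
  lv : h.lv = m
  cls : ∀ i ≤ m, Cls (h.get i) i

theorem OVec.get_mk' {V : Type} (l : ℕ) (c : ℕ → OTerm V) (i : ℕ) :
    (OVec.mk' l c).get i = if i ≤ l then c i else .zero := by
  rcases le_or_gt i l with h | h
  · rw [if_pos h, OVec.get, dif_pos (by exact Nat.lt_succ_of_le h)]
    rfl
  · rw [if_neg h.not_ge, OVec.get, dif_neg (by exact fun h' => h.not_ge (Nat.le_of_lt_succ h'))]

theorem OVec.get_of_lt {V : Type} {h : OVec V} {i : ℕ} (hi : h.lv < i) : h.get i = .zero :=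
  dif_neg (by omega)

theorem OVec.get_map {V W : Type} (s : OTerm V → OTerm W) (h : OVec V) {i : ℕ} (hi : i ≤ h.lv) :
    (h.map s).get i = s (h.get i) := by
  rw [OVec.get, OVec.get, dif_pos (Nat.lt_succ_of_le hi), dif_pos (by exact Nat.lt_succ_of_le hi)]
  rfl

theorem veval_mk' (v : GVal) (l : ℕ) (c : ℕ → OTerm OVar) (i : ℕ) :
    veval v (OVec.mk' l c) i = if i ≤ l then oeval v (c i) else 0 := by
  rw [veval, OVec.get_mk']
  split_ifs <;> rfl

theorem veval_of_lt (v : GVal) {h : OVec OVar} {i : ℕ} (hi : h.lv < i) : veval v h i = 0 := by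
  rw [veval, OVec.get_of_lt hi]; rfl

theorem veval_restrict (v : GVal) (l : ℕ) (h : OVec OVar) :
    veval v (h.restrict l) = vres l (veval v h) := funext (veval_mk' v l _)

theorem veval_map_substOne (v : GVal) (X : TVar) (h : OVec OVar) :
    veval v (h.map (substOne X)) = veval (Function.update v X (oneGVec X.1.lv)) h := by
  funext i
  rcases le_or_gt i h.lv with hi | hi
  · rw [veval, OVec.get_map _ _ hi, oeval_substOne, veval]
  · rw [veval_of_lt _ hi, veval_of_lt]
    exact hi

theorem veval_add (v : GVal) (f g : OVec OVar) : veval v (f.add g) = veval v f + veval v g := by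
  funext i
  rw [OVec.add, veval_mk', Pi.add_apply]
  split_ifs with h₁ h₂ h₃
  · rw [veval_of_lt v h₂, add_zero]; rfl
  · rw [veval_of_lt v h₃, zero_add]; rfl
  · rfl
  · rw [veval_of_lt v (by omega : f.lv < i), veval_of_lt v (by omega : g.lv < i), add_zero]

theorem oeval_boxPos (v : GVal) (f g : OVec OVar) :
    ∀ i, oeval v (f.boxPos g i) = bpos g.lv (veval v f) (veval v g) i := by
  refine down_induction g.lv (fun i h => ?_) fun i h ih => ?_
  · rw [OVec.boxPos, if_neg (by omega), bpos_of_lt _ _ h]; rfl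
  · rw [OVec.boxPos, if_pos h, bpos_of_le _ _ h, ← ih]; rfl

theorem veval_box (v : GVal) {f g : OVec OVar} (h : g.lv < f.lv) :
    veval v (f.box g) = vbox g.lv (veval v f) (veval v g) := by
  funext i
  rw [OVec.box, veval_mk']
  rcases eq_or_ne i 0 with rfl | h₂
  · rw [if_pos (Nat.zero_le _), if_pos rfl, vbox, if_pos rfl, oeval, oeval_boxPos]
    split_ifs with h₃
    · rw [h₃, Nat.cast_zero, add_zero]; rfl
    · simp only [oeval, oeval_nmul, mul_one]; rfl
  rw [if_neg h₂]
  split_ifs with h₁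
  · rw [vbox, if_neg h₂, oeval_boxPos]
  · rw [vbox, if_neg (by omega), bpos_of_lt _ _ (by omega), veval_of_lt _ (by omega)]

theorem oeval_sumTo (v : GVal) (h : ℕ → OTerm OVar) (m : ℕ) :
    oeval v (sumTo h m) = ∑ i ∈ Finset.range (m + 1), oeval v (h i) := by
  induction m with
  | zero => simp [sumTo]
  | succ m ih => rw [Finset.sum_range_succ, ← ih]; rfl

theorem Cls.sumTo {h : ℕ → OTerm OVar} {j m : ℕ} (hj : ∀ i ≤ m, Cls (h i) j) :
    Cls (sumTo h m) j := by
  induction m with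
  | zero => exact hj 0 le_rfl
  | succ m ih => exact ⟨ih fun i hi => hj i (by omega), hj _ le_rfl⟩

theorem ClsVec.mk' {m : ℕ} {c : ℕ → OTerm OVar} (h : ∀ i ≤ m, Cls (c i) i) :
    ClsVec m (OVec.mk' m c) :=
  ⟨rfl, fun i hi => by rw [OVec.get_mk', if_pos hi]; exact h i hi⟩

theorem ClsVec.map_substOne {m : ℕ} {h : OVec OVar} (hh : ClsVec m h) (X : TVar) :
    ClsVec m (h.map (substOne X)) :=
  ⟨hh.lv, fun i hi => by
    rw [OVec.get_map _ _ (hh.lv.symm ▸ hi)]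
    exact (hh.cls i hi).substOne⟩

theorem ClsVec.restrict {m l : ℕ} {h : OVec OVar} (hh : ClsVec m h) (hl : l ≤ m) :
    ClsVec l (h.restrict l) :=
  ClsVec.mk' fun i hi => hh.cls i (hi.trans hl)

theorem ClsVec.add {m l : ℕ} {f g : OVec OVar} (hf : ClsVec m f) (hg : ClsVec l g) :
    ClsVec (max m l) (f.add g) := by
  rw [OVec.add, hf.lv, hg.lv]
  refine ClsVec.mk' fun i hi => ?_
  split_ifs with h₁ h₂
  · exact hf.cls i (by omega)
  · exact hg.cls i (by omega)
  · exact ⟨hf.cls i (by omega), hg.cls i (by omega)⟩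

theorem ClsVec.boxPos {m l : ℕ} {f g : OVec OVar} (hf : ClsVec m f) (hg : ClsVec l g)
    (hl : l < m) : ∀ i, 1 ≤ i → i ≤ m → Cls (f.boxPos g i) i := by
  refine down_induction l (fun i h h1 h2 => ?_) fun i h ih h1 h2 => ?_
  · rw [OVec.boxPos, hg.lv, if_neg (by omega)]
    exact hf.cls i h2
  · rw [OVec.boxPos, hg.lv, if_pos h]
    exact ⟨h1, ih (by omega) (by omega), hf.cls i h2, hg.cls i h⟩

theorem ClsVec.box {m l : ℕ} {f g : OVec OVar} (hf : ClsVec m f) (hg : ClsVec l g)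
    (hl : l < m) : ClsVec m (f.box g) := by
  rw [OVec.box, hf.lv, hg.lv]
  refine ClsVec.mk' fun i hi => ?_
  split_ifs with h₁ h₂
  · subst h₁
    exact ⟨rfl, hf.boxPos hg hl 1 le_rfl (by omega), hf.cls 0 hi, hg.cls 0 (by omega)⟩
  · subst h₁
    exact ⟨rfl, hf.boxPos hg hl 1 le_rfl (by omega), ⟨hf.cls 0 hi, hg.cls 0 (by omega)⟩,
      Cls.nmul (h := .one) trivial (by omega)⟩
  · exact hf.boxPos hg hl i (by omega) hi

theorem one_le_normFactor (X : TVar) (h : OVec OVar) : 1 ≤ OVec.normFactor X h :=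
  Nat.mul_pos (Nat.pow_pos (by norm_num))
    ((one_le_sz X (h.get 0)).trans (Finset.single_le_sum (f := fun i => sz X (h.get i))
      (fun _ _ => Nat.zero_le _) (Finset.mem_range.2 (Nat.succ_pos _))))

theorem ClsVec.delta {m : ℕ} {h : OVec OVar} (hh : ClsVec m h) (X : TVar) :
    ClsVec (max (X.1.lv + 1) m) (h.delta X) := by
  rw [OVec.delta, hh.lv]
  refine ClsVec.mk' fun j hj => ?_
  split_ifs with h₁ h₂
  · subst h₁
    exact Cls.nmul ((hh.cls 0 (Nat.zero_le _)).deltaPart (.inr rfl)) (one_le_normFactor X h)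
  · exact Cls.sumTo fun i hi => (hh.cls i hi).deltaPart (.inl (by omega))
  · exact hh.cls j (by omega)

/-! ### The operator `δ^x` -/

section Delta

variable {m : ℕ} {h : OVec OVar} {X : TVar} {v : GVal}

theorem veval_delta_zero (hh : ClsVec m h) : veval v (h.delta X) 0 =
    ((OVec.normFactor X h * nm (dval v X 0 (h.get 0) 0) : ℕ) : NO) := by
  rw [OVec.delta, veval_mk', if_pos (Nat.zero_le _), if_pos rfl, oeval_nmul, Nat.cast_mul,
    ← (hh.cls 0 (Nat.zero_le _)).dval_nat]
  rfl

theorem veval_delta_of_le (hh : ClsVec m h) {j : ℕ} (h1 : 1 ≤ j) (h2 : j ≤ X.1.lv + 1) :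
    veval v (h.delta X) j = ∑ i ∈ Finset.range (m + 1), dval v X i (h.get i) j := by
  rw [OVec.delta, veval_mk', if_pos (by omega), if_neg (by omega), if_pos h2, oeval_sumTo, hh.lv]
  rfl

theorem veval_delta_of_lt {j : ℕ} (hj : X.1.lv + 1 < j) :
    veval v (h.delta X) j = veval v h j := by
  rw [OVec.delta, veval_mk', if_neg (by omega : ¬ j = 0), if_neg (by omega : ¬ j ≤ X.1.lv + 1)]
  split_ifs with h'
  · rfl
  · exact (veval_of_lt v (by omega)).symm

theorem dval_le_veval_delta (hh : ClsVec m h) {i j : ℕ} (hi : i ≤ m) (h1 : 1 ≤ j)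
    (h2 : j ≤ X.1.lv + 1) : dval v X i (h.get i) j ≤ veval v (h.delta X) j := by
  rw [veval_delta_of_le hh h1 h2]
  exact Finset.single_le_sum (f := fun i => dval v X i (h.get i) j) (fun _ _ => zero_le _)
    (Finset.mem_range.2 (by omega))

theorem nm_sum {ι : Type} (s : Finset ι) (f : ι → NO) : nm (∑ i ∈ s, f i) = ∑ i ∈ s, nm (f i) := by
  classical
  induction s using Finset.induction_on with
  | empty => simp
  | insert a s ha ih => rw [Finset.sum_insert ha, Finset.sum_insert ha, nm_add, ih]

theorem nm_dval_le_mul (hh : ClsVec m h) (hg : ∀ v, Good m (veval v h)) {i j : ℕ} (hi : i ≤ m)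
    (h2 : j ≤ X.1.lv + 1) : nm (dval v X i (h.get i) j) ≤
      2 ^ (X.1.lv + 1) * sz X (h.get i) * nm (dval v X 0 (h.get 0) 0) := by
  have h₀ := hh.cls 0 (Nat.zero_le _)
  rcases Nat.eq_zero_or_pos i with rfl | h1
  · exact nm_dval_zero_le h₀ v j
  rcases le_or_gt i (X.1.lv + 1) with hX | hX
  · refine (nm_dval_le (hh.cls i hi) h1 hX v j).trans ?_
    rw [← mul_assoc]
    gcongr
    · norm_num
    · omega
    · exact ((hg _).norm i).trans (nm_oeval_one_le_dval h₀ v)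
  · rw [dval_of_free ((hh.cls i hi).free (by omega)), if_neg (by omega), nm_one]
    exact Nat.mul_pos (Nat.mul_pos (Nat.pow_pos (by norm_num)) (one_le_sz _ _))
      (nm_pos (h₀.one_le_dval (.inr rfl) v))

theorem good_veval_delta (hh : ClsVec m h) (hg : ∀ v, Good m (veval v h)) :
    Good (max (X.1.lv + 1) m) (veval v (h.delta X)) := by
  have h₀ := hh.cls 0 (Nat.zero_le _)
  have hd := hh.delta X
  refine ⟨?_, fun i hi => (hd.cls i hi).one_le v, fun j => ?_,
    fun i hi => veval_of_lt v (by rw [hd.lv]; exact hi)⟩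
  · rw [veval_delta_zero hh, nm_natCast]
  · rcases Nat.eq_zero_or_pos j with rfl | h1
    · exact le_rfl
    rw [veval_delta_zero hh, nm_natCast]
    rcases le_or_gt j (X.1.lv + 1) with h2 | h2
    · rw [veval_delta_of_le hh h1 h2, nm_sum, OVec.normFactor, hh.lv, Finset.mul_sum,
        Finset.sum_mul]
      exact Finset.sum_le_sum fun i hi =>
        nm_dval_le_mul hh hg (by simpa [Nat.lt_succ_iff] using hi) h2
    · rw [veval_delta_of_lt h2]
      refine le_trans ?_ (Nat.le_mul_of_pos_left _ (one_le_normFactor X h))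
      refine le_trans ?_ (nm_oeval_one_le_dval h₀ v)
      refine le_trans (le_of_eq ?_) ((hg (Function.update v X (oneGVec X.1.lv))).norm j)
      rcases le_or_gt j m with hj | hj
      · rw [veval, veval, oeval_update_of_free ((hh.cls j hj).free (by omega))]
      · rw [veval_of_lt _ (hh.lv.symm ▸ hj), veval_of_lt _ (hh.lv.symm ▸ hj)]

/-- Strictness in component `0` comes from the positive summand `e 0`. In a positive component `i`
up to `lv x + 1`, the sum over all `δ_k h_k` dominates the part `δ_i h_i`, so `oeval_update_lt_bpos`
applies; higher components do not contain `x`. -/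
theorem prec_veval_delta (hh : ClsVec m h) (hg : ∀ v, Good m (veval v h)) (b : GVec X.1.lv)
    {e : Vec} (he : Good m e) :
    Prec (veval (Function.update v X b) h)
      (vres m (vbox X.1.lv (veval v (h.delta X) + e) b.1)) := by
  have h₀ := hh.cls 0 (Nat.zero_le _)
  have gd := (good_veval_delta (v := v) (X := X) hh hg).add he
  have hle : ∀ i, veval v (h.delta X) i ≤ (veval v (h.delta X) + e) i := fun i =>
    le_add_of_nonneg_right (zero_le _)
  have h0 : veval (Function.update v X b) h 0 < vbox X.1.lv (veval v (h.delta X) + e) b.1 0 := by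
    have gb := good_dbound v X h₀
    have hn := (gb.vbox b.2 (by omega)).nat
    have h₁ := oeval_update_le_vbox h₀ v b
    refine lt_of_le_of_lt (b := vbox X.1.lv (dbound v X (h.get 0)) b.1 0) ?_ ?_
    · rw [(hg _).nat, hn]
      exact_mod_cast h₁
    · have hlt : dbound v X (h.get 0) 0 < (veval v (h.delta X) + e) 0 := by
        refine lt_of_le_of_lt (b := veval v (h.delta X) 0) ?_ ?_
        · rw [veval_delta_zero hh, gb.nat, nm_dbound_zero v X h₀, OVec.normFactor, Nat.cast_le]
          gcongr
          exact Finset.single_le_sum (f := fun i => sz X (h.get i)) (fun _ _ => Nat.zero_le _)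
            (Finset.mem_range.2 (Nat.succ_pos _))
        · exact lt_add_of_pos_right _ (one_le_iff_pos.1 (he.pos 0 (Nat.zero_le _)))
      refine vbox_zero_lt gb gd b.2 b.2 (fun i h1 h2 => ?_) hlt.le (fun _ => le_rfl) (.inl hlt)
      rw [dbound_of_le v _ h1 h2]
      exact (dval_le_veval_delta hh (Nat.zero_le _) h1 h2).trans (hle i)
  refine ⟨h0, fun i => ?_⟩
  rcases Nat.eq_zero_or_pos i with rfl | h1
  · exact h0.le
  rcases le_or_gt i m with hi | hi
  · rw [vres_of_le _ hi, vbox_pos _ _ (by omega)]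
    rcases le_or_gt i (X.1.lv + 1) with h2 | h2
    · refine (oeval_update_lt_bpos (hh.cls i hi) h1 h2 v b).le.trans
        (bpos_mono' (fun j h1 h2 => ?_) (fun _ _ _ => le_rfl) i h1 h2)
      exact (dval_le_veval_delta hh hi h1 h2).trans (hle j)
    · refine le_trans ?_ ((hle i).trans (le_bpos _ _ i))
      rw [veval_delta_of_lt h2, veval, veval,
        oeval_update_of_free ((hh.cls i hi).free (by omega))]
  · rw [veval_of_lt _ (hh.lv.symm ▸ hi)]
    exact zero_le _

end Delta

/-! ### The canonical assignment is an assignment -/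

/-- The environment that is given by the valuation. -/
def valEnv : TVar → GVal → Vec := fun X v => (v X).1

theorem goodEnv_valEnv : GoodEnv valEnv := fun X v => (v X).2

theorem clsVec_canon : ∀ {σ : FType} (A : Term σ), A.InT → ClsVec σ.lv (canon A)
  | _, .var σ k, _ => ⟨rfl, fun i hi => by
      rw [canon, OVec.get, dif_pos (Nat.lt_succ_of_le hi)]
      exact rfl⟩
  | _, .zero, _ => ClsVec.mk' fun _ _ => trivial
  | _, .succ, _ => ClsVec.mk' fun _ _ => trivial
  | _, .caseD τ, _ => by rw [lv_caseT]; exact ClsVec.mk' fun _ _ => trivial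
  | _, .recR τ, _ => by
      rw [lv_recR]
      refine ClsVec.mk' fun i _ => ?_
      split_ifs
      · exact ⟨trivial, trivial⟩
      · change 1 ≤ i
        omega
      · trivial
  | _, .app B C, h => by
      refine ((clsVec_canon B h.1).box (clsVec_canon C h.2) ?_).restrict ?_ <;> rw [lv_arrow] <;>
        omega
  | _, .lam ρ k G, h => by
      have := ((clsVec_canon G h).delta (ρ, k)).add ((clsVec_canon G h).map_substOne (ρ, k))
      rwa [max_assoc, max_self] at this

theorem assign_canon : ∀ {σ : FType} (A : Term σ), A.InT →
    Assign False A GVal valEnv (fun v => veval v (canon A))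
  | _, .var σ k, _ => by
      funext v i
      rcases le_or_gt i σ.lv with hi | hi
      · rw [canon, veval, OVec.get, dif_pos (Nat.lt_succ_of_le hi)]
        rfl
      · exact (veval_of_lt v hi).trans ((v (σ, k)).2.zero i hi).symm
  | _, .zero, _ => funext fun v => funext (veval_mk' v _ _)
  | _, .succ, _ => funext fun v => funext (veval_mk' v _ _)
  | _, .caseD τ, _ => funext fun v => funext (veval_mk' v _ _)
  | _, .recR τ, _ => by
      funext v
      funext i
      rw [canon, veval_mk']
      simp only [recVec]
      split_ifs <;> first | rfl | omega
  | _, .app (σ := σ) (τ := τ) B C, h => by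
      refine ⟨_, _, assign_canon B h.1, assign_canon C h.2, .inl (funext fun v => ?_)⟩
      have hB := (clsVec_canon B h.1).lv
      have hC := (clsVec_canon C h.2).lv
      rw [canon, veval_restrict, veval_box, hC]
      rw [hB, hC, lv_arrow]
      omega
  | _, .lam (σ := σ) ρ k G, h => by
      have hc := clsVec_canon G h
      have hg : ∀ v, Good σ.lv (veval v (canon G)) := (assign_canon G h).good goodEnv_valEnv
      refine ⟨fun v => veval v ((canon G).delta (ρ, k)),
        fun p => veval (Function.update p.1 (ρ, k) p.2) (canon G), fun v => good_veval_delta (X := (ρ, k)) hc hg,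
        fun v b e he => prec_veval_delta (X := (ρ, k)) hc hg b he, ?_, funext fun v => ?_⟩
      · refine (assign_canon G h).comp (fun p : GVal × GVec ρ.lv =>
          Function.update p.1 (ρ, k) p.2) fun X _ p => ?_
        simp only [envExt, valEnv]
        split_ifs with e
        · subst e
          rw [Function.update_self]
        · rw [Function.update_of_ne e]
      · rw [canon, veval_add, veval_map_substOne]

end GodelT

namespace GodelT
open NO OTerm

/-! ### Terms with `R^t` -/

/-- All `R_τ^t` are replaced by `R_τ t`. -/
def Term.toT : {σ : FType} → Term σ → Term σ
  | _, .recSup τ t => .app (.recR τ) (toT t)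
  | _, .app B C => .app (toT B) (toT C)
  | _, .lam ρ k B => .lam ρ k (toT B)
  | _, A => A

theorem Term.inT_toT : ∀ {σ : FType} (A : Term σ), A.toT.InT
  | _, .var _ _ | _, .zero | _, .succ | _, .caseD _ | _, .recR _ => trivial
  | _, .recSup _ t => ⟨trivial, inT_toT t⟩
  | _, .app B C => ⟨inT_toT B, inT_toT C⟩
  | _, .lam _ _ B => inT_toT B

theorem Term.red'_toT : ∀ {σ : FType} (A : Term σ), Relation.ReflTransGen Red' A.toT A
  | _, .var _ _ | _, .zero | _, .succ | _, .caseD _ | _, .recR _ => .refl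
  | _, .recSup τ t =>
      Relation.ReflTransGen.tail
        ((red'_toT t).lift (fun s => Term.app (.recR τ) s) fun _ _ => .appArg) (.R_sup t)
  | _, .app B C =>
      ((red'_toT B).lift (fun D => Term.app D C.toT) fun _ _ => .appFun).trans
        ((red'_toT C).lift (fun D => Term.app B D) fun _ _ => .appArg)
  | _, .lam ρ k B => (red'_toT B).lift (fun D => Term.lam ρ k D) fun _ _ => .xi

/-- `A` is a reduct in `λβR'` of the term `A.toT` in `T`, and assignments are transported along
reductions, starting from the canonical one. -/
theorem exists_assign {σ : FType} (A : Term σ) : ∃ a, Assign False A GVal valEnv a := by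
  refine A.red'_toT.rec (motive := fun B _ => ∃ a, Assign False B GVal valEnv a)
    ⟨_, assign_canon _ A.inT_toT⟩ ?_
  rintro B C - h ⟨a, ha⟩
  obtain ⟨b, hb, -⟩ := ha.red' h goodEnv_valEnv
  exact ⟨b, hb⟩

/-! ### Closed assignments -/

/-- The valuation of all variable vectors by `⟨1, …, 1⟩`. -/
noncomputable def oneVal : GVal := fun X => oneGVec X.1.lv

theorem interp_bind_one (h : OTerm OVar) :
    (h.bind fun _ => (.one : OTerm Empty)).interp = (oeval oneVal h).1 := by
  induction h with
  | var x =>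
    simp only [OTerm.bind, interp, oeval, oneVal, oneGVec, oneVec]
    rw [if_pos (by have := x.2.2; omega)]
    rfl
  | zero => rfl
  | one => rfl
  | omega => rfl
  | add f g ihf ihg => simp only [OTerm.bind, interp, ihf, ihg]; rfl
  | exp2 f g ihf ihg => simp only [OTerm.bind, interp, ihf, ihg]; rfl
  | psi f g ihf ihg =>
    simp only [OTerm.bind, interp, ihf, ihg, oeval, val_natCast]
    rfl

theorem interp_closedCanon {σ : FType} (A : Term σ) (hA : A.InT) :
    ((closedCanon A).get 0).interp = (nm (veval oneVal (canon A) 0) : Ordinal.{0}) := by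
  have h := ((clsVec_canon A hA).cls 0 (Nat.zero_le _)).nat oneVal
  rw [closedCanon, OVec.get_map _ _ (Nat.zero_le _), interp_bind_one, h, val_natCast]
  rfl

/-! ### Heights of reduction trees -/

section Height

variable {α : Type} {step : α → α → Prop} {M : α → ℕ → Prop}

theorem exists_measure (hM : ∀ a b k, step a b → M a k → ∃ l < k, M b l) {f : ℕ → α} {n k : ℕ}
    (hf : ∀ i < n, step (f i) (f (i + 1))) (h : M (f 0) k) :
    ∀ i ≤ n, ∃ l, M (f i) l ∧ l + i ≤ k := by
  intro i hi
  induction i with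
  | zero => exact ⟨k, h, le_rfl⟩
  | succ i ih =>
    obtain ⟨l, hl, hlk⟩ := ih (by omega)
    obtain ⟨l', hl', h'⟩ := hM _ _ _ (hf i hi) hl
    exact ⟨l', h', by omega⟩

theorem treeHeight_le (hM : ∀ a b k, step a b → M a k → ∃ l < k, M b l)
    (hpos : ∀ a k, M a k → 1 ≤ k) {a : α} {k : ℕ} (h : M a k) : treeHeight step a ≤ k := by
  refine iSup₂_le fun n hn => ?_
  obtain ⟨f, rfl, hf⟩ := hn
  obtain ⟨l, hl, hlk⟩ := exists_measure hM hf h n le_rfl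
  have := hpos _ _ hl
  exact_mod_cast (by omega : n + 1 ≤ k)

theorem stronglyNormalizing_of_measure (hM : ∀ a b k, step a b → M a k → ∃ l < k, M b l)
    {a : α} {k : ℕ} (h : M a k) : StronglyNormalizing step a := by
  rintro ⟨f, rfl, hf⟩
  obtain ⟨l, -, hlk⟩ := exists_measure hM (fun i _ => hf i) h (k + 1) le_rfl
  omega

end Height

/-- `k` is the component `0` of a closed assignment to `A`. -/
def Bound (p : Prop) {σ : FType} (A : Term σ) (k : ℕ) : Prop :=
  ∃ a, Assign p A GVal valEnv a ∧ nm (a oneVal 0) = k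

section Bound

variable {p : Prop} {σ : FType} {A B : Term σ} {k : ℕ}

theorem Bound.pos (h : Bound p A k) : 1 ≤ k := by
  obtain ⟨a, ha, rfl⟩ := h
  exact (ha.good goodEnv_valEnv oneVal).pos'

theorem Bound.of_false (h : Bound False A k) : Bound p A k := by
  obtain ⟨a, ha, h⟩ := h
  exact ⟨a, ha.of_false, h⟩

theorem Bound.alphaEq (h : Bound p A k) (hAB : A.AlphaEq B) : Bound p B k := by
  obtain ⟨a, ha, h⟩ := h
  exact ⟨a, (Assign.alphaEq_iff hAB).1 ha, h⟩

theorem Bound.of_prec (h : ∀ {a}, Assign p A GVal valEnv a →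
      ∃ b, Assign p B GVal valEnv b ∧ ∀ w, Prec (b w) (a w)) (hA : Bound p A k) :
    ∃ l < k, Bound p B l := by
  obtain ⟨a, ha, rfl⟩ := hA
  obtain ⟨b, hb, hba⟩ := h ha
  exact ⟨_, nat_lt_of_lt (hb.good goodEnv_valEnv _).nat (ha.good goodEnv_valEnv _).nat
    (hba oneVal).1, b, hb, rfl⟩

theorem Bound.red (A B : Term σ) (k : ℕ) (h : Term.Red A B) (hA : Bound True A k) :
    ∃ l < k, Bound True B l :=
  hA.of_prec (Assign.red h goodEnv_valEnv)

theorem Bound.red' (A B : Term σ) (k : ℕ) (h : Term.Red' A B) (hA : Bound False A k) :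
    ∃ l < k, Bound False B l :=
  hA.of_prec (Assign.red' h goodEnv_valEnv)

theorem Bound.alphaRed {step : Term σ → Term σ → Prop}
    (hstep : ∀ A B k, step A B → Bound p A k → ∃ l < k, Bound p B l)
    (A B : Term σ) (k : ℕ) (h : Term.AlphaRed step A B) (hA : Bound p A k) :
    ∃ l < k, Bound p B l := by
  obtain ⟨-, -, B', hB, hα⟩ := h
  obtain ⟨l, hl, h⟩ := hstep _ _ _ hB hA
  exact ⟨l, hl, h.alphaEq hα⟩

theorem bound_canon (hA : A.InT) : Bound False A (nm (veval oneVal (canon A) 0)) :=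
  ⟨_, assign_canon A hA, rfl⟩

theorem exists_bound (A : Term σ) : ∃ k, Bound False A k :=
  let ⟨a, ha⟩ := exists_assign A
  ⟨_, a, ha, rfl⟩

end Bound

end GodelT

theorem corollary3p5 :
    (∀ (σ : GodelT.FType) (A : GodelT.Term σ), A.InT →
      ∃ a₀ : ℕ, ((GodelT.closedCanon A).get 0).interp = (a₀ : Ordinal.{0}) ∧
        ∀ A' : GodelT.Term σ, GodelT.Term.AlphaEq A A' → A'.WellNamed →
          GodelT.treeHeight (GodelT.Term.AlphaRed GodelT.Term.Red) A' ≤ (a₀ : ℕ∞) ∧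
          GodelT.treeHeight (GodelT.Term.AlphaRed GodelT.Term.Red') A' ≤ (a₀ : ℕ∞)) ∧
    (∀ (σ : GodelT.FType) (A : GodelT.Term σ), A.InT →
      GodelT.StronglyNormalizing GodelT.Term.Red A ∧
      GodelT.StronglyNormalizing (GodelT.Term.AlphaRed GodelT.Term.Red) A) ∧
    (∀ (σ : GodelT.FType) (A : GodelT.Term σ),
      GodelT.StronglyNormalizing GodelT.Term.Red' A ∧
      GodelT.StronglyNormalizing (GodelT.Term.AlphaRed GodelT.Term.Red') A) := by
  refine ⟨fun σ A hA => ⟨_, GodelT.interp_closedCanon A hA, fun A' hα _ => ?_⟩,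
    fun σ A _ => ?_, fun σ A => ?_⟩
  · have h := (GodelT.bound_canon hA).alphaEq hα
    -- The same number bounds both trees: an assignment without the alternative for `R t` is also
    -- one with it.
    exact ⟨GodelT.treeHeight_le (GodelT.Bound.alphaRed GodelT.Bound.red) (fun _ _ => GodelT.Bound.pos)
        (h.of_false (p := True)),
      GodelT.treeHeight_le (GodelT.Bound.alphaRed GodelT.Bound.red') (fun _ _ => GodelT.Bound.pos) h⟩
  · obtain ⟨k, h⟩ := GodelT.exists_bound A
    exact ⟨GodelT.stronglyNormalizing_of_measure GodelT.Bound.red (h.of_false (p := True)),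
      GodelT.stronglyNormalizing_of_measure (GodelT.Bound.alphaRed GodelT.Bound.red)
        (h.of_false (p := True))⟩
  · obtain ⟨k, h⟩ := GodelT.exists_bound A
    exact ⟨GodelT.stronglyNormalizing_of_measure GodelT.Bound.red' h,
      GodelT.stronglyNormalizing_of_measure (GodelT.Bound.alphaRed GodelT.Bound.red') h⟩
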